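/- Let $T>0$, $\Omega_x=(a,b)\subset\mathbb R$ a bounded interval, $\tilde Q_T=[0,T]\times\Omega_x$, $K\subset\Omega_x$ compact, $k\ge 1$ an integer, and $\delta_0,c_0>0$. Put $$M_1=\begin{pmatrix}0&0&0\\1&0&0\\0&1&0\\0&0&1\end{pmatrix},\qquad M_2=\begin{pmatrix}1&0&0\\0&0&0\\0&0&1\\0&1&0\end{pmatrix},\qquad \hat g=(g_1,g_1,g_2,g_3)^T .$$ There exists a constant $C$, depending only on $T,a,b,K,k,\delta_0,c_0$, such that the following holds. Let $0=t_0<\dots<t_M=T$ and $a=x_0<\dots<x_N=b$ be partitions all of whose steps $t_m-t_{m-1}$ and $x_j-x_{j-1}$ lie in $[c_0h,h]$, where $h>0$; put $I_m=(t_{m-1},t_m]$, $S_m=I_m\times\Omega_x$, $\delta=\delta_0h$. Let $\tilde V_h$ be the space of functions $g:\bigcup_m S_m\to\mathbb R^3$ that on each slab $S_m$ are in $H^1$, vanish for $x\in\{a,b\}$, and on each $I_m\times(x_{j-1},x_j)$ are polynomials of degree at most $k$ in $t$ and in $x$ (jumps across the times $t_m$ are allowed). Let $b^{h,i-1}=(\rho,-j_1,-j_2,0)^T\in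 L_2(\tilde Q_T)^4$ be the source produced by the density $f^{h,i-1}(t,x,v)$ of the previous iteration step, $$\rho=\int_{\Omega_v}f^{h,i-1}\,dv-\rho_b(x),\qquad j_l=\int_{\Omega_v}\hat v_l f^{h,i-1}\,dv,\qquad \hat v=\frac{v}{\sqrt{1+|v|^2}},$$ where $f^{h,i-1}(t,x,\cdot)$ is integrable over $\Omega_v\subset\mathbb R^2$ for almost every $(t,x)$. Let $W^i=(E_1^i,E_2^i,B^i)^T\in C([0,T];L_2(\Omega_x))^3$ be an exact (weak) solution of $$M_1W^i_t+M_2W^i_x=b^{h,i-1},\qquad W^i(0,\cdot)=W^0,$$ such that $W^i(t,\cdot)$ is supported in $K$ for every $t\in[0,T]$. Let $W^{h,i}\in\tilde V_h$ be a streamline diffusion solution, that is, for $m=1,\dots,M$ and all $g\in\tilde V_h$, $$(M_1W^{h,i}_t+M_2W^{h,i}_x,\hat g+\delta(M_1g_t+M_2g_x))_{S_m}+\langle W^{h,i}_+,g_+\rangle_{m-1}=(b^{h,i-1},\hat g+\delta(M_1g_t+M_2g_x))_{S_m}+\langle W^{h,i}_-,g_+\rangle_{m-1},$$ where $\langle u,w\rangle_m=\int_{\Omega_x}u(t_m,x)\cdot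 w(t_m,x)\,dx$, the subscripts $\pm$ denote one-sided limits in time, and $W^{h,i}_-(t_0,\cdot)=W^0$. Define the residuals $$\tilde R_1^i|_{S_m}=b^{h,i-1}-M_1W_t^{h,i}-M_2W_x^{h,i},\qquad \tilde R_2^i|_{S_m}=\frac{W^{h,i}_+(t_{m-1},x)-W^{h,i}_-(t_{m-1},x)}{h}.$$ Then the numerical error $\tilde e^i=W^i-W^{h,i}$ satisfies, at the final time (where $W^{h,i}(T,\cdot)=W^{h,i}_-(T,\cdot)$), $$\|\tilde e^i(T,\cdot)\|_{H^{-1}(\Omega_x)}\le C\Big(\|h\tilde R_1^i\|_{L_2(\tilde Q_T)}+\|h\tilde R_2^i\|_{L_2(\tilde Q_T)}\Big),$$ where $\|u\|_{H^{-1}(\Omega_x)}=\sup\{(u,\chi)_{L_2(\Omega_x)}/\|\chi\|_{H^1(\Omega_x)}:\ 0\ne\chi\in C_0^\infty(\Omega_x)^3\}$. -/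

import Mathlib

open MeasureTheory Set Filter Topology
open scoped ENNReal ContDiff Matrix

noncomputable section

namespace VlasovMaxwell

/-- `ℝ^n` with the Euclidean norm. -/
abbrev Vec (n : ℕ) := EuclideanSpace ℝ (Fin n)

/-! ### The Maxwell system `M₁ W_t + M₂ W_x = b` for `W = (E₁, E₂, B)` -/

def M₁ : Matrix (Fin 4) (Fin 3) ℝ := !![0, 0, 0; 1, 0, 0; 0, 1, 0; 0, 0, 1]

def M₂ : Matrix (Fin 4) (Fin 3) ℝ := !![1, 0, 0; 0, 0, 0; 0, 0, 1; 0, 1, 0]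

/-- Matrix times column vector, between Euclidean spaces. -/
def act (A : Matrix (Fin 4) (Fin 3) ℝ) (w : Vec 3) : Vec 4 := WithLp.toLp 2 (A *ᵥ w.ofLp)

/-- `ĝ = (g₁, g₁, g₂, g₃)`. -/
def hat (g : Vec 3) : Vec 4 := !₂[g 0, g 0, g 1, g 2]

def dt (w : ℝ → ℝ → Vec 3) (t x : ℝ) : Vec 3 := deriv (fun s => w s x) t

def dx (w : ℝ → ℝ → Vec 3) (t x : ℝ) : Vec 3 := deriv (fun y => w t y) x

/-- `M₁ w_t + M₂ w_x` at `p = (t, x)`. -/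
def maxwellOp (w : ℝ → ℝ → Vec 3) (p : ℝ × ℝ) : Vec 4 :=
  act M₁ (dt w p.1 p.2) + act M₂ (dx w p.1 p.2)

/-- Relativistic velocity `v̂ = v / √(1 + |v|²)`. -/
def vhat (v : Vec 2) : Vec 2 := (Real.sqrt (1 + ‖v‖ ^ 2))⁻¹ • v

/-- The right-hand side `b = (ρ, -j₁, -j₂, 0)` produced by a phase-space density `f(t, x, v)` and a
background density `ρb(x)`: `ρ = ∫ f dv - ρb`, `j_l = ∫ v̂_l f dv`, integrals over `Ωv`. -/
def source (Ωv : Set (Vec 2)) (ρb : ℝ → ℝ) (f : ℝ → ℝ → Vec 2 → ℝ) (p : ℝ × ℝ) : Vec 4 :=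
  !₂[(∫ v in Ωv, f p.1 p.2 v) - ρb p.2,
     -∫ v in Ωv, vhat v 0 * f p.1 p.2 v,
     -∫ v in Ωv, vhat v 1 * f p.1 p.2 v,
     0]

/-- The space-time cylinder `[0, T] × Ω_x`, `Ω_x = (a, b)`. -/
def cylinder (T a b : ℝ) : Set (ℝ × ℝ) := Icc 0 T ×ˢ Ioo a b

/-- `W ∈ C([0, T]; L₂(a, b))³` is a weak solution of `M₁ W_t + M₂ W_x = F` on `(0, T) × (a, b)`
with `W(0, ·) = W0`. -/
structure IsMaxwellSolution (T a b : ℝ) (F : ℝ × ℝ → Vec 4) (W0 : ℝ → Vec 3)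
    (W : ℝ → ℝ → Vec 3) : Prop where
  memLp : MemLp (Function.uncurry W) 2 (volume.restrict (cylinder T a b))
  memLp_slice : ∀ t ∈ Icc 0 T, MemLp (W t) 2 (volume.restrict (Ioo a b))
  continuous : ∀ t ∈ Icc 0 T,
    Tendsto (fun s => eLpNorm (W s - W t) 2 (volume.restrict (Ioo a b))) (𝓝[Icc 0 T] t) (𝓝 0)
  initial : W 0 =ᵐ[volume.restrict (Ioo a b)] W0
  equation : ∀ ψ : ℝ × ℝ → Vec 4, ContDiff ℝ ∞ ψ → HasCompactSupport ψ →
    tsupport ψ ⊆ univ ×ˢ Ioo a b → ∀ t ∈ Icc 0 T,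
    (∫ x in Ioo a b, inner ℝ (act M₁ (W t x)) (ψ (t, x)))
      - (∫ x in Ioo a b, inner ℝ (act M₁ (W0 x)) (ψ (0, x)))
      - (∫ p in cylinder t a b,
          (inner ℝ (act M₁ (W p.1 p.2)) (deriv (fun s => ψ (s, p.2)) p.1)
            + inner ℝ (act M₂ (W p.1 p.2)) (deriv (fun y => ψ (p.1, y)) p.2)))
      = ∫ p in cylinder t a b, inner ℝ (F p) (ψ p)

/-! ### Meshes and finite element spaces -/

/-- A partition `0 = t₀ < ⋯ < t_M = T` of the time interval and a partition
`a = x₀ < ⋯ < x_N = b` of the space interval. -/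
structure Mesh (T a b : ℝ) where
  M : ℕ
  N : ℕ
  t : Fin (M + 1) → ℝ
  x : Fin (N + 1) → ℝ
  t_strictMono : StrictMono t
  x_strictMono : StrictMono x
  t_zero : t 0 = 0
  t_last : t (Fin.last M) = T
  x_zero : x 0 = a
  x_last : x (Fin.last N) = b

variable {T a b : ℝ}

/-- All time steps and all space elements have length between `c₀ h` and `h`. -/
def Mesh.IsQuasiUniform (𝒯 : Mesh T a b) (c₀ h : ℝ) : Prop :=
  (∀ m : Fin 𝒯.M, c₀ * h ≤ 𝒯.t m.succ - 𝒯.t m.castSucc ∧ 𝒯.t m.succ - 𝒯.t m.castSucc ≤ h) ∧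
  (∀ j : Fin 𝒯.N, c₀ * h ≤ 𝒯.x j.succ - 𝒯.x j.castSucc ∧ 𝒯.x j.succ - 𝒯.x j.castSucc ≤ h)

/-- The slab `S_m = I_m × Ω_x`, where `I_m` is the half-open `m`-th time interval
(slabs are counted from `0`). -/
def Mesh.slab (𝒯 : Mesh T a b) (m : Fin 𝒯.M) : Set (ℝ × ℝ) :=
  Ioc (𝒯.t m.castSucc) (𝒯.t m.succ) ×ˢ Ioo a b

/-- The finite element space. An element is a family `g`, one function per slab
(it may jump from slab to slab). `g m t x` is the continuous representative on the closed slab: on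
every closed space-time element it is a polynomial of degree at most `k` in `t` and in `x`, so that
it is continuous across the space nodes, i.e. `H¹` on the slab, and it vanishes for `x = a`
and `x = b`. Values outside the closed slab are irrelevant. -/
def Mesh.feSpace (𝒯 : Mesh T a b) (k : ℕ) : Set (Fin 𝒯.M → ℝ → ℝ → Vec 3) :=
  {g | ∀ m : Fin 𝒯.M,
    (∀ j : Fin 𝒯.N, ∃ c : Fin (k + 1) → Fin (k + 1) → Vec 3,
      ∀ t ∈ Icc (𝒯.t m.castSucc) (𝒯.t m.succ), ∀ x ∈ Icc (𝒯.x j.castSucc) (𝒯.x j.succ),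
        g m t x = ∑ i : Fin (k + 1), ∑ l : Fin (k + 1), (t ^ (i : ℕ) * x ^ (l : ℕ)) • c i l) ∧
    (∀ t ∈ Icc (𝒯.t m.castSucc) (𝒯.t m.succ), g m t a = 0 ∧ g m t b = 0)}

/-- Limit from above in time at the initial time of the `m`-th slab. -/
def Mesh.plus (𝒯 : Mesh T a b) (g : Fin 𝒯.M → ℝ → ℝ → Vec 3) (m : Fin 𝒯.M) (x : ℝ) : Vec 3 :=
  g m (𝒯.t m.castSucc) x

/-- Limit from below in time at a time node; at `t₀ = 0` it is the initial datum `W0`. -/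
def Mesh.minus (𝒯 : Mesh T a b) (W0 : ℝ → Vec 3) (w : Fin 𝒯.M → ℝ → ℝ → Vec 3) :
    Fin (𝒯.M + 1) → ℝ → Vec 3 :=
  Fin.cases W0 (fun m x => w m (𝒯.t m.succ) x)

/-- `Wh` is the streamline diffusion solution of degree `k` with parameter `δ`, right-hand side `F`
and initial datum `W0`. -/
def Mesh.IsSDSolution (𝒯 : Mesh T a b) (k : ℕ) (δ : ℝ) (F : ℝ × ℝ → Vec 4) (W0 : ℝ → Vec 3)
    (Wh : Fin 𝒯.M → ℝ → ℝ → Vec 3) : Prop :=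
  Wh ∈ 𝒯.feSpace k ∧
  ∀ m : Fin 𝒯.M, ∀ g ∈ 𝒯.feSpace k,
    (∫ p in 𝒯.slab m,
        inner ℝ (maxwellOp (Wh m) p) (hat (g m p.1 p.2) + δ • maxwellOp (g m) p))
      + (∫ x in Ioo a b, inner ℝ (𝒯.plus Wh m x) (𝒯.plus g m x))
    = (∫ p in 𝒯.slab m, inner ℝ (F p) (hat (g m p.1 p.2) + δ • maxwellOp (g m) p))
      + (∫ x in Ioo a b, inner ℝ (𝒯.minus W0 Wh m.castSucc x) (𝒯.plus g m x))

/-! ### Residuals -/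

/-- `R̃₁ = F - M₁ Wh_t - M₂ Wh_x`, slab by slab. -/
def Mesh.residual₁ (𝒯 : Mesh T a b) (F : ℝ × ℝ → Vec 4) (Wh : Fin 𝒯.M → ℝ → ℝ → Vec 3)
    (p : ℝ × ℝ) : Vec 4 :=
  ∑ m : Fin 𝒯.M, (𝒯.slab m).indicator (fun q => F q - maxwellOp (Wh m) q) p

/-- `R̃₂`: on each slab, constant in time, the jump of `Wh` at the initial time of that slab,
divided by `h`. -/
def Mesh.residual₂ (𝒯 : Mesh T a b) (h : ℝ) (W0 : ℝ → Vec 3) (Wh : Fin 𝒯.M → ℝ → ℝ → Vec 3)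
    (p : ℝ × ℝ) : Vec 3 :=
  ∑ m : Fin 𝒯.M, (𝒯.slab m).indicator
    (fun q => h⁻¹ • (𝒯.plus Wh m q.2 - 𝒯.minus W0 Wh m.castSucc q.2)) p

/-! ### The negative norm -/

/-- `H¹(a, b)` norm of a smooth function. -/
def h1Norm (a b : ℝ) (χ : ℝ → Vec 3) : ℝ :=
  Real.sqrt ((∫ x in Ioo a b, ‖χ x‖ ^ 2) + ∫ x in Ioo a b, ‖deriv χ x‖ ^ 2)

/-- `H⁻¹(a, b)` norm: the supremum of `(u, χ) / ‖χ‖_{H¹}` over `χ ∈ C₀^∞(a, b)³`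
(the quotient is `0` for `χ = 0`). -/
def hNegOneNorm (a b : ℝ) (u : ℝ → Vec 3) : ℝ≥0∞ :=
  ⨆ χ ∈ {χ : ℝ → Vec 3 | ContDiff ℝ ∞ χ ∧ HasCompactSupport χ ∧ tsupport χ ⊆ Ioo a b},
    ENNReal.ofReal (∫ x in Ioo a b, inner ℝ (u x) (χ x)) / ENNReal.ofReal (h1Norm a b χ)

end VlasovMaxwell

end

/-! The system decouples along three orthogonal vectors `n`, the directions of E₁, E₂ + B and E₂ -
B, so the pairing of the error with χ is a weighted sum of three scalar pairings
(`inner_eq_characteristic_sum`). Pairing the equation with `hat n` gives a transport equation w_t +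
s w_x = f with speed s = 1, 1, -1, and test functions u n in the scheme give a scalar scheme for w =
(Wh, n) (`Mesh.IsSDSolution.isScalarSD`). It remains to bound the error of one such w at time T
against a scalar test function χ.

The main tool is duality. The backward transport of χ is ψ(t, y) = χ(y + s (T - t)); the pairing of
the error with χ is, up to boundary effects, the residual functional evaluated at ψ. By Galerkin
orthogonality ψ may be replaced by ψ - g with g discrete, at the cost of the streamline term of g
(`Mesh.IsScalarSD.dual_bound`). First-order approximation of ψ then yields the factor h on the
residuals and uses one derivative of χ; this is why the estimate is in H⁻¹.

The obstruction is the inflow end. Discrete functions vanish at both ends of the interval, but ψ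
vanishes only at the outflow end. So ψ is multiplied by a cutoff η that is 0 at the inflow end and 1
on K. The exact solution vanishes off K, hence so does the source
(`IsMaxwellSolution.ae_source_eq_zero`), and the cutoff is felt by the numerical solution only:
there remain one term with w η' and one with w(T) (1 - η), both supported between the inflow end and
K (`Mesh.error_representation`, `Mesh.exists_scalar_bound`).

Both terms are bounded by a local energy estimate (`Mesh.exists_strip_estimate`). Upstream of K the
scheme has zero data. Testing it with β w, where β decreases affinely along the flow down to 0 at a
mesh node, controls w in L₂ of the strip through the slope of β. The product β w is not a test
function, but it differs from one by a bubble of size h times w (`Mesh.exists_superapproximation`),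
and the resulting products of h, the residual and w are absorbed. A suitable node exists once h is
at most d/4, where d is a distance of K from the boundary. If h ≥ d/4, negative powers of h are
bounded, and g = 0 without any cutoff is good enough (`Mesh.IsScalarErrorProblem.coarse_bound`). -/

namespace VlasovMaxwell

/-! ### Elements of a slab, piecewise C¹ functions and the fundamental theorem of calculus on a
slab. -/

section Elements

variable {T a b : ℝ} (𝒯 : Mesh T a b) (m : Fin 𝒯.M)

/-- The open space-time element with indices `m` and `j`. -/
def Mesh.elem (j : Fin 𝒯.N) : Set (ℝ × ℝ) :=
  Ioo (𝒯.t m.castSucc) (𝒯.t m.succ) ×ˢ Ioo (𝒯.x j.castSucc) (𝒯.x j.succ)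

lemma Mesh.t_lt : 𝒯.t m.castSucc < 𝒯.t m.succ := 𝒯.t_strictMono Fin.castSucc_lt_succ

lemma Mesh.x_lt (j : Fin 𝒯.N) : 𝒯.x j.castSucc < 𝒯.x j.succ :=
  𝒯.x_strictMono Fin.castSucc_lt_succ

lemma Mesh.a_le_x (i : Fin (𝒯.N + 1)) : a ≤ 𝒯.x i := by
  have := 𝒯.x_strictMono.monotone (Fin.zero_le i)
  rwa [𝒯.x_zero] at this

lemma Mesh.x_le_b (i : Fin (𝒯.N + 1)) : 𝒯.x i ≤ b := by
  have := 𝒯.x_strictMono.monotone (Fin.le_last i)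
  rwa [𝒯.x_last] at this

lemma Mesh.t_nonneg (i : Fin (𝒯.M + 1)) : 0 ≤ 𝒯.t i := by
  have := 𝒯.t_strictMono.monotone (Fin.zero_le i)
  rwa [𝒯.t_zero] at this

lemma Mesh.t_le (i : Fin (𝒯.M + 1)) : 𝒯.t i ≤ T := by
  have := 𝒯.t_strictMono.monotone (Fin.le_last i)
  rwa [𝒯.t_last] at this

lemma exists_mem_Ioc_of_mem_Ioc {N : ℕ} {x : Fin (N + 1) → ℝ} {y : ℝ} (h0 : x 0 < y)
    (h1 : y ≤ x (Fin.last N)) : ∃ j : Fin N, y ∈ Ioc (x j.castSucc) (x j.succ) := by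
  have key : ∀ i : Fin (N + 1), y ≤ x i → ∃ j : Fin N, y ∈ Ioc (x j.castSucc) (x j.succ) := by
    intro i
    induction i using Fin.induction with
    | zero => intro h; exact absurd h (not_le.2 h0)
    | succ j ih =>
      intro h
      by_cases hj : y ≤ x j.castSucc
      · exact ih hj
      · exact ⟨j, not_le.1 hj, h⟩
  exact key _ h1

lemma Mesh.exists_x_mem {y : ℝ} (hy : y ∈ Ioc a b) :
    ∃ j : Fin 𝒯.N, y ∈ Ioc (𝒯.x j.castSucc) (𝒯.x j.succ) :=
  exists_mem_Ioc_of_mem_Ioc (by rw [𝒯.x_zero]; exact hy.1) (by rw [𝒯.x_last]; exact hy.2)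

lemma Mesh.exists_t_mem {s : ℝ} (hs : s ∈ Ioc 0 T) :
    ∃ m : Fin 𝒯.M, s ∈ Ioc (𝒯.t m.castSucc) (𝒯.t m.succ) :=
  exists_mem_Ioc_of_mem_Ioc (by rw [𝒯.t_zero]; exact hs.1) (by rw [𝒯.t_last]; exact hs.2)

lemma Mesh.exists_x_mem_Ioo {y : ℝ} (hy : y ∈ Ioc a b) (hn : y ∉ range 𝒯.x) :
    ∃ j : Fin 𝒯.N, y ∈ Ioo (𝒯.x j.castSucc) (𝒯.x j.succ) := by
  obtain ⟨j, hj⟩ := 𝒯.exists_x_mem hy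
  exact ⟨j, hj.1, lt_of_le_of_ne hj.2 fun h => hn ⟨_, h.symm⟩⟩

lemma Mesh.elem_subset_slab (j : Fin 𝒯.N) : 𝒯.elem m j ⊆ 𝒯.slab m := by
  rintro ⟨t, y⟩ ⟨ht, hy⟩
  exact ⟨⟨ht.1, ht.2.le⟩, (𝒯.a_le_x _).trans_lt hy.1, hy.2.trans_le (𝒯.x_le_b _)⟩

lemma Mesh.measurableSet_slab : MeasurableSet (𝒯.slab m) := measurableSet_Ioc.prod measurableSet_Ioo

lemma Mesh.measurableSet_elem (j : Fin 𝒯.N) : MeasurableSet (𝒯.elem m j) :=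
  measurableSet_Ioo.prod measurableSet_Ioo

lemma Mesh.ae_notMem_range_x : ∀ᵐ y : ℝ, y ∉ range 𝒯.x :=
  (finite_range 𝒯.x).countable.ae_notMem volume

lemma Mesh.ae_exists_elem : ∀ᵐ p ∂(volume.restrict (𝒯.slab m)), ∃ j, p ∈ 𝒯.elem m j := by
  rw [ae_restrict_iff' (𝒯.measurableSet_slab m)]
  have h1 : ∀ᵐ p : ℝ × ℝ, p.2 ∉ range 𝒯.x :=
    Measure.quasiMeasurePreserving_snd.ae 𝒯.ae_notMem_range_x
  have h2 : ∀ᵐ p : ℝ × ℝ, p.1 ∉ ({𝒯.t m.succ} : Set ℝ) :=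
    Measure.quasiMeasurePreserving_fst.ae ((countable_singleton _).ae_notMem volume)
  filter_upwards [h1, h2] with p hp1 hp2 hp
  obtain ⟨j, hj⟩ := 𝒯.exists_x_mem_Ioo (Ioo_subset_Ioc_self hp.2) hp1
  exact ⟨j, ⟨hp.1.1, lt_of_le_of_ne hp.1.2 hp2⟩, hj⟩

lemma Mesh.slab_ae_eq : 𝒯.slab m =ᵐ[volume] ⋃ j, 𝒯.elem m j := by
  have := 𝒯.ae_exists_elem m
  rw [ae_restrict_iff' (𝒯.measurableSet_slab m)] at this
  filter_upwards [this] with p hp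
  refine propext ⟨fun h => mem_iUnion.2 (hp h), fun h => ?_⟩
  obtain ⟨j, hj⟩ := mem_iUnion.1 h
  exact 𝒯.elem_subset_slab m j hj

lemma disjoint_Ioo_nodes {N : ℕ} {x : Fin (N + 1) → ℝ} (hx : StrictMono x) {i j : Fin N}
    (hij : i ≠ j) : Disjoint (Ioo (x i.castSucc) (x i.succ)) (Ioo (x j.castSucc) (x j.succ)) := by
  wlog h : i < j generalizing i j
  · exact (this hij.symm (lt_of_le_of_ne (not_lt.1 h) hij.symm)).symm
  rw [Set.disjoint_left]
  intro y hy hy'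
  have : x i.succ ≤ x j.castSucc := hx.monotone (Fin.succ_le_castSucc_iff.2 h)
  linarith [hy.2, hy'.1]

lemma Mesh.pairwise_disjoint_elem : Pairwise (Function.onFun Disjoint (𝒯.elem m)) := by
  intro i j hij
  exact Set.disjoint_prod.2 (Or.inr (disjoint_Ioo_nodes 𝒯.x_strictMono hij))

lemma Mesh.integral_slab_eq_sum {f : ℝ × ℝ → ℝ} (hf : IntegrableOn f (𝒯.slab m)) :
    ∫ p in 𝒯.slab m, f p = ∑ j, ∫ p in 𝒯.elem m j, f p := by
  rw [setIntegral_congr_set (𝒯.slab_ae_eq m)]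
  exact integral_iUnion_fintype (𝒯.measurableSet_elem m) (𝒯.pairwise_disjoint_elem m)
    fun j => hf.mono_set (𝒯.elem_subset_slab m j)

lemma Mesh.restrict_slab : (volume.restrict (𝒯.slab m) : Measure (ℝ × ℝ)) =
    (volume.restrict (Ioc (𝒯.t m.castSucc) (𝒯.t m.succ))).prod (volume.restrict (Ioo a b)) := by
  rw [Measure.prod_restrict]; rfl

instance Mesh.isFiniteMeasure_slab : IsFiniteMeasure (volume.restrict (𝒯.slab m)) := by
  rw [𝒯.restrict_slab]; infer_instance

/-- A function that coincides on every open element of a slab with a continuous function. -/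
def Mesh.PiecewiseContinuous (G : ℝ × ℝ → ℝ) : Prop :=
  ∀ j : Fin 𝒯.N, ∃ F : ℝ × ℝ → ℝ, Continuous F ∧ EqOn G F (𝒯.elem m j)

variable {𝒯 m}

lemma Mesh.PiecewiseContinuous.memLp {G : ℝ × ℝ → ℝ} (hG : 𝒯.PiecewiseContinuous m G)
    (p : ℝ≥0∞) : MemLp G p (volume.restrict (𝒯.slab m)) := by
  choose F hF hGF using hG
  have hm : AEStronglyMeasurable G (volume.restrict (𝒯.slab m)) := by
    rw [Measure.restrict_congr_set (𝒯.slab_ae_eq m), aestronglyMeasurable_iUnion_iff]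
    intro j
    refine (hF j).aestronglyMeasurable.congr ?_
    filter_upwards [ae_restrict_mem (𝒯.measurableSet_elem m j)] with p hp using (hGF j hp).symm
  have hb : ∀ j, ∃ B, ∀ p ∈ 𝒯.elem m j, ‖G p‖ ≤ B := by
    intro j
    obtain ⟨B, hB⟩ := ((isCompact_Icc (a := 𝒯.t m.castSucc) (b := 𝒯.t m.succ)).prod
      (isCompact_Icc (a := 𝒯.x j.castSucc) (b := 𝒯.x j.succ))).exists_bound_of_continuousOn
        (hF j).continuousOn
    refine ⟨B, fun p hp => ?_⟩
    rw [hGF j hp]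
    exact hB p ⟨Ioo_subset_Icc_self hp.1, Ioo_subset_Icc_self hp.2⟩
  choose B hB using hb
  refine MemLp.of_bound hm (∑ j, |B j|) ?_
  filter_upwards [𝒯.ae_exists_elem m] with p ⟨j, hj⟩
  exact (hB j p hj).trans ((le_abs_self _).trans
    (Finset.single_le_sum (f := fun j => |B j|) (fun i _ => abs_nonneg _) (Finset.mem_univ j)))

lemma Mesh.PiecewiseContinuous.integrable {G : ℝ × ℝ → ℝ} (hG : 𝒯.PiecewiseContinuous m G) :
    Integrable G (volume.restrict (𝒯.slab m)) := memLp_one_iff_integrable.1 (hG.memLp 1)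

variable (𝒯 m) in
/-- A function that coincides on every closed element of a slab with a function of class `C¹`. -/
def Mesh.PiecewiseC1 (f : ℝ → ℝ → ℝ) : Prop :=
  ∀ j : Fin 𝒯.N, ∃ F : ℝ → ℝ → ℝ, ContDiff ℝ 1 (Function.uncurry F) ∧
    ∀ t ∈ Icc (𝒯.t m.castSucc) (𝒯.t m.succ), ∀ y ∈ Icc (𝒯.x j.castSucc) (𝒯.x j.succ),
      f t y = F t y

/-- Time derivative of a scalar function. -/
noncomputable def pdt (f : ℝ → ℝ → ℝ) (t y : ℝ) : ℝ := deriv (fun s => f s y) t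

/-- Space derivative of a scalar function. -/
noncomputable def pdx (f : ℝ → ℝ → ℝ) (t y : ℝ) : ℝ := deriv (fun z => f t z) y

lemma hasDerivAt_pdt {F : ℝ → ℝ → ℝ} (hF : ContDiff ℝ 1 (Function.uncurry F)) (t y : ℝ) :
    HasDerivAt (fun s => F s y) (pdt F t y) t := by
  have : ContDiff ℝ 1 (fun s => F s y) :=
    hF.comp (contDiff_id.prodMk contDiff_const : ContDiff ℝ 1 fun s : ℝ => (s, y))
  exact (this.differentiable one_ne_zero t).hasDerivAt

lemma hasDerivAt_pdx {F : ℝ → ℝ → ℝ} (hF : ContDiff ℝ 1 (Function.uncurry F)) (t y : ℝ) :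
    HasDerivAt (fun z => F t z) (pdx F t y) y := by
  have : ContDiff ℝ 1 (fun z => F t z) :=
    hF.comp (contDiff_const.prodMk contDiff_id : ContDiff ℝ 1 fun z : ℝ => (t, z))
  exact (this.differentiable one_ne_zero y).hasDerivAt

lemma continuous_pdt {F : ℝ → ℝ → ℝ} (hF : ContDiff ℝ 1 (Function.uncurry F)) :
    Continuous fun p : ℝ × ℝ => pdt F p.1 p.2 := by
  have h1 : ∀ p : ℝ × ℝ, pdt F p.1 p.2 = fderiv ℝ (Function.uncurry F) p (1, 0) := by
    intro p
    have h := ((hF.differentiable one_ne_zero p).hasFDerivAt).comp_hasDerivAt p.1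
      ((hasDerivAt_id p.1).prodMk (hasDerivAt_const p.1 p.2))
    exact h.deriv
  simp_rw [h1]
  exact (hF.continuous_fderiv one_ne_zero).clm_apply continuous_const

lemma continuous_pdx {F : ℝ → ℝ → ℝ} (hF : ContDiff ℝ 1 (Function.uncurry F)) :
    Continuous fun p : ℝ × ℝ => pdx F p.1 p.2 := by
  have h1 : ∀ p : ℝ × ℝ, pdx F p.1 p.2 = fderiv ℝ (Function.uncurry F) p (0, 1) := by
    intro p
    have h := ((hF.differentiable one_ne_zero p).hasFDerivAt).comp_hasDerivAt p.2
      ((hasDerivAt_const p.2 p.1).prodMk (hasDerivAt_id p.2))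
    exact h.deriv
  simp_rw [h1]
  exact (hF.continuous_fderiv one_ne_zero).clm_apply continuous_const

namespace Mesh

lemma eventuallyEq_t {f F : ℝ → ℝ → ℝ} {j : Fin 𝒯.N}
    (h : ∀ t ∈ Icc (𝒯.t m.castSucc) (𝒯.t m.succ), ∀ y ∈ Icc (𝒯.x j.castSucc) (𝒯.x j.succ),
      f t y = F t y) {p : ℝ × ℝ} (hp : p ∈ 𝒯.elem m j) :
    (fun s => f s p.2) =ᶠ[𝓝 p.1] fun s => F s p.2 := by
  filter_upwards [isOpen_Ioo.mem_nhds hp.1] with s hs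
  exact h s (Ioo_subset_Icc_self hs) _ (Ioo_subset_Icc_self hp.2)

lemma eventuallyEq_x {f F : ℝ → ℝ → ℝ} {j : Fin 𝒯.N}
    (h : ∀ t ∈ Icc (𝒯.t m.castSucc) (𝒯.t m.succ), ∀ y ∈ Icc (𝒯.x j.castSucc) (𝒯.x j.succ),
      f t y = F t y) {p : ℝ × ℝ} (hp : p ∈ 𝒯.elem m j) :
    (fun z => f p.1 z) =ᶠ[𝓝 p.2] fun z => F p.1 z := by
  filter_upwards [isOpen_Ioo.mem_nhds hp.2] with z hz
  exact h _ (Ioo_subset_Icc_self hp.1) _ (Ioo_subset_Icc_self hz)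

namespace PiecewiseC1

variable {f g : ℝ → ℝ → ℝ}

lemma of_contDiff (hf : ContDiff ℝ 1 (Function.uncurry f)) : 𝒯.PiecewiseC1 m f :=
  fun _ => ⟨f, hf, fun _ _ _ _ => rfl⟩

lemma mul (hf : 𝒯.PiecewiseC1 m f) (hg : 𝒯.PiecewiseC1 m g) :
    𝒯.PiecewiseC1 m fun t y => f t y * g t y := fun j => by
  obtain ⟨F, hF, hfF⟩ := hf j
  obtain ⟨G, hG, hgG⟩ := hg j
  exact ⟨fun t y => F t y * G t y, hF.mul hG, fun t ht y hy => by
    simp only [hfF t ht y hy, hgG t ht y hy]⟩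

lemma sub (hf : 𝒯.PiecewiseC1 m f) (hg : 𝒯.PiecewiseC1 m g) :
    𝒯.PiecewiseC1 m fun t y => f t y - g t y := fun j => by
  obtain ⟨F, hF, hfF⟩ := hf j
  obtain ⟨G, hG, hgG⟩ := hg j
  exact ⟨fun t y => F t y - G t y, hF.sub hG, fun t ht y hy => by
    simp only [hfF t ht y hy, hgG t ht y hy]⟩

lemma piecewiseContinuous (hf : 𝒯.PiecewiseC1 m f) :
    𝒯.PiecewiseContinuous m fun p => f p.1 p.2 := fun j => by
  obtain ⟨F, hF, hfF⟩ := hf j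
  exact ⟨fun p => F p.1 p.2, hF.continuous,
    fun p hp => hfF _ (Ioo_subset_Icc_self hp.1) _ (Ioo_subset_Icc_self hp.2)⟩

lemma piecewiseContinuous_pdt (hf : 𝒯.PiecewiseC1 m f) :
    𝒯.PiecewiseContinuous m fun p => pdt f p.1 p.2 := fun j => by
  obtain ⟨F, hF, hfF⟩ := hf j
  exact ⟨fun p => pdt F p.1 p.2, continuous_pdt hF, fun p hp => (eventuallyEq_t hfF hp).deriv_eq⟩

lemma piecewiseContinuous_pdx (hf : 𝒯.PiecewiseC1 m f) :
    𝒯.PiecewiseContinuous m fun p => pdx f p.1 p.2 := fun j => by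
  obtain ⟨F, hF, hfF⟩ := hf j
  exact ⟨fun p => pdx F p.1 p.2, continuous_pdx hF, fun p hp => (eventuallyEq_x hfF hp).deriv_eq⟩

lemma hasDerivAt_t (hf : 𝒯.PiecewiseC1 m f) {j : Fin 𝒯.N} {p : ℝ × ℝ} (hp : p ∈ 𝒯.elem m j) :
    HasDerivAt (fun s => f s p.2) (pdt f p.1 p.2) p.1 := by
  obtain ⟨F, hF, hfF⟩ := hf j
  have h := eventuallyEq_t hfF hp
  exact ((hasDerivAt_pdt hF p.1 p.2).congr_of_eventuallyEq h).differentiableAt.hasDerivAt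

lemma hasDerivAt_x (hf : 𝒯.PiecewiseC1 m f) {j : Fin 𝒯.N} {p : ℝ × ℝ} (hp : p ∈ 𝒯.elem m j) :
    HasDerivAt (fun z => f p.1 z) (pdx f p.1 p.2) p.2 := by
  obtain ⟨F, hF, hfF⟩ := hf j
  have h := eventuallyEq_x hfF hp
  exact ((hasDerivAt_pdx hF p.1 p.2).congr_of_eventuallyEq h).differentiableAt.hasDerivAt

/-- The local C¹ functions agree with `f` on closed elements, hence with each other at shared nodes,
and a finite closed cover glues continuity. -/
lemma continuousOn_x (hf : 𝒯.PiecewiseC1 m f) (hab : a < b) {t : ℝ}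
    (ht : t ∈ Icc (𝒯.t m.castSucc) (𝒯.t m.succ)) : ContinuousOn (f t) (Icc a b) := by
  have hcov : Icc a b ⊆ ⋃ j : Fin 𝒯.N, Icc (𝒯.x j.castSucc) (𝒯.x j.succ) := by
    intro y hy
    rcases eq_or_lt_of_le hy.1 with h | h
    -- The left end `a` lies in no half-open element; it belongs to the closed first one, which
    -- exists because some element contains `b`.
    · obtain ⟨j, hj⟩ := 𝒯.exists_x_mem (right_mem_Ioc.2 hab)
      have h0 : 0 < 𝒯.N := Fin.pos j
      refine mem_iUnion.2 ⟨⟨0, h0⟩, ?_⟩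
      have e : 𝒯.x (Fin.castSucc ⟨0, h0⟩) = a := 𝒯.x_zero
      rw [e, ← h]
      exact ⟨le_rfl, e.symm.le.trans (𝒯.x_lt _).le⟩
    · obtain ⟨j, hj⟩ := 𝒯.exists_x_mem ⟨h, hy.2⟩
      exact mem_iUnion.2 ⟨j, Ioc_subset_Icc_self hj⟩
  refine ContinuousOn.mono ?_ hcov
  refine (locallyFinite_of_finite _).continuousOn_iUnion (fun _ => isClosed_Icc) fun j => ?_
  obtain ⟨F, hF, hfF⟩ := hf j
  refine ContinuousOn.congr (f := F t) ?_ fun y hy => hfF t ht y hy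
  exact (hF.continuous.comp (by fun_prop : Continuous fun y : ℝ => (t, y))).continuousOn

lemma memLp_slice (hf : 𝒯.PiecewiseC1 m f) (hab : a < b) {t : ℝ}
    (ht : t ∈ Icc (𝒯.t m.castSucc) (𝒯.t m.succ)) (p : ℝ≥0∞) :
    MemLp (f t) p (volume.restrict (Ioo a b)) := by
  have hc := hf.continuousOn_x hab ht
  obtain ⟨B, hB⟩ := isCompact_Icc.exists_bound_of_continuousOn hc
  refine MemLp.of_bound ((hc.mono Ioo_subset_Icc_self).aestronglyMeasurable measurableSet_Ioo) B ?_
  filter_upwards [ae_restrict_mem measurableSet_Ioo] with y hy using hB y (Ioo_subset_Icc_self hy)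

/-- Fundamental theorem of calculus in time on a slab. -/
lemma integral_pdt (hf : 𝒯.PiecewiseC1 m f) (hab : a < b) :
    ∫ p in 𝒯.slab m, pdt f p.1 p.2 =
      (∫ y in Ioo a b, f (𝒯.t m.succ) y) - ∫ y in Ioo a b, f (𝒯.t m.castSucc) y := by
  have hi := hf.piecewiseContinuous_pdt.integrable
  rw [𝒯.restrict_slab] at hi ⊢
  rw [integral_prod_symm _ hi, ← integral_sub
    (memLp_one_iff_integrable.1 (hf.memLp_slice hab (right_mem_Icc.2 (𝒯.t_lt m).le) 1))
    (memLp_one_iff_integrable.1 (hf.memLp_slice hab (left_mem_Icc.2 (𝒯.t_lt m).le) 1))]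
  refine integral_congr_ae ?_
  have hn := ae_restrict_of_ae (s := Ioo a b) 𝒯.ae_notMem_range_x
  filter_upwards [ae_restrict_mem measurableSet_Ioo, hi.prod_left_ae, hn] with y hy hiy hny
  rw [← intervalIntegral.integral_of_le (𝒯.t_lt m).le]
  obtain ⟨j, hj⟩ := 𝒯.exists_x_mem_Ioo (Ioo_subset_Ioc_self hy) hny
  obtain ⟨F, hF, hfF⟩ := hf j
  refine intervalIntegral.integral_eq_sub_of_hasDerivAt_of_le (f := fun s => f s y)
    (𝒯.t_lt m).le ?_ ?_ ?_
  · refine ContinuousOn.congr (f := fun s => F s y) ?_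
      fun s hs => hfF s hs y (Ioo_subset_Icc_self hj)
    exact (hF.continuous.comp (by fun_prop : Continuous fun s : ℝ => (s, y))).continuousOn
  · intro s hs
    exact hf.hasDerivAt_t (p := (s, y)) ⟨hs, hj⟩
  · exact (intervalIntegrable_iff_integrableOn_Ioc_of_le (𝒯.t_lt m).le).2 hiy

/-- Fundamental theorem of calculus in space on a slab. -/
lemma integral_pdx (hf : 𝒯.PiecewiseC1 m f) (hab : a < b)
    (h0 : ∀ t ∈ Icc (𝒯.t m.castSucc) (𝒯.t m.succ), f t a = 0 ∧ f t b = 0) :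
    ∫ p in 𝒯.slab m, pdx f p.1 p.2 = 0 := by
  have hi := hf.piecewiseContinuous_pdx.integrable
  rw [𝒯.restrict_slab] at hi ⊢
  rw [integral_prod _ hi]
  refine integral_eq_zero_of_ae ?_
  have hn := ae_restrict_of_ae (s := Ioc (𝒯.t m.castSucc) (𝒯.t m.succ))
    ((countable_singleton (𝒯.t m.succ)).ae_notMem volume)
  filter_upwards [ae_restrict_mem measurableSet_Ioc, hi.prod_right_ae, hn] with t ht hit hnt
  have ht' : t ∈ Ioo (𝒯.t m.castSucc) (𝒯.t m.succ) := ⟨ht.1, lt_of_le_of_ne ht.2 hnt⟩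
  rw [← integral_Ioc_eq_integral_Ioo, ← intervalIntegral.integral_of_le hab.le]
  -- Continuity across the nodes means that no jump terms appear there; the finitely many kinks form
  -- the exceptional set.
  have := MeasureTheory.integral_eq_of_hasDerivAt_off_countable_of_le (f t) (pdx f t) hab.le
    (finite_range 𝒯.x).countable (hf.continuousOn_x hab (Ioo_subset_Icc_self ht')) ?_ ?_
  · rw [this, (h0 t (Ioc_subset_Icc_self ht)).1, (h0 t (Ioc_subset_Icc_self ht)).2, sub_zero]; rfl
  · rintro y ⟨hy, hny⟩
    obtain ⟨j, hj⟩ := 𝒯.exists_x_mem_Ioo (Ioo_subset_Ioc_self hy) hny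
    exact hf.hasDerivAt_x (p := (t, y)) ⟨ht', hj⟩
  · rw [intervalIntegrable_iff_integrableOn_Ioc_of_le hab.le, integrableOn_Ioc_iff_integrableOn_Ioo]
    exact hit

end PiecewiseC1

end Mesh

end Elements


/-! ### Polynomials in two variables and the inverse inequality. -/

section InverseInequality

/-- The polynomial of degree at most `k` with the given coefficients. -/
noncomputable def polyFun {k : ℕ} (a : Fin (k + 1) → ℝ) (y : ℝ) : ℝ := ∑ i, a i * y ^ (i : ℕ)

lemma continuous_polyFun {k : ℕ} (a : Fin (k + 1) → ℝ) : Continuous (polyFun a) := by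
  unfold polyFun; fun_prop

lemma polyFun_eq_zero {k : ℕ} {a : Fin (k + 1) → ℝ}
    (h : ∀ y ∈ Ioo (0 : ℝ) 1, polyFun a y = 0) : a = 0 := by
  classical
  set P : Polynomial ℝ := ∑ i, Polynomial.C (a i) * Polynomial.X ^ (i : ℕ) with hP
  have hev : ∀ y, P.eval y = polyFun a y := fun y => by
    simp [hP, polyFun, Polynomial.eval_finsetSum]
  have hP0 : P = 0 := by
    refine Polynomial.eq_zero_of_infinite_isRoot P ((Ioo_infinite zero_lt_one).mono fun y hy => ?_)
    rw [mem_ofPred_eq, Polynomial.IsRoot.def, hev, h y hy]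
  funext i
  have := congrArg (fun p => p.coeff (i : ℕ)) hP0
  simpa [hP, Polynomial.finsetSum_coeff, Polynomial.coeff_C_mul, Polynomial.coeff_X_pow,
    Fin.val_inj] using this

/-- Both sides are quadratic in the coefficients, so the unit sphere suffices. It is compact, and
the continuous integral has a positive minimum on it because a polynomial that vanishes on (0, 1) is
zero. -/
lemma exists_sum_sq_le_integral_polyFun (k : ℕ) : ∃ C : ℝ, 0 < C ∧ ∀ a : Fin (k + 1) → ℝ,
    ∑ i, a i ^ 2 ≤ C * ∫ y in (0 : ℝ)..1, polyFun a y ^ 2 := by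
  set Q : (Fin (k + 1) → ℝ) → ℝ := fun a => ∫ y in (0 : ℝ)..1, polyFun a y ^ 2 with hQ
  have hQc : Continuous Q := by
    refine intervalIntegral.continuous_parametric_intervalIntegral_of_continuous' ?_ 0 1
    unfold Function.uncurry polyFun
    fun_prop
  have hS : IsCompact {a : Fin (k + 1) → ℝ | ∑ i, a i ^ 2 = 1} := by
    refine Metric.isCompact_of_isClosed_isBounded
      (isClosed_eq (by fun_prop) continuous_const) ?_
    refine (Metric.isBounded_closedBall (x := (0 : Fin (k + 1) → ℝ)) (r := 1)).subset fun a ha => ?_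
    rw [mem_closedBall_zero_iff, pi_norm_le_iff_of_nonneg zero_le_one]
    intro i
    have h1 : a i ^ 2 ≤ 1 := by
      rw [← (show ∑ i, a i ^ 2 = 1 from ha)]
      exact Finset.single_le_sum (f := fun i => a i ^ 2) (fun i _ => sq_nonneg _)
        (Finset.mem_univ i)
    rw [Real.norm_eq_abs]
    exact (sq_le_one_iff_abs_le_one _).1 h1
  have hne : {a : Fin (k + 1) → ℝ | ∑ i, a i ^ 2 = 1}.Nonempty :=
    ⟨Pi.single 0 1, by simp [Pi.single_apply]⟩
  obtain ⟨a₀, ha₀, hmin⟩ := hS.exists_isMinOn hne hQc.continuousOn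
  have hpos : 0 < Q a₀ := by
    have h0 : 0 ≤ Q a₀ := intervalIntegral.integral_nonneg zero_le_one fun y _ => sq_nonneg _
    refine lt_of_le_of_ne h0 fun h => ?_
    have hc : Continuous fun y => polyFun a₀ y ^ 2 := (continuous_polyFun a₀).pow 2
    have hz : a₀ = 0 := by
      refine polyFun_eq_zero fun y hy => ?_
      by_contra hne
      have : 0 < ∫ y in (0 : ℝ)..1, polyFun a₀ y ^ 2 :=
        intervalIntegral.integral_pos zero_lt_one hc.continuousOn (fun _ _ => sq_nonneg _)
          ⟨y, Ioo_subset_Icc_self hy, by positivity⟩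
      exact this.ne h
    have : ∑ i, a₀ i ^ 2 = 1 := ha₀
    simp [hz] at this
  refine ⟨(Q a₀)⁻¹, inv_pos.2 hpos, fun a => ?_⟩
  set σ := ∑ i, a i ^ 2 with hσ
  have hσ0 : 0 ≤ σ := Finset.sum_nonneg fun i _ => sq_nonneg _
  rcases hσ0.eq_or_lt with h | h
  · rw [← h]
    exact mul_nonneg (inv_pos.2 hpos).le
      (intervalIntegral.integral_nonneg zero_le_one fun y _ => sq_nonneg _)
  · have hs : 0 < Real.sqrt σ := Real.sqrt_pos.2 h
    have h1 : Q a₀ ≤ Q fun i => (Real.sqrt σ)⁻¹ * a i := by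
      refine hmin (?_ : ∑ i, ((Real.sqrt σ)⁻¹ * a i) ^ 2 = 1)
      simp_rw [mul_pow, ← Finset.mul_sum, ← hσ, inv_pow, Real.sq_sqrt hσ0]
      exact inv_mul_cancel₀ h.ne'
    have h2 : (Q fun i => (Real.sqrt σ)⁻¹ * a i) = σ⁻¹ * Q a := by
      have : ∀ y, polyFun (fun i => (Real.sqrt σ)⁻¹ * a i) y ^ 2 = σ⁻¹ * polyFun a y ^ 2 := by
        intro y
        have : polyFun (fun i => (Real.sqrt σ)⁻¹ * a i) y = (Real.sqrt σ)⁻¹ * polyFun a y := by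
          simp [polyFun, Finset.mul_sum, mul_assoc]
        rw [this, mul_pow, inv_pow, Real.sq_sqrt hσ0]
      simp only [hQ, this, intervalIntegral.integral_const_mul]
    rw [h2] at h1
    change σ ≤ (Q a₀)⁻¹ * Q a
    rw [inv_mul_eq_div, le_div_iff₀ hpos]
    calc σ * Q a₀ ≤ σ * (σ⁻¹ * Q a) := by gcongr
      _ = Q a := by rw [mul_inv_cancel_left₀ h.ne']

/-- Functions of two variables that are polynomials of degree at most `k` in each of them. -/
def IsBiPoly (k : ℕ) (f : ℝ → ℝ → ℝ) : Prop :=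
  ∃ c : Fin (k + 1) → Fin (k + 1) → ℝ, ∀ t x,
    f t x = ∑ i : Fin (k + 1), ∑ l : Fin (k + 1), t ^ (i : ℕ) * x ^ (l : ℕ) * c i l

lemma IsBiPoly.add {k : ℕ} {f g : ℝ → ℝ → ℝ} (hf : IsBiPoly k f) (hg : IsBiPoly k g) :
    IsBiPoly k fun t x => f t x + g t x := by
  obtain ⟨c, hc⟩ := hf
  obtain ⟨d, hd⟩ := hg
  refine ⟨fun i l => c i l + d i l, fun t x => ?_⟩
  simp_rw [hc, hd, mul_add, Finset.sum_add_distrib]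

lemma IsBiPoly.const_mul {k : ℕ} {f : ℝ → ℝ → ℝ} (hf : IsBiPoly k f) (r : ℝ) :
    IsBiPoly k fun t x => r * f t x := by
  obtain ⟨c, hc⟩ := hf
  refine ⟨fun i l => r * c i l, fun t x => ?_⟩
  simp_rw [hc, Finset.mul_sum]
  refine Finset.sum_congr rfl fun i _ => Finset.sum_congr rfl fun l _ => by ring

lemma IsBiPoly.sum {k : ℕ} {ι : Type*} (s : Finset ι) {f : ι → ℝ → ℝ → ℝ}
    (hf : ∀ i ∈ s, IsBiPoly k (f i)) : IsBiPoly k fun t x => ∑ i ∈ s, f i t x := by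
  classical
  induction s using Finset.induction_on with
  | empty => exact ⟨0, by simp⟩
  | insert i s hi ih =>
    simp_rw [Finset.sum_insert hi]
    exact (hf i (Finset.mem_insert_self _ _)).add
      (ih fun j hj => hf j (Finset.mem_insert_of_mem hj))

lemma eval_eq_sum_fin {k : ℕ} {P : Polynomial ℝ} (hP : P.natDegree ≤ k) (y : ℝ) :
    P.eval y = ∑ i : Fin (k + 1), P.coeff i * y ^ (i : ℕ) := by
  rw [Polynomial.eval_eq_sum_range' (Nat.lt_succ_of_le hP) y, Finset.sum_range]

lemma IsBiPoly.of_mul {k : ℕ} {P Q : Polynomial ℝ} (hP : P.natDegree ≤ k) (hQ : Q.natDegree ≤ k) :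
    IsBiPoly k fun t x => P.eval t * Q.eval x := by
  refine ⟨fun i l => P.coeff i * Q.coeff l, fun t x => ?_⟩
  simp_rw [eval_eq_sum_fin hP, eval_eq_sum_fin hQ, Finset.sum_mul_sum]
  refine Finset.sum_congr rfl fun i _ => Finset.sum_congr rfl fun l _ => by ring

lemma natDegree_comp_affine_le {k : ℕ} {P : Polynomial ℝ} (hP : P.natDegree ≤ k) (r s : ℝ) :
    (P.comp (Polynomial.C r * Polynomial.X + Polynomial.C s)).natDegree ≤ k := by
  refine Polynomial.natDegree_comp_le.trans ?_
  calc _ ≤ k * 1 := Nat.mul_le_mul hP (Polynomial.natDegree_linear_le)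
    _ = k := mul_one k

lemma isBiPoly_affine {k : ℕ} (t₀ τ x₀ ℓ : ℝ) {i l : ℕ} (hi : i ≤ k) (hl : l ≤ k) :
    IsBiPoly k fun t x => ((t - t₀) / τ) ^ i * ((x - x₀) / ℓ) ^ l := by
  have h := IsBiPoly.of_mul (k := k)
    (natDegree_comp_affine_le (P := Polynomial.X ^ i) (by simpa using hi) τ⁻¹ (-t₀ / τ))
    (natDegree_comp_affine_le (P := Polynomial.X ^ l) (by simpa using hl) ℓ⁻¹ (-x₀ / ℓ))
  convert h using 3 with t x
  simp only [Polynomial.pow_comp, Polynomial.X_comp, Polynomial.eval_pow, Polynomial.eval_add,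
    Polynomial.eval_mul, Polynomial.eval_C, Polynomial.eval_X]
  ring

lemma IsBiPoly.contDiff {k : ℕ} {f : ℝ → ℝ → ℝ} (hf : IsBiPoly k f) :
    ContDiff ℝ 1 (Function.uncurry f) := by
  obtain ⟨c, hc⟩ := hf
  have : Function.uncurry f =
      fun p : ℝ × ℝ =>
        ∑ i : Fin (k + 1), ∑ l : Fin (k + 1), p.1 ^ (i : ℕ) * p.2 ^ (l : ℕ) * c i l := by
    funext p; exact hc p.1 p.2
  rw [this]
  fun_prop

/-- An affine change of each variable preserves the degree bounds, so the pull-back to the unit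
square has coefficients of its own. They are the quantities that the inverse inequality controls
uniformly in the shape of the rectangle. -/
lemma IsBiPoly.exists_affine_coeff {k : ℕ} {f : ℝ → ℝ → ℝ} (hf : IsBiPoly k f) (t₀ x₀ : ℝ) {τ ℓ : ℝ}
    (hτ : τ ≠ 0) (hℓ : ℓ ≠ 0) : ∃ c : Fin (k + 1) → Fin (k + 1) → ℝ, ∀ t x,
      f t x = ∑ i : Fin (k + 1), ∑ l : Fin (k + 1),
        ((t - t₀) / τ) ^ (i : ℕ) * ((x - x₀) / ℓ) ^ (l : ℕ) * c i l := by
  have h : IsBiPoly k fun t x => f (τ * t + t₀) (ℓ * x + x₀) := by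
    obtain ⟨c, hc⟩ := hf
    simp_rw [hc]
    refine IsBiPoly.sum _ fun i _ => IsBiPoly.sum _ fun l _ => ?_
    have h := (isBiPoly_affine (k := k) (-t₀ / τ) τ⁻¹ (-x₀ / ℓ) ℓ⁻¹
      (Nat.lt_succ_iff.1 i.2) (Nat.lt_succ_iff.1 l.2)).const_mul (c i l)
    convert h using 3 with t x
    rw [mul_comm]
    congr 3 <;> field_simp <;> ring
  obtain ⟨c, hc⟩ := h
  refine ⟨c, fun t x => ?_⟩
  rw [← hc]
  congr 1 <;> field_simp <;> ring

lemma integral_comp_affine (f : ℝ → ℝ) {t₀ t₁ : ℝ} (h : t₀ < t₁) :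
    ∫ t in t₀..t₁, f ((t - t₀) / (t₁ - t₀)) = (t₁ - t₀) * ∫ y in (0 : ℝ)..1, f y := by
  have h1 := sub_pos.2 h
  have := intervalIntegral.integral_comp_div_sub (a := t₀) (b := t₁) f h1.ne' (t₀ / (t₁ - t₀))
  simp_rw [sub_div]
  rw [this, ← sub_div, ← sub_div, sub_self, zero_div, div_self h1.ne', smul_eq_mul]

/-- Inverse inequality: the coefficients of a polynomial in the local coordinates of a rectangle
are controlled by its `L₂` norm. -/
lemma exists_inverse_inequality (k : ℕ) : ∃ C : ℝ, 0 < C ∧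
    ∀ (t₀ t₁ x₀ x₁ : ℝ), t₀ < t₁ → x₀ < x₁ → ∀ c : Fin (k + 1) → Fin (k + 1) → ℝ,
      (t₁ - t₀) * (x₁ - x₀) * ∑ i, ∑ l, c i l ^ 2 ≤
        C * ∫ p in Ioo t₀ t₁ ×ˢ Ioo x₀ x₁,
          (∑ i : Fin (k + 1), ∑ l : Fin (k + 1),
            ((p.1 - t₀) / (t₁ - t₀)) ^ (i : ℕ) * ((p.2 - x₀) / (x₁ - x₀)) ^ (l : ℕ)
            * c i l) ^ 2 := by
  obtain ⟨C, hC, hCa⟩ := exists_sum_sq_le_integral_polyFun k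
  -- The one-dimensional inequality is used twice: on the coefficients of each row as a polynomial
  -- in X, then, for fixed X, on the resulting polynomial in T.
  refine ⟨C * C, by positivity, fun t₀ t₁ x₀ x₁ ht hx c => ?_⟩
  have hτ := sub_pos.2 ht
  have hℓ := sub_pos.2 hx
  set f : ℝ → ℝ → ℝ := fun T X =>
    ∑ i : Fin (k + 1), ∑ l : Fin (k + 1), T ^ (i : ℕ) * X ^ (l : ℕ) * c i l with hf
  have hfc : Continuous fun p : ℝ × ℝ => f p.1 p.2 := by simp only [hf]; fun_prop
  have e1 : ∀ T X, f T X = polyFun (fun i => polyFun (c i) X) T := fun T X => by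
    simp only [hf, polyFun, Finset.sum_mul]
    refine Finset.sum_congr rfl fun i _ => Finset.sum_congr rfl fun l _ => by ring
  have hint : ∫ p in Ioo t₀ t₁ ×ˢ Ioo x₀ x₁,
      f ((p.1 - t₀) / (t₁ - t₀)) ((p.2 - x₀) / (x₁ - x₀)) ^ 2 =
      (t₁ - t₀) * (x₁ - x₀) * ∫ X in (0 : ℝ)..1, ∫ T in (0 : ℝ)..1, f T X ^ 2 := by
    have hcont : Continuous fun p : ℝ × ℝ =>
        f ((p.1 - t₀) / (t₁ - t₀)) ((p.2 - x₀) / (x₁ - x₀)) ^ 2 := by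
      simp only [hf]; fun_prop
    have hi : Integrable (fun p : ℝ × ℝ =>
        f ((p.1 - t₀) / (t₁ - t₀)) ((p.2 - x₀) / (x₁ - x₀)) ^ 2)
        ((volume.restrict (Ioo t₀ t₁)).prod (volume.restrict (Ioo x₀ x₁))) := by
      rw [Measure.prod_restrict]
      exact (hcont.continuousOn.integrableOn_compact (isCompact_Icc.prod isCompact_Icc)).mono_set
        (prod_mono Ioo_subset_Icc_self Ioo_subset_Icc_self)
    rw [Measure.volume_eq_prod, ← Measure.prod_restrict, integral_prod_symm _ hi]
    simp only []
    have e2 : ∀ y, ∫ x in Ioo t₀ t₁, f ((x - t₀) / (t₁ - t₀)) ((y - x₀) / (x₁ - x₀)) ^ 2 =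
        (t₁ - t₀) * ∫ T in (0 : ℝ)..1, f T ((y - x₀) / (x₁ - x₀)) ^ 2 := fun y => by
      rw [← integral_Ioc_eq_integral_Ioo, ← intervalIntegral.integral_of_le ht.le]
      exact integral_comp_affine (fun T => f T ((y - x₀) / (x₁ - x₀)) ^ 2) ht
    simp_rw [e2]
    rw [← integral_Ioc_eq_integral_Ioo, ← intervalIntegral.integral_of_le hx.le,
      intervalIntegral.integral_const_mul,
      integral_comp_affine (fun X => ∫ T in (0 : ℝ)..1, f T X ^ 2) hx]
    ring
  change _ ≤ C * C * ∫ p in Ioo t₀ t₁ ×ˢ Ioo x₀ x₁,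
      f ((p.1 - t₀) / (t₁ - t₀)) ((p.2 - x₀) / (x₁ - x₀)) ^ 2
  rw [hint]
  have key : ∑ i, ∑ l, c i l ^ 2 ≤
      C * (C * ∫ X in (0 : ℝ)..1, ∫ T in (0 : ℝ)..1, f T X ^ 2) := by
    have hci : ∀ i, IntervalIntegrable (fun X => polyFun (c i) X ^ 2) volume 0 1 := fun i =>
      ((continuous_polyFun (c i)).pow 2).intervalIntegrable 0 1
    calc ∑ i, ∑ l, c i l ^ 2 ≤ ∑ i, C * ∫ X in (0 : ℝ)..1, polyFun (c i) X ^ 2 :=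
          Finset.sum_le_sum fun i _ => hCa (c i)
      _ = C * ∫ X in (0 : ℝ)..1, ∑ i, polyFun (c i) X ^ 2 := by
          rw [← Finset.mul_sum, intervalIntegral.integral_finsetSum fun i _ => hci i]
      _ ≤ C * ∫ X in (0 : ℝ)..1, C * ∫ T in (0 : ℝ)..1, f T X ^ 2 := by
          refine mul_le_mul_of_nonneg_left ?_ hC.le
          refine intervalIntegral.integral_mono_on zero_le_one ?_ ?_ fun X _ => ?_
          · exact Continuous.intervalIntegrable
              (continuous_finsetSum _ fun i _ => (continuous_polyFun (c i)).pow 2) 0 1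
          · refine Continuous.intervalIntegrable (Continuous.mul continuous_const
              (intervalIntegral.continuous_parametric_intervalIntegral_of_continuous' ?_ 0 1)) 0 1
            exact (hfc.comp continuous_swap).pow 2
          · simp_rw [e1]
            exact hCa fun i => polyFun (c i) X
      _ = _ := by rw [intervalIntegral.integral_const_mul]
  calc _ ≤ (t₁ - t₀) * (x₁ - x₀) * (C * (C * ∫ X in (0 : ℝ)..1, ∫ T in (0 : ℝ)..1, f T X ^ 2)) := by
        gcongr
    _ = _ := by ring

end InverseInequality


/-! ### The bubble correction on one element. -/

section Superapproximation

lemma hasDerivAt_polyFun {k : ℕ} (a : Fin (k + 1) → ℝ) (y : ℝ) :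
    HasDerivAt (polyFun a) (∑ i : Fin (k + 1), a i * (i * y ^ ((i : ℕ) - 1))) y := by
  unfold polyFun
  exact HasDerivAt.fun_sum fun i _ => (hasDerivAt_pow (i : ℕ) y).const_mul (a i)

lemma abs_polyFun_le {k : ℕ} (a : Fin (k + 1) → ℝ) {y : ℝ} (hy : y ∈ Icc (0 : ℝ) 1) :
    |polyFun a y| ≤ ∑ i, |a i| := by
  refine (Finset.abs_sum_le_sum_abs _ _).trans (Finset.sum_le_sum fun i _ => ?_)
  rw [abs_mul, abs_of_nonneg (pow_nonneg hy.1 _)]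
  exact mul_le_of_le_one_right (abs_nonneg _) (pow_le_one₀ hy.1 hy.2)

lemma abs_deriv_polyFun_le {k : ℕ} (a : Fin (k + 1) → ℝ) {y : ℝ} (hy : y ∈ Icc (0 : ℝ) 1) :
    |∑ i : Fin (k + 1), a i * (i * y ^ ((i : ℕ) - 1))| ≤ (k + 1) * ∑ i, |a i| := by
  refine (Finset.abs_sum_le_sum_abs _ _).trans ?_
  rw [Finset.mul_sum]
  refine Finset.sum_le_sum fun i _ => ?_
  have hi : ((i : ℕ) : ℝ) ≤ k + 1 := by exact_mod_cast i.2.le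
  have h1 : y ^ ((i : ℕ) - 1) ≤ 1 := pow_le_one₀ hy.1 hy.2
  have h0 : 0 ≤ y ^ ((i : ℕ) - 1) := pow_nonneg hy.1 _
  rw [abs_mul, abs_mul, abs_of_nonneg h0, Nat.abs_cast, mul_comm]
  refine mul_le_mul_of_nonneg_right ?_ (abs_nonneg _)
  calc ((i : ℕ) : ℝ) * y ^ ((i : ℕ) - 1) ≤ (k + 1) * 1 := by gcongr
    _ = k + 1 := mul_one _

lemma sub_div_sub_mem_Icc {x₀ x₁ x : ℝ} (hx : x ∈ Icc x₀ x₁) :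
    (x - x₀) / (x₁ - x₀) ∈ Icc (0 : ℝ) 1 :=
  ⟨div_nonneg (by linarith [hx.1]) (by linarith [hx.1, hx.2]),
    div_le_one_of_le₀ (by linarith [hx.2]) (by linarith [hx.1, hx.2])⟩

/-- Multiplication by X pushes only the top term out of the degree bound. Replacing X^(k+1) by X^k
costs a multiple of X^k (X - 1), which vanishes at X = 1 and, for k ≥ 1, at X = 0. -/
lemma sum_shift_eq {k : ℕ} (c : Fin (k + 1) → ℝ) (X : ℝ) :
    ∑ l : Fin (k + 1), X ^ (min ((l : ℕ) + 1) k) * c l =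
      X * (∑ l : Fin (k + 1), X ^ (l : ℕ) * c l) - c (Fin.last k) * (X ^ k * (X - 1)) := by
  rw [Fin.sum_univ_castSucc, Fin.sum_univ_castSucc, mul_add, Finset.mul_sum]
  have h1 : ∀ i : Fin k, X ^ (min ((i.castSucc : ℕ) + 1) k) * c i.castSucc =
      X * (X ^ (i.castSucc : ℕ) * c i.castSucc) := fun i => by
    rw [min_eq_left (by simp), pow_succ]; ring
  rw [Finset.sum_congr rfl fun i _ => h1 i]
  simp only [Fin.val_last, min_eq_right (Nat.le_succ k)]
  ring

/-- On one element, the product of a polynomial and an affine weight differs from a polynomial of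
the original degree, with the same values at both ends, by a small bubble. -/
lemma exists_bubble (k : ℕ) (hk : 1 ≤ k) : ∃ C : ℝ, 0 < C ∧
    ∀ (t₀ t₁ x₀ x₁ : ℝ), t₀ < t₁ → x₀ < x₁ → ∀ F : ℝ → ℝ → ℝ, IsBiPoly k F →
    ∀ s ω₀ : ℝ, |s| ≤ 1 → ∃ (θ : ℝ → ℝ → ℝ) (A : ℝ), 0 ≤ A ∧
      ContDiff ℝ 1 (Function.uncurry θ) ∧ (∀ t, θ t x₀ = 0 ∧ θ t x₁ = 0) ∧
      IsBiPoly k (fun t x => (ω₀ - s * (x - x₀)) * F t x - θ t x) ∧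
      (t₁ - t₀) * (x₁ - x₀) * A ^ 2 ≤ C * ∫ p in Ioo t₀ t₁ ×ˢ Ioo x₀ x₁, F p.1 p.2 ^ 2 ∧
      ∀ t ∈ Icc t₀ t₁, ∀ x ∈ Icc x₀ x₁, |θ t x| ≤ (x₁ - x₀) * A ∧ |pdx θ t x| ≤ A ∧
        (t₁ - t₀) * |pdt θ t x| ≤ (x₁ - x₀) * A := by
  obtain ⟨C, hC, hinv⟩ := exists_inverse_inequality k
  -- The amplitude below is (k + 1) `S`, which gives two of the factors; the third comes from
  -- Cauchy-Schwarz for the sum `S`.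
  refine ⟨(k + 1) ^ 3 * C, by positivity, fun t₀ t₁ x₀ x₁ ht hx F hF s ω₀ hs => ?_⟩
  have hτ := sub_pos.2 ht
  have hℓ := sub_pos.2 hx
  obtain ⟨c, hc⟩ := hF.exists_affine_coeff t₀ x₀ hτ.ne' hℓ.ne'
  set d : Fin (k + 1) → ℝ := fun i => c i (Fin.last k) with hd
  set S := ∑ i, |d i| with hS
  have hS0 : 0 ≤ S := Finset.sum_nonneg fun i _ => abs_nonneg _
  have hk1 : (1 : ℝ) ≤ k + 1 := by linarith [(Nat.cast_nonneg k : (0 : ℝ) ≤ k)]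
  set τ := t₁ - t₀ with hτd
  set ℓ := x₁ - x₀ with hℓd
  -- Only the part -s ℓ X of the weight raises the degree, and only through the top coefficients
  -- `d`. The excess is this bubble; its factor ℓ is the gain of one power of the mesh size.
  set θ : ℝ → ℝ → ℝ := fun t x =>
    -(s * ℓ) * polyFun d ((t - t₀) / τ) * (((x - x₀) / ℓ) ^ k * ((x - x₀) / ℓ - 1)) with hθ
  have hpx : ∀ t x, pdx θ t x = -s * polyFun d ((t - t₀) / τ) *
      ((k + 1) * ((x - x₀) / ℓ) ^ k - k * ((x - x₀) / ℓ) ^ (k - 1)) := by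
    intro t x
    have h1 : HasDerivAt (fun x : ℝ => (x - x₀) / ℓ) (1 / ℓ) x :=
      ((hasDerivAt_id x).sub_const x₀).div_const ℓ
    have h2 := ((h1.pow k).mul (h1.sub_const 1)).const_mul (-(s * ℓ) * polyFun d ((t - t₀) / τ))
    refine (h2.deriv : pdx θ t x = _).trans ?_
    obtain ⟨n, rfl⟩ : ∃ n, k = n + 1 := ⟨k - 1, by omega⟩
    simp only [Nat.add_sub_cancel, pow_succ, Pi.pow_apply]
    push_cast
    field_simp
    ring
  have hpt : ∀ t x, pdt θ t x = -(s * ℓ) *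
      ((∑ i : Fin (k + 1), d i * (i * ((t - t₀) / τ) ^ ((i : ℕ) - 1))) * (1 / τ)) *
      (((x - x₀) / ℓ) ^ k * ((x - x₀) / ℓ - 1)) := by
    intro t x
    have h1 : HasDerivAt (fun t : ℝ => (t - t₀) / τ) (1 / τ) t :=
      ((hasDerivAt_id t).sub_const t₀).div_const τ
    have h2 := ((hasDerivAt_polyFun d ((t - t₀) / τ)).comp t h1).const_mul (-(s * ℓ))
    exact (h2.mul_const (((x - x₀) / ℓ) ^ k * ((x - x₀) / ℓ - 1))).deriv
  refine ⟨θ, (k + 1) * S, by positivity, ?_, ?_, ?_, ?_, ?_⟩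
  · simp only [hθ, polyFun, Function.uncurry_def, div_eq_mul_inv]
    fun_prop
  · intro t
    refine ⟨?_, ?_⟩
    · simp [hθ, show k ≠ 0 by omega]
    · simp only [hθ, ← hℓd, div_self hℓ.ne']; simp
  · have h1 : (fun t x => (ω₀ - s * (x - x₀)) * F t x - θ t x) = fun t x => ω₀ * F t x +
        -(s * ℓ) * ∑ i : Fin (k + 1), ∑ l : Fin (k + 1),
          c i l * (((t - t₀) / τ) ^ (i : ℕ) * ((x - x₀) / ℓ) ^ (min ((l : ℕ) + 1) k)) := by
      funext t x
      have e1 : ∀ i : Fin (k + 1), ∑ l : Fin (k + 1),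
          c i l * (((t - t₀) / τ) ^ (i : ℕ) * ((x - x₀) / ℓ) ^ (min ((l : ℕ) + 1) k)) =
          (x - x₀) / ℓ * (∑ l : Fin (k + 1),
            ((t - t₀) / τ) ^ (i : ℕ) * ((x - x₀) / ℓ) ^ (l : ℕ) * c i l) -
          d i * ((t - t₀) / τ) ^ (i : ℕ) * (((x - x₀) / ℓ) ^ k * ((x - x₀) / ℓ - 1)) := by
        intro i
        have := sum_shift_eq (c i) ((x - x₀) / ℓ)
        calc _ = ((t - t₀) / τ) ^ (i : ℕ) *
              ∑ l : Fin (k + 1), ((x - x₀) / ℓ) ^ (min ((l : ℕ) + 1) k) * c i l := by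
              rw [Finset.mul_sum]; exact Finset.sum_congr rfl fun l _ => by ring
          _ = _ := by
              rw [this, mul_sub, Finset.mul_sum, Finset.mul_sum, Finset.mul_sum]
              congr 1
              · exact Finset.sum_congr rfl fun l _ => by ring
              · ring
      simp_rw [e1]
      rw [Finset.sum_sub_distrib, ← Finset.mul_sum, ← Finset.sum_mul, ← hc]
      have : s * (x - x₀) = s * ℓ * ((x - x₀) / ℓ) := by field_simp
      rw [this]
      simp only [hθ, polyFun]
      ring
    rw [h1]
    refine (hF.const_mul ω₀).add (IsBiPoly.const_mul ?_ _)
    refine IsBiPoly.sum _ fun i _ => IsBiPoly.sum _ fun l _ => IsBiPoly.const_mul ?_ _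
    exact isBiPoly_affine _ _ _ _ (Nat.lt_succ_iff.1 i.2) (min_le_right _ _)
  · have h1 := hinv t₀ t₁ x₀ x₁ ht hx c
    simp_rw [← hτd, ← hℓd, ← hc] at h1
    have h2 : S ^ 2 ≤ (k + 1) * ∑ i, ∑ l, c i l ^ 2 := by
      calc S ^ 2 ≤ (Finset.univ : Finset (Fin (k + 1))).card * ∑ i, |d i| ^ 2 :=
            sq_sum_le_card_mul_sum_sq
        _ ≤ (k + 1) * ∑ i, ∑ l, c i l ^ 2 := by
            simp only [Finset.card_univ, Fintype.card_fin, sq_abs]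
            push_cast
            refine mul_le_mul_of_nonneg_left (Finset.sum_le_sum fun i _ => ?_) (by positivity)
            exact Finset.single_le_sum (f := fun l => c i l ^ 2) (fun l _ => sq_nonneg _)
              (Finset.mem_univ _)
    calc τ * ℓ * ((k + 1) * S) ^ 2 = (k + 1) ^ 2 * (τ * ℓ) * S ^ 2 := by ring
      _ ≤ (k + 1) ^ 2 * (τ * ℓ) * ((k + 1) * ∑ i, ∑ l, c i l ^ 2) := by gcongr
      _ = (k + 1) ^ 3 * (τ * ℓ * ∑ i, ∑ l, c i l ^ 2) := by ring
      _ ≤ (k + 1) ^ 3 * (C * ∫ p in Ioo t₀ t₁ ×ˢ Ioo x₀ x₁, F p.1 p.2 ^ 2) := by gcongr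
      _ = _ := by ring
  · intro t htt x hxx
    have hT := sub_div_sub_mem_Icc htt
    have hX := sub_div_sub_mem_Icc hxx
    rw [← hτd] at hT
    rw [← hℓd] at hX
    have hp := abs_polyFun_le d hT
    have hdp := abs_deriv_polyFun_le d hT
    have hb : |((x - x₀) / ℓ) ^ k * ((x - x₀) / ℓ - 1)| ≤ 1 := by
      rw [abs_mul, abs_of_nonneg (pow_nonneg hX.1 _), abs_of_nonpos (by linarith [hX.2])]
      exact mul_le_one₀ (pow_le_one₀ hX.1 hX.2) (by linarith [hX.2]) (by linarith [hX.1])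
    refine ⟨?_, ?_, ?_⟩
    · simp only [hθ]
      rw [abs_mul, abs_mul, abs_neg, abs_mul, abs_of_pos hℓ]
      calc |s| * ℓ * |polyFun d ((t - t₀) / τ)| * _ ≤ 1 * ℓ * S * 1 := by gcongr
        _ ≤ ℓ * ((k + 1) * S) := by nlinarith [mul_nonneg hℓ.le hS0]
    · rw [hpx, abs_mul, abs_mul, abs_neg]
      have hd1 : |(k + 1) * ((x - x₀) / ℓ) ^ k - k * ((x - x₀) / ℓ) ^ (k - 1)| ≤ (k + 1 : ℝ) := by
        have e1 := pow_le_one₀ hX.1 hX.2 (n := k)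
        have e2 := pow_le_one₀ hX.1 hX.2 (n := k - 1)
        have e3 := pow_nonneg hX.1 k
        have e4 := pow_nonneg hX.1 (k - 1)
        have e5 : (0 : ℝ) ≤ k := Nat.cast_nonneg k
        rw [abs_le]
        constructor <;> nlinarith
      calc |s| * |polyFun d ((t - t₀) / τ)| * _ ≤ 1 * S * (k + 1) := by gcongr
        _ = (k + 1) * S := by ring
    · rw [hpt, abs_mul, abs_mul, abs_neg, abs_mul, abs_of_pos hℓ, abs_mul,
        abs_of_pos (one_div_pos.2 hτ)]
      calc _ ≤ τ * (1 * ℓ * ((k + 1) * S * (1 / τ)) * 1) := by gcongr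
        _ = ℓ * ((k + 1) * S) := by field_simp

end Superapproximation


/-! ### Assembling functions from pieces on consecutive intervals. -/

section Gluing

/-- The function equal to `G j` on the `j`-th half-open interval between consecutive nodes. -/
noncomputable def glue {N : ℕ} (x : Fin (N + 1) → ℝ) (G : Fin N → ℝ → ℝ) (y : ℝ) : ℝ :=
  ∑ j, (Ioc (x j.castSucc) (x j.succ)).indicator (G j) y

lemma disjoint_Ioc_nodes {N : ℕ} {x : Fin (N + 1) → ℝ} (hx : StrictMono x) {i j : Fin N}
    (hij : i ≠ j) : Disjoint (Ioc (x i.castSucc) (x i.succ)) (Ioc (x j.castSucc) (x j.succ)) := by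
  wlog h : i < j generalizing i j
  · exact (this hij.symm (lt_of_le_of_ne (not_lt.1 h) hij.symm)).symm
  rw [Set.disjoint_left]
  intro y hy hy'
  have : x i.succ ≤ x j.castSucc := hx.monotone (Fin.succ_le_castSucc_iff.2 h)
  linarith [hy.2, hy'.1]

lemma glue_of_mem_Ioc {N : ℕ} {x : Fin (N + 1) → ℝ} (hx : StrictMono x) (G : Fin N → ℝ → ℝ)
    {j : Fin N} {y : ℝ} (hy : y ∈ Ioc (x j.castSucc) (x j.succ)) : glue x G y = G j y := by
  unfold glue
  rw [Finset.sum_eq_single j, indicator_of_mem hy]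
  · intro i _ hij
    exact indicator_of_notMem (fun h => Set.disjoint_left.1 (disjoint_Ioc_nodes hx hij) h hy) _
  · simp

/-- A node belongs to the interval on its left, so formulas extend to closed intervals when
neighbouring pieces share the nodal values `v`. The first node lies in no interval and gets the
default 0, hence `v 0 = 0`. -/
lemma glue_of_mem_Icc {N : ℕ} {x : Fin (N + 1) → ℝ} (hx : StrictMono x) {G : Fin N → ℝ → ℝ}
    {v : Fin (N + 1) → ℝ} (hv : ∀ j : Fin N, G j (x j.castSucc) = v j.castSucc ∧
      G j (x j.succ) = v j.succ) (hv0 : v 0 = 0)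
    {j : Fin N} {y : ℝ} (hy : y ∈ Icc (x j.castSucc) (x j.succ)) : glue x G y = G j y := by
  rcases eq_or_lt_of_le hy.1 with h | h
  · rw [← h, (hv j).1]
    rcases Fin.eq_zero_or_eq_succ j.castSucc with h0 | ⟨i, hi⟩
    · rw [h0, hv0]
      refine Finset.sum_eq_zero fun i _ => indicator_of_notMem (fun hm => ?_) _
      exact absurd hm.1 (not_lt.2 (hx.monotone (Fin.zero_le _)))
    · rw [hi, glue_of_mem_Ioc hx G (j := i) ⟨hx Fin.castSucc_lt_succ, le_rfl⟩, (hv i).2]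
  · exact glue_of_mem_Ioc hx G ⟨h, hy.2⟩

lemma measurable_glue {N : ℕ} (x : Fin (N + 1) → ℝ) {G : Fin N → ℝ → ℝ}
    (hG : ∀ j, Measurable (G j)) : Measurable (glue x G) := by
  unfold glue
  exact Finset.measurable_sum _ fun j _ => (hG j).indicator measurableSet_Ioc

end Gluing

/-! ### Scalar finite elements, the strip weight and superapproximation on a slab. -/

section FiniteElements

variable {T a b : ℝ} (𝒯 : Mesh T a b)

lemma Mesh.Ioo_ae_eq :
    Ioo a b =ᵐ[volume] ⋃ j : Fin 𝒯.N, Ioo (𝒯.x j.castSucc) (𝒯.x j.succ) := by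
  filter_upwards [𝒯.ae_notMem_range_x] with y hy
  refine propext ⟨fun h => mem_iUnion.2 (𝒯.exists_x_mem_Ioo (Ioo_subset_Ioc_self h) hy),
    fun h => ?_⟩
  obtain ⟨j, hj⟩ := mem_iUnion.1 h
  exact ⟨(𝒯.a_le_x _).trans_lt hj.1, hj.2.trans_le (𝒯.x_le_b _)⟩

lemma Mesh.integral_Ioo_eq_sum {f : ℝ → ℝ} (hf : IntegrableOn f (Ioo a b)) :
    ∫ y in Ioo a b, f y = ∑ j : Fin 𝒯.N, ∫ y in Ioo (𝒯.x j.castSucc) (𝒯.x j.succ), f y := by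
  rw [setIntegral_congr_set 𝒯.Ioo_ae_eq]
  refine integral_iUnion_fintype (fun _ => measurableSet_Ioo)
    (fun i j hij => disjoint_Ioo_nodes 𝒯.x_strictMono hij) fun j => hf.mono_set ?_
  exact fun y hj => ⟨(𝒯.a_le_x _).trans_lt hj.1, hj.2.trans_le (𝒯.x_le_b _)⟩

variable (m : Fin 𝒯.M)

/-- Scalar finite element functions on the slab with index `m`. -/
def Mesh.IsScalarFE (k : ℕ) (g : ℝ → ℝ → ℝ) : Prop :=
  (∀ j : Fin 𝒯.N, ∃ F : ℝ → ℝ → ℝ, IsBiPoly k F ∧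
    ∀ t ∈ Icc (𝒯.t m.castSucc) (𝒯.t m.succ), ∀ y ∈ Icc (𝒯.x j.castSucc) (𝒯.x j.succ),
      g t y = F t y) ∧
  ∀ t ∈ Icc (𝒯.t m.castSucc) (𝒯.t m.succ), g t a = 0 ∧ g t b = 0

variable {𝒯 m}

lemma Mesh.IsScalarFE.piecewiseC1 {k : ℕ} {g : ℝ → ℝ → ℝ} (hg : 𝒯.IsScalarFE m k g) :
    𝒯.PiecewiseC1 m g := fun j => by
  obtain ⟨F, hF, h⟩ := hg.1 j
  exact ⟨F, hF.contDiff, h⟩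

/-- Weight that is affine upstream of the node `z` with respect to the direction `s`, and zero
downstream of it. -/
noncomputable def stripWeight (s z y : ℝ) : ℝ := max (s * (z - y)) 0

/-- The region upstream of the node `z` with respect to the direction `s`. -/
def strip (s z : ℝ) : Set ℝ := {y | 0 < s * (z - y)}

lemma mem_strip {s z y : ℝ} : y ∈ strip s z ↔ 0 < s * (z - y) := by
  rw [strip, mem_ofPred_eq]

lemma isOpen_strip (s z : ℝ) : IsOpen (strip s z) :=
  isOpen_lt continuous_const (by fun_prop)

lemma continuous_stripWeight (s z : ℝ) : Continuous (stripWeight s z) := by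
  unfold stripWeight; fun_prop

lemma stripWeight_nonneg (s z y : ℝ) : 0 ≤ stripWeight s z y := le_max_right _ _

lemma stripWeight_of_mem {s z y : ℝ} (h : y ∈ strip s z) : stripWeight s z y = s * (z - y) :=
  max_eq_left (mem_strip.1 h).le

lemma stripWeight_of_notMem {s z y : ℝ} (h : y ∉ strip s z) : stripWeight s z y = 0 :=
  max_eq_right (not_lt.1 (mem_strip.not.1 h))

/-- The threshold is a mesh node, so it cuts no element. Hence the weight is affine or zero on each
element and its kink never falls inside one. -/
lemma Mesh.strip_dichotomy {s : ℝ} (hs : s = 1 ∨ s = -1) (i : Fin (𝒯.N + 1)) (j : Fin 𝒯.N) :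
    (∀ y ∈ Icc (𝒯.x j.castSucc) (𝒯.x j.succ), s * (𝒯.x i - y) ≤ 0) ∨
    ((∀ y ∈ Icc (𝒯.x j.castSucc) (𝒯.x j.succ), 0 ≤ s * (𝒯.x i - y)) ∧
      Ioo (𝒯.x j.castSucc) (𝒯.x j.succ) ⊆ strip s (𝒯.x i)) := by
  have hcase : 𝒯.x i ≤ 𝒯.x j.castSucc ∨ 𝒯.x j.succ ≤ 𝒯.x i := by
    rcases le_or_gt i j.castSucc with h | h
    · exact Or.inl (𝒯.x_strictMono.monotone h)
    · exact Or.inr (𝒯.x_strictMono.monotone (Fin.castSucc_lt_iff_succ_le.1 h))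
  rcases hs with rfl | rfl <;> rcases hcase with h | h
  · left; intro y hy; linarith [hy.1]
  · right; refine ⟨fun y hy => by linarith [hy.2], fun y hy => ?_⟩
    rw [mem_strip]; linarith [hy.2]
  · right; refine ⟨fun y hy => by linarith [hy.1], fun y hy => ?_⟩
    rw [mem_strip]; linarith [hy.1]
  · left; intro y hy; linarith [hy.2]

lemma Mesh.piecewiseC1_stripWeight {s : ℝ} (hs : s = 1 ∨ s = -1) (i : Fin (𝒯.N + 1)) :
    𝒯.PiecewiseC1 m fun _ y => stripWeight s (𝒯.x i) y := fun j => by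
  rcases 𝒯.strip_dichotomy hs i j with h | ⟨h, -⟩
  · exact ⟨fun _ _ => 0, contDiff_const, fun t _ y hy => max_eq_right (h y hy)⟩
  · exact ⟨fun _ y => s * (𝒯.x i - y), by simp only [Function.uncurry_def]; fun_prop,
      fun t _ y hy => max_eq_left (h y hy)⟩

/-- Superapproximation: the product of a finite element function and the strip weight is close to
the finite element space. -/
lemma Mesh.exists_superapproximation (k : ℕ) (hk : 1 ≤ k) {c₀ : ℝ} (hc₀ : 0 < c₀) :
    ∃ C : ℝ, 0 < C ∧ ∀ {T a b : ℝ} (𝒯 : Mesh T a b) (h : ℝ), 0 < h → 𝒯.IsQuasiUniform c₀ h →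
    ∀ (m : Fin 𝒯.M) (w : ℝ → ℝ → ℝ), 𝒯.IsScalarFE m k w → ∀ s : ℝ, s = 1 ∨ s = -1 →
    ∀ i : Fin (𝒯.N + 1), ∃ (θ : ℝ → ℝ → ℝ) (A : ℝ → ℝ),
      𝒯.PiecewiseC1 m θ ∧ 𝒯.IsScalarFE m k (fun t y => stripWeight s (𝒯.x i) y * w t y - θ t y) ∧
      Measurable A ∧ (∃ B, ∀ y, |A y| ≤ B) ∧ (∀ y, 0 ≤ A y) ∧
      (∀ t ∈ Icc (𝒯.t m.castSucc) (𝒯.t m.succ), ∀ y ∈ Ioc a b, |θ t y| ≤ h * A y) ∧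
      (∀ j, ∀ p ∈ 𝒯.elem m j, |pdx θ p.1 p.2| ≤ A p.2 ∧ |pdt θ p.1 p.2| ≤ c₀⁻¹ * A p.2) ∧
      (𝒯.t m.succ - 𝒯.t m.castSucc) * ∫ y in Ioo a b, A y ^ 2 ≤
        C * ∫ p in 𝒯.slab m, (univ ×ˢ strip s (𝒯.x i)).indicator (fun p => w p.1 p.2 ^ 2) p := by
  obtain ⟨C, hC, hbub⟩ := exists_bubble k hk
  refine ⟨C, hC, fun {T a b} 𝒯 h hh hqu m w hw s hs i => ?_⟩
  have hs1 : |s| ≤ 1 := by rcases hs with rfl | rfl <;> simp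
  set τ := 𝒯.t m.succ - 𝒯.t m.castSucc with hτd
  have hτ : 0 < τ := sub_pos.2 (𝒯.t_lt m)
  have hint : IntegrableOn
      ((univ ×ˢ strip s (𝒯.x i)).indicator fun p : ℝ × ℝ => w p.1 p.2 ^ 2) (𝒯.slab m) :=
    ((hw.piecewiseC1.mul hw.piecewiseC1).piecewiseContinuous.integrable.congr
      (ae_of_all _ fun p => (sq (w p.1 p.2)).symm)).indicator
      (MeasurableSet.univ.prod (isOpen_strip _ _).measurableSet)
  have hel : ∀ j : Fin 𝒯.N, ∃ (θ : ℝ → ℝ → ℝ) (A : ℝ), 0 ≤ A ∧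
      ContDiff ℝ 1 (Function.uncurry θ) ∧
      (∀ t, θ t (𝒯.x j.castSucc) = 0 ∧ θ t (𝒯.x j.succ) = 0) ∧
      (∃ G, IsBiPoly k G ∧ ∀ t ∈ Icc (𝒯.t m.castSucc) (𝒯.t m.succ),
        ∀ y ∈ Icc (𝒯.x j.castSucc) (𝒯.x j.succ),
          stripWeight s (𝒯.x i) y * w t y - θ t y = G t y) ∧
      τ * (𝒯.x j.succ - 𝒯.x j.castSucc) * A ^ 2 ≤ C * ∫ p in 𝒯.elem m j,
        (univ ×ˢ strip s (𝒯.x i)).indicator (fun p => w p.1 p.2 ^ 2) p ∧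
      ∀ t ∈ Icc (𝒯.t m.castSucc) (𝒯.t m.succ), ∀ y ∈ Icc (𝒯.x j.castSucc) (𝒯.x j.succ),
        |θ t y| ≤ h * A ∧ |pdx θ t y| ≤ A ∧ |pdt θ t y| ≤ c₀⁻¹ * A := by
    intro j
    obtain ⟨F, hF, hwF⟩ := hw.1 j
    -- Downstream the weight is zero and needs no correction. Upstream the element bubble is taken
    -- with the value of the weight at the left node as constant term.
    rcases 𝒯.strip_dichotomy hs i j with hz | ⟨hz, hsub⟩
    · refine ⟨fun _ _ => 0, 0, le_rfl, contDiff_const, fun _ => ⟨rfl, rfl⟩,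
        ⟨fun _ _ => 0, ⟨0, by simp⟩, fun t _ y hy => ?_⟩, ?_, fun t _ y _ => ?_⟩
      · rw [stripWeight, max_eq_right (hz y hy)]; simp
      · rw [zero_pow two_ne_zero, mul_zero]
        exact mul_nonneg hC.le
          (integral_nonneg fun p => indicator_nonneg (fun _ _ => sq_nonneg _) _)
      · simp [pdx, pdt]
    · obtain ⟨θ, A, hA, hθ, hθ0, hG, hL2, hb⟩ := hbub _ _ _ _ (𝒯.t_lt m) (𝒯.x_lt j) F hF s
        (s * (𝒯.x i - 𝒯.x j.castSucc)) hs1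
      have hℓ := sub_pos.2 (𝒯.x_lt j)
      have hℓh := (hqu.2 j).2
      refine ⟨θ, A, hA, hθ, hθ0, ⟨_, hG, fun t ht y hy => ?_⟩, ?_, fun t ht y hy => ?_⟩
      · rw [stripWeight, max_eq_left (hz y hy), hwF t ht y hy]; ring
      · refine hL2.trans_eq ?_
        congr 1
        refine setIntegral_congr_fun (𝒯.measurableSet_elem m j) fun p hp => ?_
        rw [indicator_of_mem (mem_prod.2 ⟨mem_univ _, hsub hp.2⟩),
          hwF _ (Ioo_subset_Icc_self hp.1) _ (Ioo_subset_Icc_self hp.2)]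
      · obtain ⟨h1, h2, h3⟩ := hb t ht y hy
        refine ⟨h1.trans (by gcongr), h2, ?_⟩
        -- The time derivative scales with the ratio of the space step to the time step, which is at
        -- most 1 / c₀ by quasi-uniformity.
        have h4 : c₀ * h * |pdt θ t y| ≤ h * A :=
          calc c₀ * h * |pdt θ t y| ≤ τ * |pdt θ t y| := by gcongr; exact (hqu.1 m).1
            _ ≤ (𝒯.x j.succ - 𝒯.x j.castSucc) * A := h3
            _ ≤ h * A := by gcongr
        rw [inv_mul_eq_div, le_div_iff₀ hc₀]
        nlinarith
  choose θ A hA hθ hθ0 hG hL2 hb using hel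
  have hx := 𝒯.x_strictMono
  have hval : ∀ t (j : Fin 𝒯.N), ∀ y ∈ Icc (𝒯.x j.castSucc) (𝒯.x j.succ),
      glue 𝒯.x (fun j => θ j t) y = θ j t y := fun t j y hy =>
    glue_of_mem_Icc hx (v := 0) (fun j => hθ0 j t) rfl hy
  have hA' : ∀ y, 0 ≤ glue 𝒯.x (fun j _ => A j) y := fun y =>
    Finset.sum_nonneg fun j _ => indicator_nonneg (fun _ _ => hA j) _
  have hAm : Measurable (glue 𝒯.x fun j _ => A j) := measurable_glue _ fun j => measurable_const
  have hAB : ∀ y, |glue 𝒯.x (fun j _ => A j) y| ≤ ∑ j, A j := fun y => by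
    rw [abs_of_nonneg (hA' y)]
    exact Finset.sum_le_sum fun j _ => indicator_le_self' (fun _ _ => hA j) y
  refine ⟨fun t y => glue 𝒯.x (fun j => θ j t) y, glue 𝒯.x fun j _ => A j, ?_, ⟨?_, ?_⟩, hAm,
    ⟨_, hAB⟩, hA', ?_, ?_, ?_⟩
  · exact fun j => ⟨θ j, hθ j, fun t _ y hy => hval t j y hy⟩
  · intro j
    obtain ⟨G, hGp, hGe⟩ := hG j
    refine ⟨G, hGp, fun t ht y hy => ?_⟩
    simp only [hval t j y hy]
    exact hGe t ht y hy
  · intro t ht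
    obtain ⟨h0, h1⟩ := hw.2 t ht
    have e0 : glue 𝒯.x (fun j => θ j t) a = 0 :=
      Finset.sum_eq_zero fun j _ => indicator_of_notMem
        (fun hm => absurd hm.1 (not_lt.2 (𝒯.a_le_x _))) _
    have e1 : glue 𝒯.x (fun j => θ j t) b = 0 := by
      refine Finset.sum_eq_zero fun j _ => ?_
      by_cases hm : b ∈ Ioc (𝒯.x j.castSucc) (𝒯.x j.succ)
      · have : b = 𝒯.x j.succ := le_antisymm hm.2 (𝒯.x_le_b _)
        rw [indicator_of_mem hm]
        exact (congrArg (θ j t) this).trans (hθ0 j t).2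
      · exact indicator_of_notMem hm _
    simp only [h0, h1, e0, e1]; simp
  · intro t ht y hy
    obtain ⟨j, hj⟩ := 𝒯.exists_x_mem hy
    simp only [hval t j y (Ioc_subset_Icc_self hj), glue_of_mem_Ioc hx _ hj]
    exact (hb j t ht y (Ioc_subset_Icc_self hj)).1
  · intro j p hp
    have hv : ∀ t ∈ Icc (𝒯.t m.castSucc) (𝒯.t m.succ),
        ∀ y ∈ Icc (𝒯.x j.castSucc) (𝒯.x j.succ),
        (fun t y => glue 𝒯.x (fun j => θ j t) y) t y = θ j t y := fun t _ y hy => hval t j y hy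
    have e1 : pdx (fun t y => glue 𝒯.x (fun j => θ j t) y) p.1 p.2 = pdx (θ j) p.1 p.2 :=
      (eventuallyEq_x hv hp).deriv_eq
    have e2 : pdt (fun t y => glue 𝒯.x (fun j => θ j t) y) p.1 p.2 = pdt (θ j) p.1 p.2 :=
      (eventuallyEq_t hv hp).deriv_eq
    rw [e1, e2, glue_of_mem_Ioc hx _ (Ioo_subset_Ioc_self hp.2)]
    exact (hb j _ (Ioo_subset_Icc_self hp.1) _ (Ioo_subset_Icc_self hp.2)).2
  · have hAi : IntegrableOn (fun y => glue 𝒯.x (fun j _ => A j) y ^ 2) (Ioo a b) := by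
      refine Integrable.of_bound (C := (∑ j, A j) ^ 2)
        (hAm.pow_const 2).aestronglyMeasurable (ae_of_all _ fun y => ?_)
      rw [Real.norm_eq_abs, abs_pow]
      exact pow_le_pow_left₀ (abs_nonneg _) (hAB y) 2
    rw [𝒯.integral_Ioo_eq_sum hAi, 𝒯.integral_slab_eq_sum m hint, Finset.mul_sum, Finset.mul_sum]
    refine Finset.sum_le_sum fun j _ => le_trans (le_of_eq ?_) (hL2 j)
    have : ∫ y in Ioo (𝒯.x j.castSucc) (𝒯.x j.succ), glue 𝒯.x (fun j _ => A j) y ^ 2 =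
        ∫ y in Ioo (𝒯.x j.castSucc) (𝒯.x j.succ), A j ^ 2 :=
      setIntegral_congr_fun measurableSet_Ioo fun y hy => by
        simp only [glue_of_mem_Ioc hx (fun j _ => A j) (Ioo_subset_Ioc_self hy)]
    rw [this, setIntegral_const, Real.volume_real_Ioo_of_le (𝒯.x_lt j).le, smul_eq_mul, mul_assoc]

end FiniteElements


/-! ### The weighted energy estimate upstream of a node, on one slab. -/

section StripEstimate

variable {T a b : ℝ}

/-- The streamline diffusion equation for one scalar component `w` on one slab. The functions
`re`, `rp`, `rq` are the components of the residual paired with a test function and its two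
derivatives, and `wm` is the trace of `w` from the previous slab. -/
structure Mesh.IsScalarSD (𝒯 : Mesh T a b) (m : Fin 𝒯.M) (k : ℕ) (δ : ℝ) (w : ℝ → ℝ → ℝ)
    (re rp rq ρ : ℝ × ℝ → ℝ) (wm : ℝ → ℝ) : Prop where
  fe : 𝒯.IsScalarFE m k w
  memLp_re : MemLp re 2 (volume.restrict (𝒯.slab m))
  memLp_rp : MemLp rp 2 (volume.restrict (𝒯.slab m))
  memLp_rq : MemLp rq 2 (volume.restrict (𝒯.slab m))
  memLp_ρ : MemLp ρ 2 (volume.restrict (𝒯.slab m))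
  memLp_wm : MemLp wm 2 (volume.restrict (Ioo a b))
  re_le : ∀ z, |re z| ≤ 2 * ρ z
  rp_le : ∀ z, |rp z| ≤ 2 * ρ z
  rq_le : ∀ z, |rq z| ≤ 2 * ρ z
  orth : ∀ g, 𝒯.IsScalarFE m k g →
    ∫ z in 𝒯.slab m, (re z * g z.1 z.2 + δ * (rp z * pdt g z.1 z.2 + rq z * pdx g z.1 z.2)) =
      ∫ y in Ioo a b, (w (𝒯.t m.castSucc) y - wm y) * g (𝒯.t m.castSucc) y

variable {𝒯 : Mesh T a b} {m : Fin 𝒯.M}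

lemma Mesh.IsScalarSD.integrable_test {k : ℕ} {δ : ℝ} {w : ℝ → ℝ → ℝ} {re rp rq ρ : ℝ × ℝ → ℝ}
    {wm : ℝ → ℝ} (H : 𝒯.IsScalarSD m k δ w re rp rq ρ wm) {g : ℝ → ℝ → ℝ}
    (hg : 𝒯.PiecewiseC1 m g) :
    Integrable (fun z => re z * g z.1 z.2 + δ * (rp z * pdt g z.1 z.2 + rq z * pdx g z.1 z.2))
      (volume.restrict (𝒯.slab m)) :=
  (H.memLp_re.integrable_mul (hg.piecewiseContinuous.memLp 2)).add
    (((H.memLp_rp.integrable_mul (hg.piecewiseContinuous_pdt.memLp 2)).add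
      (H.memLp_rq.integrable_mul (hg.piecewiseContinuous_pdx.memLp 2))).const_mul δ)

lemma hasDerivAt_stripWeight {s z y : ℝ} (h : y ∈ strip s z) :
    HasDerivAt (stripWeight s z) (-s) y := by
  have h1 : stripWeight s z =ᶠ[𝓝 y] fun x => s * (z - x) := by
    filter_upwards [(isOpen_strip s z).mem_nhds h] with x hx using stripWeight_of_mem hx
  refine HasDerivAt.congr_of_eventuallyEq ?_ h1
  simpa using ((hasDerivAt_id y).const_sub z).const_mul s

lemma Mesh.hasDerivAt_stripWeight_elem {s : ℝ} (hs : s = 1 ∨ s = -1) (i : Fin (𝒯.N + 1))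
    {j : Fin 𝒯.N} {y : ℝ} (hy : y ∈ Ioo (𝒯.x j.castSucc) (𝒯.x j.succ)) :
    HasDerivAt (stripWeight s (𝒯.x i)) (-s * (strip s (𝒯.x i)).indicator 1 y) y := by
  rcases 𝒯.strip_dichotomy hs i j with h | ⟨-, h⟩
  · have hn : ∀ x ∈ Ioo (𝒯.x j.castSucc) (𝒯.x j.succ), x ∉ strip s (𝒯.x i) := fun x hx hx' =>
      absurd (mem_strip.1 hx') (not_lt.2 (h x (Ioo_subset_Icc_self hx)))
    rw [indicator_of_notMem (hn y hy), mul_zero]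
    refine (hasDerivAt_const y (0 : ℝ)).congr_of_eventuallyEq ?_
    filter_upwards [isOpen_Ioo.mem_nhds hy] with x hx using stripWeight_of_notMem (hn x hx)
  · rw [indicator_of_mem (h hy), Pi.one_apply, mul_one]
    exact hasDerivAt_stripWeight (h hy)

/-- The integrand of the scheme for the test function β w - θ, where β has derivative -s σ. By `h1`
the part β w produces the transport derivative of -β w² / 2 and the good term -σ w² / 2, and by `h2`
the streamline part with β may be dropped. Everything left is h ρ times a multiple of A or σ |w|.
Young's inequality splits it with small weights on σ w² and on A², the latter depending on the
superapproximation constant `C`. -/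
lemma strip_pointwise_bound {s : ℝ} (hs : s = 1 ∨ s = -1)
    {re rp rq ρ w wt wx β σ θ θt θx A h δ₀ c₀ C : ℝ}
    (hh : 0 < h) (hδ₀ : 0 < δ₀) (hc₀ : 0 < c₀) (hC : 0 < C)
    (hσ : σ = 0 ∨ σ = 1)
    (hre : |re| ≤ 2 * ρ) (hrp : |rp| ≤ 2 * ρ) (hrq : |rq| ≤ 2 * ρ)
    (hθ : |θ| ≤ h * A) (hθx : |θx| ≤ A) (hθt : |θt| ≤ c₀⁻¹ * A)
    (h1 : β * re = -(β * (wt + s * wx))) (h2 : β * (wt * rp + wx * rq) ≤ 0) :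
    re * (β * w - θ) + δ₀ * h * (rp * (β * wt - θt) + rq * (β * wx - s * σ * w - θx)) ≤
      -(β * w * wt) - s * (β * w * wx - s * σ * w ^ 2 / 2) - σ * w ^ 2 / 2
        + (2 + 4 * C) * (2 + 2 * δ₀ * (c₀⁻¹ + 1)) ^ 2 * h ^ 2 * ρ ^ 2
        + σ * w ^ 2 / 8 + (16 * C)⁻¹ * A ^ 2 := by
  set K := 2 + 2 * δ₀ * (c₀⁻¹ + 1) with hK
  have hρ : 0 ≤ ρ := by linarith [(abs_nonneg _).trans hre]
  have hc : 0 < c₀⁻¹ := inv_pos.2 hc₀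
  have hσ2 : σ ^ 2 = σ := by rcases hσ with rfl | rfl <;> norm_num
  have hσ0 : 0 ≤ σ := by rcases hσ with rfl | rfl <;> norm_num
  have hs2 : s ^ 2 = 1 := by rcases hs with rfl | rfl <;> norm_num
  have hsa : |s| = 1 := by rcases hs with rfl | rfl <;> norm_num
  have e1 : -(re * θ) ≤ 2 * ρ * (h * A) := by
    refine (neg_le_abs _).trans ?_
    rw [abs_mul]; gcongr
  have e2 : -(rp * θt) ≤ 2 * ρ * (c₀⁻¹ * A) := by
    refine (neg_le_abs _).trans ?_
    rw [abs_mul]; gcongr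
  have e3 : -(rq * θx) ≤ 2 * ρ * A := by
    refine (neg_le_abs _).trans ?_
    rw [abs_mul]; gcongr
  have e4 : -(rq * (s * σ * w)) ≤ 2 * ρ * (σ * |w|) := by
    refine (neg_le_abs _).trans ?_
    rw [abs_mul, abs_mul, abs_mul, hsa, one_mul, abs_of_nonneg hσ0]; gcongr
  have hd : 0 ≤ δ₀ * h := by positivity
  have hmain : re * (β * w - θ) + δ₀ * h * (rp * (β * wt - θt) + rq * (β * wx - s * σ * w - θx)) ≤
      -(β * w * wt) - s * (β * w * wx) + 2 * ρ * (h * A)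
        + δ₀ * h * (2 * ρ * (c₀⁻¹ * A) + 2 * ρ * A + 2 * ρ * (σ * |w|)) := by
    have f1 : re * (β * w) = -(β * w * wt) - s * (β * w * wx) := by linear_combination w * h1
    have f2 := mul_le_mul_of_nonneg_left e2 hd
    have f3 := mul_le_mul_of_nonneg_left e3 hd
    have f4 := mul_le_mul_of_nonneg_left e4 hd
    have f5 := mul_le_mul_of_nonneg_left h2 hd
    linear_combination f1 + e1 + f2 + f3 + f4 + f5
  have hY : 2 * ρ * (h * A) + δ₀ * h * (2 * ρ * (c₀⁻¹ * A) + 2 * ρ * A + 2 * ρ * (σ * |w|)) ≤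
      K * h * ρ * A + K * h * ρ * (σ * |w|) := by
    have g1 : 0 ≤ h * ρ * (σ * |w|) := by positivity
    have g2 : 0 ≤ 2 + 2 * δ₀ * c₀⁻¹ := by positivity
    have := mul_nonneg g2 g1
    rw [hK]
    linear_combination this
  have hY1 : K * h * ρ * A ≤ 4 * C * (K * h * ρ) ^ 2 + (16 * C)⁻¹ * A ^ 2 := by
    have : 4 * C * (K * h * ρ) ^ 2 + (16 * C)⁻¹ * A ^ 2 - K * h * ρ * A =
        4 * C * (K * h * ρ - (8 * C)⁻¹ * A) ^ 2 := by field_simp; ring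
    linarith [mul_nonneg (by positivity : 0 ≤ 4 * C) (sq_nonneg (K * h * ρ - (8 * C)⁻¹ * A))]
  have hY2 : K * h * ρ * (σ * |w|) ≤ 2 * (K * h * ρ) ^ 2 + σ * w ^ 2 / 8 := by
    have : (σ * |w|) ^ 2 = σ * w ^ 2 := by rw [mul_pow, hσ2, sq_abs]
    linear_combination 2 * sq_nonneg (K * h * ρ - σ * |w| / 4) + this / 8
  have hs3 : s * (β * w * wx - s * σ * w ^ 2 / 2) = s * (β * w * wx) - σ * w ^ 2 / 2 := by
    linear_combination (-(σ * w ^ 2 / 2)) * hs2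
  rw [hs3]
  calc _ ≤ _ := hmain
    _ ≤ -(β * w * wt) - s * (β * w * wx) + (4 * C * (K * h * ρ) ^ 2 + (16 * C)⁻¹ * A ^ 2)
        + (2 * (K * h * ρ) ^ 2 + σ * w ^ 2 / 8) := by linarith
    _ = _ := by ring

/-- Energy estimate upstream of a node, on one slab. -/
lemma Mesh.exists_strip_estimate_slab (k : ℕ) (hk : 1 ≤ k) {δ₀ c₀ : ℝ} (hδ₀ : 0 < δ₀)
    (hc₀ : 0 < c₀) :
    ∃ C : ℝ, 0 < C ∧ ∀ {T a b : ℝ}, a < b → ∀ (𝒯 : Mesh T a b) (h : ℝ), 0 < h →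
    𝒯.IsQuasiUniform c₀ h → ∀ (m : Fin 𝒯.M) (w : ℝ → ℝ → ℝ) (re rp rq ρ : ℝ × ℝ → ℝ) (wm : ℝ → ℝ),
    𝒯.IsScalarSD m k (δ₀ * h) w re rp rq ρ wm → ∀ s : ℝ, s = 1 ∨ s = -1 → ∀ i : Fin (𝒯.N + 1),
    (∀ᵐ z ∂(volume.restrict (𝒯.slab m)), z.2 ∈ strip s (𝒯.x i) →
      re z = -(pdt w z.1 z.2 + s * pdx w z.1 z.2) ∧
      pdt w z.1 z.2 * rp z + pdx w z.1 z.2 * rq z ≤ 0) →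
    (1 / 2) * (∫ y in Ioo a b, stripWeight s (𝒯.x i) y * w (𝒯.t m.succ) y ^ 2)
      + (1 / 4) * (∫ z in 𝒯.slab m,
          (univ ×ˢ strip s (𝒯.x i)).indicator (fun z => w z.1 z.2 ^ 2) z) ≤
    (1 / 2) * (∫ y in Ioo a b, stripWeight s (𝒯.x i) y * wm y ^ 2)
      + C * (h ^ 2 * (∫ z in 𝒯.slab m, ρ z ^ 2)
        + (𝒯.t m.succ - 𝒯.t m.castSucc) * ∫ y in Ioo a b, (w (𝒯.t m.castSucc) y - wm y) ^ 2) := by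
  obtain ⟨C, hC, hsup⟩ := Mesh.exists_superapproximation k hk hc₀
  set K := 2 + 2 * δ₀ * (c₀⁻¹ + 1) with hK
  have hD1 : 0 ≤ (2 + 4 * C) * K ^ 2 := by positivity
  -- The first summand pays for the residual in the slab, the second for the jump tested with the
  -- bubble at the initial time.
  refine ⟨(2 + 4 * C) * K ^ 2 + 4 * C / c₀ ^ 2, by positivity, ?_⟩
  intro T a b hab 𝒯 h hh hqu m w re rp rq ρ wm H s hs i hst
  obtain ⟨θ, A, hθ1, hg, hAm, ⟨B, hAB⟩, hA, hθA, hθd, hAint⟩ := hsup 𝒯 h hh hqu m w H.fe s hs i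
  set τ := 𝒯.t m.succ - 𝒯.t m.castSucc with hτd
  have hτ : 0 < τ := sub_pos.2 (𝒯.t_lt m)
  have hτh : c₀ * h ≤ τ := (hqu.1 m).1
  set t₀ := 𝒯.t m.castSucc with ht₀
  have ht₀m : t₀ ∈ Icc (𝒯.t m.castSucc) (𝒯.t m.succ) := left_mem_Icc.2 (𝒯.t_lt m).le
  have ht₁m : 𝒯.t m.succ ∈ Icc (𝒯.t m.castSucc) (𝒯.t m.succ) := right_mem_Icc.2 (𝒯.t_lt m).le
  set β := stripWeight s (𝒯.x i) with hβ
  set μ := (volume.restrict (𝒯.slab m) : Measure (ℝ × ℝ)) with hμ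
  set ν := (volume.restrict (Ioo a b) : Measure ℝ) with hν
  have hw1 := H.fe.piecewiseC1
  have hβ1 : 𝒯.PiecewiseC1 m fun _ y => β y := 𝒯.piecewiseC1_stripWeight hs i
  set f : ℝ → ℝ → ℝ := fun t y => 2⁻¹ * (β y * (w t y * w t y)) with hf
  have hf1 : 𝒯.PiecewiseC1 m f :=
    (Mesh.PiecewiseC1.of_contDiff (f := fun _ _ => 2⁻¹) contDiff_const).mul (hβ1.mul (hw1.mul hw1))
  set g : ℝ → ℝ → ℝ := fun t y => β y * w t y - θ t y with hgd
  set σw : ℝ × ℝ → ℝ := (univ ×ˢ strip s (𝒯.x i)).indicator fun z => w z.1 z.2 ^ 2 with hσw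
  -- integrability on the slab
  have hσi : Integrable σw μ :=
    ((hw1.mul hw1).piecewiseContinuous.integrable.congr
      (ae_of_all _ fun p => (sq (w p.1 p.2)).symm)).indicator
      (MeasurableSet.univ.prod (isOpen_strip _ _).measurableSet)
  have hA2 : Integrable (fun y => A y ^ 2) ν := by
    refine Integrable.of_bound (C := B ^ 2) (hAm.pow_const 2).aestronglyMeasurable
      (ae_of_all _ fun y => ?_)
    rw [Real.norm_eq_abs, abs_pow]
    exact pow_le_pow_left₀ (abs_nonneg _) (hAB y) 2
  have hAi : Integrable (fun z : ℝ × ℝ => A z.2 ^ 2) μ := by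
    rw [hμ, 𝒯.restrict_slab]; exact hA2.comp_snd _
  have hAI : ∫ z in 𝒯.slab m, A z.2 ^ 2 = τ * ∫ y in Ioo a b, A y ^ 2 := by
    rw [𝒯.restrict_slab, integral_fun_snd (fun y => A y ^ 2), smul_eq_mul]
    simp [Measure.real, hτd, ht₀, (𝒯.t_lt m).le]
  have hρi : Integrable (fun z => ρ z ^ 2) μ := H.memLp_ρ.integrable_sq
  have hfti := hf1.piecewiseContinuous_pdt.integrable
  have hfxi := hf1.piecewiseContinuous_pdx.integrable
  -- the pointwise estimate on the slab
  have hpt : ∀ᵐ z ∂μ, re z * g z.1 z.2 + δ₀ * h * (rp z * pdt g z.1 z.2 + rq z * pdx g z.1 z.2) ≤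
      -pdt f z.1 z.2 - s * pdx f z.1 z.2 - (1 / 2) * σw z
        + (2 + 4 * C) * K ^ 2 * h ^ 2 * ρ z ^ 2 + (1 / 8) * σw z + (16 * C)⁻¹ * A z.2 ^ 2 := by
    filter_upwards [𝒯.ae_exists_elem m, hst] with z ⟨j, hj⟩ hz
    have dw_t := hw1.hasDerivAt_t hj
    have dw_x := hw1.hasDerivAt_x hj
    have dθ_t := hθ1.hasDerivAt_t hj
    have dθ_x := hθ1.hasDerivAt_x hj
    have dβ := 𝒯.hasDerivAt_stripWeight_elem hs i hj.2
    set σ : ℝ := (strip s (𝒯.x i)).indicator 1 z.2 with hσ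
    have hσ01 : σ = 0 ∨ σ = 1 := by
      by_cases hm : z.2 ∈ strip s (𝒯.x i)
      · right; rw [hσ, indicator_of_mem hm]; rfl
      · left; rw [hσ, indicator_of_notMem hm]
    have hσwz : σw z = σ * w z.1 z.2 ^ 2 := by
      by_cases hm : z.2 ∈ strip s (𝒯.x i)
      · rw [hσw, hσ, indicator_of_mem hm, indicator_of_mem (mem_prod.2 ⟨mem_univ _, hm⟩)]; simp
      · rw [hσw, hσ, indicator_of_notMem hm, indicator_of_notMem fun h' => hm (mem_prod.1 h').2]
        simp
    have gt : pdt g z.1 z.2 = β z.2 * pdt w z.1 z.2 - pdt θ z.1 z.2 :=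
      ((dw_t.const_mul (β z.2)).sub dθ_t).deriv
    have gx : pdx g z.1 z.2 = β z.2 * pdx w z.1 z.2 - s * σ * w z.1 z.2 - pdx θ z.1 z.2 := by
      refine ((dβ.mul dw_x).sub dθ_x).deriv.trans ?_
      ring
    have ft : pdt f z.1 z.2 = β z.2 * w z.1 z.2 * pdt w z.1 z.2 := by
      refine ((((dw_t.mul dw_t).const_mul (β z.2)).const_mul 2⁻¹).deriv).trans ?_
      ring
    have fx : pdx f z.1 z.2 = β z.2 * w z.1 z.2 * pdx w z.1 z.2 - s * σ * w z.1 z.2 ^ 2 / 2 := by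
      refine (((dβ.mul (dw_x.mul dw_x)).const_mul 2⁻¹).deriv).trans ?_
      simp only [Pi.mul_apply]
      ring
    have hβre : β z.2 * re z = -(β z.2 * (pdt w z.1 z.2 + s * pdx w z.1 z.2)) ∧
        β z.2 * (pdt w z.1 z.2 * rp z + pdx w z.1 z.2 * rq z) ≤ 0 := by
      by_cases hm : z.2 ∈ strip s (𝒯.x i)
      · obtain ⟨e1, e2⟩ := hz hm
        refine ⟨by rw [e1]; ring, mul_nonpos_of_nonneg_of_nonpos (stripWeight_nonneg _ _ _) e2⟩
      · rw [hβ, stripWeight_of_notMem hm]; simp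
    have hzI : z.2 ∈ Ioc a b := Ioo_subset_Ioc_self (𝒯.elem_subset_slab m j hj).2
    have := strip_pointwise_bound hs hh hδ₀ hc₀ hC hσ01
      (H.re_le z) (H.rp_le z) (H.rq_le z)
      (hθA z.1 (Ioo_subset_Icc_self hj.1) z.2 hzI) (hθd j z hj).1 (hθd j z hj).2
      hβre.1 hβre.2 (w := w z.1 z.2)
    rw [gt, gx, ft, fx, hσwz]
    refine this.trans (le_of_eq ?_)
    rw [hK]; ring
  have hI1 : ∫ z in 𝒯.slab m,
        (re z * g z.1 z.2 + δ₀ * h * (rp z * pdt g z.1 z.2 + rq z * pdx g z.1 z.2)) ≤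
      -(∫ z in 𝒯.slab m, pdt f z.1 z.2) - s * (∫ z in 𝒯.slab m, pdx f z.1 z.2)
        - (1 / 2) * (∫ z in 𝒯.slab m, σw z)
        + (2 + 4 * C) * K ^ 2 * h ^ 2 * (∫ z in 𝒯.slab m, ρ z ^ 2)
        + (1 / 8) * (∫ z in 𝒯.slab m, σw z)
        + (16 * C)⁻¹ * (∫ z in 𝒯.slab m, A z.2 ^ 2) := by
    have j1 := hfti.neg
    have j2 := hfxi.const_mul s
    have j3 := hσi.const_mul (1 / 2)
    have j4 := hρi.const_mul ((2 + 4 * C) * K ^ 2 * h ^ 2)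
    have j5 := hσi.const_mul (1 / 8)
    have j6 := hAi.const_mul ((16 * C)⁻¹)
    refine (integral_mono_ae (H.integrable_test hg.piecewiseC1)
      (((((j1.sub j2).sub j3).add j4).add j5).add j6) hpt).trans (le_of_eq ?_)
    rw [integral_add' ((((j1.sub j2).sub j3).add j4).add j5) j6,
      integral_add' (((j1.sub j2).sub j3).add j4) j5, integral_add' ((j1.sub j2).sub j3) j4,
      integral_sub' (j1.sub j2) j3, integral_sub' j1 j2, integral_neg']
    simp only [integral_const_mul]
  -- Orthogonality turns the left side into the jump term. On the right the time derivative becomes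
  -- a difference of traces, and the space derivative integrates to zero since w vanishes at both
  -- ends.
  rw [H.orth g hg, hf1.integral_pdt hab, hf1.integral_pdx hab
    (fun t ht => by simp [hf, (H.fe.2 t ht).1, (H.fe.2 t ht).2])] at hI1
  -- the initial trace of the slab
  set J : ℝ → ℝ := fun y => w t₀ y - wm y with hJ
  have hw0 : MemLp (w t₀) 2 ν := hw1.memLp_slice hab ht₀m 2
  have hJ2 : MemLp J 2 ν := hw0.sub H.memLp_wm
  have hβb : MemLp β ⊤ ν := hβ1.memLp_slice hab ht₀m ⊤
  have hβi : ∀ {u : ℝ → ℝ}, MemLp u 2 ν → Integrable (fun y => β y * u y ^ 2) ν := fun hu =>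
    memLp_one_iff_integrable.1 ((memLp_one_iff_integrable.2 hu.integrable_sq).mul hβb)
  -- With J = w₊ - w₋ one has J w₊ = (w₊² - w₋² + J²) / 2. This trades the trace from above for the
  -- trace from below, and the square of J is dropped. The bubble is bounded by h A ≤ τ A / c₀, so
  -- its product with J carries the factor τ of the energy.
  have hI2 : (1 / 2) * (∫ y in Ioo a b, β y * w t₀ y ^ 2)
        - (1 / 2) * (∫ y in Ioo a b, β y * wm y ^ 2)
        - 4 * C / c₀ ^ 2 * τ * (∫ y in Ioo a b, J y ^ 2)
        - τ * (16 * C)⁻¹ * (∫ y in Ioo a b, A y ^ 2) ≤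
      ∫ y in Ioo a b, (w t₀ y - wm y) * g t₀ y := by
    have j1 := (hβi hw0).const_mul (1 / 2)
    have j2 := (hβi H.memLp_wm).const_mul (1 / 2)
    have j3 := hJ2.integrable_sq.const_mul (4 * C / c₀ ^ 2 * τ)
    have j4 := hA2.const_mul (τ * (16 * C)⁻¹)
    have hpt2 : ∀ᵐ y ∂ν, (1 / 2) * (β y * w t₀ y ^ 2) - (1 / 2) * (β y * wm y ^ 2)
        - 4 * C / c₀ ^ 2 * τ * J y ^ 2 - τ * (16 * C)⁻¹ * A y ^ 2 ≤ J y * g t₀ y := by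
      filter_upwards [ae_restrict_mem measurableSet_Ioo] with y hy
      have e1 := hθA t₀ ht₀m y (Ioo_subset_Ioc_self hy)
      have e2 : J y * θ t₀ y ≤ |J y| * (c₀⁻¹ * τ * A y) := by
        refine (le_abs_self _).trans ?_
        rw [abs_mul]
        have : h ≤ c₀⁻¹ * τ := by rw [inv_mul_eq_div, le_div_iff₀ hc₀]; linarith
        refine mul_le_mul_of_nonneg_left (e1.trans ?_) (abs_nonneg _)
        exact mul_le_mul_of_nonneg_right this (hA y)
      have e3 : |J y| * (c₀⁻¹ * τ * A y) ≤
          4 * C / c₀ ^ 2 * τ * J y ^ 2 + τ * (16 * C)⁻¹ * A y ^ 2 := by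
        have : 4 * C / c₀ ^ 2 * τ * |J y| ^ 2 + τ * (16 * C)⁻¹ * A y ^ 2
            - |J y| * (c₀⁻¹ * τ * A y) =
            τ * (4 * C) * (c₀⁻¹ * |J y| - (8 * C)⁻¹ * A y) ^ 2 := by field_simp; ring
        rw [← sq_abs (J y)]
        linarith [mul_nonneg (by positivity : 0 ≤ τ * (4 * C))
          (sq_nonneg (c₀⁻¹ * |J y| - (8 * C)⁻¹ * A y))]
      have e4 : J y * (β y * w t₀ y) =
          (1 / 2) * (β y * w t₀ y ^ 2) - (1 / 2) * (β y * wm y ^ 2) + β y * J y ^ 2 / 2 := by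
        simp only [hJ]; ring
      have e5 : 0 ≤ β y * J y ^ 2 / 2 := by
        have := stripWeight_nonneg s (𝒯.x i) y
        positivity
      have e6 : J y * g t₀ y = J y * (β y * w t₀ y) - J y * θ t₀ y := by simp only [hgd]; ring
      rw [e6, e4]
      linarith
    refine (le_of_eq ?_).trans (integral_mono_ae (((j1.sub j2).sub j3).sub j4)
      (hJ2.integrable_mul (hg.piecewiseC1.memLp_slice hab ht₀m 2)) hpt2)
    rw [integral_sub' ((j1.sub j2).sub j3) j4, integral_sub' (j1.sub j2) j3, integral_sub' j1 j2]
    simp only [integral_const_mul]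
    rfl
  have hf2 : ∀ t, ∫ y in Ioo a b, f t y = (1 / 2) * ∫ y in Ioo a b, β y * w t y ^ 2 := fun t => by
    rw [← integral_const_mul]
    refine integral_congr_ae (ae_of_all _ fun y => ?_)
    simp only [hf]; ring
  rw [hf2, hf2, hAI, ← ht₀] at hI1
  have hρ0 : 0 ≤ ∫ z in 𝒯.slab m, ρ z ^ 2 := integral_nonneg fun _ => sq_nonneg _
  have hJ0 : 0 ≤ ∫ y in Ioo a b, J y ^ 2 := integral_nonneg fun _ => sq_nonneg _
  -- This bound is spent twice, in the slab and at its initial time. Together with the 1/8 from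
  -- Young's inequality it uses up 1/4 of the good term 1/2 and leaves 1/4.
  have hAs : (16 * C)⁻¹ * (τ * ∫ y in Ioo a b, A y ^ 2) ≤ (1 / 16) * ∫ z in 𝒯.slab m, σw z := by
    calc _ ≤ (16 * C)⁻¹ * (C * ∫ z in 𝒯.slab m, σw z) := by gcongr
      _ = _ := by field_simp
  have hc1 : 0 ≤ (2 + 4 * C) * K ^ 2 * (τ * ∫ y in Ioo a b, J y ^ 2) := by positivity
  have hc2 : 0 ≤ 4 * C / c₀ ^ 2 * (h ^ 2 * ∫ z in 𝒯.slab m, ρ z ^ 2) := by positivity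
  nlinarith [hI1, hI2, hAs, hc1, hc2]

end StripEstimate


/-! ### Summation over the slabs, Green's formula and the residual functional. -/

section Duality

variable {T a b : ℝ}

lemma sum_telescope_le {M : ℕ} {u : Fin (M + 1) → ℝ} {v r : Fin M → ℝ}
    (h : ∀ m : Fin M, u m.succ + v m ≤ u m.castSucc + r m) :
    u (Fin.last M) + ∑ m, v m ≤ u 0 + ∑ m, r m := by
  have h1 := Finset.sum_le_sum fun m (_ : m ∈ Finset.univ) => h m
  rw [Finset.sum_add_distrib, Finset.sum_add_distrib] at h1
  have h2 : u 0 + ∑ m : Fin M, u m.succ = (∑ m : Fin M, u m.castSucc) + u (Fin.last M) := by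
    rw [← Fin.sum_univ_succ, Fin.sum_univ_castSucc]
  linarith

/-- Traces from below at the time nodes of a scalar function given slab by slab. -/
noncomputable def Mesh.trace (𝒯 : Mesh T a b) (w0 : ℝ → ℝ) (w : Fin 𝒯.M → ℝ → ℝ → ℝ) :
    Fin (𝒯.M + 1) → ℝ → ℝ :=
  Fin.cases w0 fun m y => w m (𝒯.t m.succ) y

/-- The jump of a scalar function at the initial time of a slab. -/
noncomputable def Mesh.jump (𝒯 : Mesh T a b) (w0 : ℝ → ℝ) (w : Fin 𝒯.M → ℝ → ℝ → ℝ)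
    (m : Fin 𝒯.M) (y : ℝ) : ℝ :=
  w m (𝒯.t m.castSucc) y - 𝒯.trace w0 w m.castSucc y

/-- Sum of the weighted squared residuals. -/
noncomputable def Mesh.energy (𝒯 : Mesh T a b) (h : ℝ) (ρ : Fin 𝒯.M → ℝ × ℝ → ℝ) (w0 : ℝ → ℝ)
    (w : Fin 𝒯.M → ℝ → ℝ → ℝ) : ℝ :=
  ∑ m, (h ^ 2 * (∫ z in 𝒯.slab m, ρ m z ^ 2)
    + (𝒯.t m.succ - 𝒯.t m.castSucc) * ∫ y in Ioo a b, 𝒯.jump w0 w m y ^ 2)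

lemma Mesh.trace_succ (𝒯 : Mesh T a b) (w0 : ℝ → ℝ) (w : Fin 𝒯.M → ℝ → ℝ → ℝ) (m : Fin 𝒯.M)
    (y : ℝ) : 𝒯.trace w0 w m.succ y = w m (𝒯.t m.succ) y := rfl

lemma Mesh.energy_nonneg (𝒯 : Mesh T a b) (h : ℝ) (ρ : Fin 𝒯.M → ℝ × ℝ → ℝ) (w0 : ℝ → ℝ)
    (w : Fin 𝒯.M → ℝ → ℝ → ℝ) : 0 ≤ 𝒯.energy h ρ w0 w := by
  refine Finset.sum_nonneg fun m _ => ?_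
  have h1 : 0 ≤ ∫ z in 𝒯.slab m, ρ m z ^ 2 := integral_nonneg fun _ => sq_nonneg _
  have h2 : 0 ≤ ∫ y in Ioo a b, 𝒯.jump w0 w m y ^ 2 := integral_nonneg fun _ => sq_nonneg _
  have h3 := sub_nonneg.2 (𝒯.t_lt m).le
  positivity

/-- Energy estimate upstream of a node, up to the final time. -/
lemma Mesh.exists_strip_estimate (k : ℕ) (hk : 1 ≤ k) {δ₀ c₀ : ℝ} (hδ₀ : 0 < δ₀)
    (hc₀ : 0 < c₀) :
    ∃ C : ℝ, 0 < C ∧ ∀ {T a b : ℝ}, a < b → ∀ (𝒯 : Mesh T a b) (h : ℝ), 0 < h →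
    𝒯.IsQuasiUniform c₀ h → ∀ (w : Fin 𝒯.M → ℝ → ℝ → ℝ) (re rp rq ρ : Fin 𝒯.M → ℝ × ℝ → ℝ)
    (w0 : ℝ → ℝ), (∀ m, 𝒯.IsScalarSD m k (δ₀ * h) (w m) (re m) (rp m) (rq m) (ρ m)
      (𝒯.trace w0 w m.castSucc)) → ∀ s : ℝ, s = 1 ∨ s = -1 → ∀ i : Fin (𝒯.N + 1),
    (∀ m, ∀ᵐ z ∂(volume.restrict (𝒯.slab m)), z.2 ∈ strip s (𝒯.x i) →
      re m z = -(pdt (w m) z.1 z.2 + s * pdx (w m) z.1 z.2) ∧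
      pdt (w m) z.1 z.2 * rp m z + pdx (w m) z.1 z.2 * rq m z ≤ 0) →
    (∀ᵐ y ∂(volume.restrict (Ioo a b)), y ∈ strip s (𝒯.x i) → w0 y = 0) →
    (∫ y in Ioo a b, stripWeight s (𝒯.x i) y * 𝒯.trace w0 w (Fin.last 𝒯.M) y ^ 2) ≤
        C * 𝒯.energy h ρ w0 w ∧
    ∑ m, (∫ z in 𝒯.slab m, (univ ×ˢ strip s (𝒯.x i)).indicator (fun z => w m z.1 z.2 ^ 2) z) ≤
        C * 𝒯.energy h ρ w0 w := by
  obtain ⟨C, hC, hslab⟩ := Mesh.exists_strip_estimate_slab k hk hδ₀ hc₀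
  -- The telescoped inequality has the coefficients 1/2 and 1/4 on two non-negative terms; dropping
  -- either one costs at most the factor 4.
  refine ⟨4 * C, by positivity, ?_⟩
  intro T a b hab 𝒯 h hh hqu w re rp rq ρ w0 H s hs i hst hw0
  have key := sum_telescope_le
    (u := fun n => (1 / 2) * (∫ y in Ioo a b, stripWeight s (𝒯.x i) y * 𝒯.trace w0 w n y ^ 2))
    (v := fun m => (1 / 4) * (∫ z in 𝒯.slab m,
          (univ ×ˢ strip s (𝒯.x i)).indicator (fun z => w m z.1 z.2 ^ 2) z))
    (r := fun m => C * (h ^ 2 * (∫ z in 𝒯.slab m, ρ m z ^ 2)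
      + (𝒯.t m.succ - 𝒯.t m.castSucc) * ∫ y in Ioo a b, 𝒯.jump w0 w m y ^ 2))
    fun m => hslab hab 𝒯 h hh hqu m _ _ _ _ _ _ (H m) s hs i (hst m)
  have h0 : ∫ y in Ioo a b, stripWeight s (𝒯.x i) y * 𝒯.trace w0 w 0 y ^ 2 = 0 := by
    refine integral_eq_zero_of_ae ?_
    filter_upwards [hw0] with y hy
    by_cases hm : y ∈ strip s (𝒯.x i)
    · have : 𝒯.trace w0 w 0 y = 0 := hy hm
      simp [this]
    · simp [stripWeight_of_notMem hm]
  simp only [h0, ← Finset.mul_sum] at key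
  change _ ≤ (1 / 2) * 0 + C * 𝒯.energy h ρ w0 w at key
  have n1 : 0 ≤ ∫ y in Ioo a b, stripWeight s (𝒯.x i) y * 𝒯.trace w0 w (Fin.last 𝒯.M) y ^ 2 :=
    integral_nonneg fun y => mul_nonneg (stripWeight_nonneg _ _ _) (sq_nonneg _)
  have n2 : 0 ≤ ∑ m, (∫ z in 𝒯.slab m,
      (univ ×ˢ strip s (𝒯.x i)).indicator (fun z => w m z.1 z.2 ^ 2) z) :=
    Finset.sum_nonneg fun m _ => integral_nonneg fun z =>
      indicator_nonneg (fun _ _ => sq_nonneg _) _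
  have n3 := mul_nonneg hC.le (𝒯.energy_nonneg h ρ w0 w)
  constructor <;> linarith

variable {𝒯 : Mesh T a b} {m : Fin 𝒯.M}

lemma _root_.MeasureTheory.MemLp.integrable_mul_fun {α : Type*} [MeasurableSpace α] {μ : Measure α}
    {f g : α → ℝ} (hf : MemLp f 2 μ) (hg : MemLp g 2 μ) : Integrable (fun x => f x * g x) μ :=
  hf.integrable_mul hg

/-- Green's formula on a slab. -/
lemma Mesh.PiecewiseC1.integral_transport_mul {w ψ : ℝ → ℝ → ℝ} (hw : 𝒯.PiecewiseC1 m w)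
    (hψ : ContDiff ℝ 1 (Function.uncurry ψ)) (hab : a < b)
    (h0 : ∀ t ∈ Icc (𝒯.t m.castSucc) (𝒯.t m.succ), w t a = 0 ∧ w t b = 0) (s : ℝ) :
    ∫ z in 𝒯.slab m, (pdt w z.1 z.2 + s * pdx w z.1 z.2) * ψ z.1 z.2 =
      (∫ y in Ioo a b, w (𝒯.t m.succ) y * ψ (𝒯.t m.succ) y)
        - (∫ y in Ioo a b, w (𝒯.t m.castSucc) y * ψ (𝒯.t m.castSucc) y)
        - ∫ z in 𝒯.slab m, w z.1 z.2 * (pdt ψ z.1 z.2 + s * pdx ψ z.1 z.2) := by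
  have hψ1 : 𝒯.PiecewiseC1 m ψ := .of_contDiff hψ
  have hf := hw.mul hψ1
  have h1 := hf.integral_pdt hab
  have h2 := hf.integral_pdx hab fun t ht => by simp [(h0 t ht).1, (h0 t ht).2]
  have i1 := hf.piecewiseContinuous_pdt.integrable
  have i2 := hf.piecewiseContinuous_pdx.integrable
  have i3 : Integrable (fun z : ℝ × ℝ => w z.1 z.2 * (pdt ψ z.1 z.2 + s * pdx ψ z.1 z.2))
      (volume.restrict (𝒯.slab m)) :=
    (hw.piecewiseContinuous.memLp 2).integrable_mul ((hψ1.piecewiseContinuous_pdt.memLp 2).add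
      ((hψ1.piecewiseContinuous_pdx.memLp 2).const_mul s))
  have e : ∫ z in 𝒯.slab m, (pdt w z.1 z.2 + s * pdx w z.1 z.2) * ψ z.1 z.2 =
      ∫ z in 𝒯.slab m, (pdt (fun t y => w t y * ψ t y) z.1 z.2
        + s * pdx (fun t y => w t y * ψ t y) z.1 z.2
        - w z.1 z.2 * (pdt ψ z.1 z.2 + s * pdx ψ z.1 z.2)) := by
    refine integral_congr_ae ?_
    filter_upwards [𝒯.ae_exists_elem m] with z ⟨j, hj⟩
    have d1 : pdt (fun t y => w t y * ψ t y) z.1 z.2 = _ :=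
      ((hw.hasDerivAt_t hj).mul (hψ1.hasDerivAt_t hj)).deriv
    have d2 : pdx (fun t y => w t y * ψ t y) z.1 z.2 = _ :=
      ((hw.hasDerivAt_x hj).mul (hψ1.hasDerivAt_x hj)).deriv
    rw [d1, d2]; ring
  have i4 : Integrable (fun z : ℝ × ℝ => pdt (fun t y => w t y * ψ t y) z.1 z.2
      + s * pdx (fun t y => w t y * ψ t y) z.1 z.2) (volume.restrict (𝒯.slab m)) :=
    i1.add (i2.const_mul s)
  rw [e, integral_sub i4 i3, integral_add i1 (i2.const_mul s),
    integral_const_mul, h1, h2, mul_zero, add_zero]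

/-- The parameter stays free: bounds of this shape add up over the slabs and over the different
terms with one common κ, which is optimised once at the end in place of repeated discrete
Cauchy-Schwarz inequalities. -/
lemma integral_mul_le_of_pos {α : Type*} [MeasurableSpace α] {μ : Measure α} {f g : α → ℝ}
    (hf : MemLp f 2 μ) (hg : MemLp g 2 μ) {κ : ℝ} (hκ : 0 < κ) :
    |∫ x, f x * g x ∂μ| ≤ κ * (∫ x, f x ^ 2 ∂μ) + (4 * κ)⁻¹ * ∫ x, g x ^ 2 ∂μ := by
  rw [← integral_const_mul, ← integral_const_mul,
    ← integral_add (hf.integrable_sq.const_mul _) (hg.integrable_sq.const_mul _)]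
  refine abs_integral_le_integral_abs.trans (integral_mono (hf.integrable_mul hg).abs
    ((hf.integrable_sq.const_mul _).add (hg.integrable_sq.const_mul _)) fun x => ?_)
  have : κ * f x ^ 2 + (4 * κ)⁻¹ * g x ^ 2 - |f x| * |g x| =
      κ * (|f x| - (2 * κ)⁻¹ * |g x|) ^ 2 := by
    rw [← sq_abs (f x), ← sq_abs (g x)]; field_simp; ring
  simp only [abs_mul]
  linarith [mul_nonneg hκ.le (sq_nonneg (|f x| - (2 * κ)⁻¹ * |g x|))]

/-- The residual functional on one slab, estimated by Galerkin orthogonality. -/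
lemma Mesh.IsScalarSD.dual_bound {k : ℕ} {δ₀ h : ℝ} {w : ℝ → ℝ → ℝ} {re rp rq ρ : ℝ × ℝ → ℝ}
    {wm : ℝ → ℝ} (H : 𝒯.IsScalarSD m k (δ₀ * h) w re rp rq ρ wm) (hab : a < b) (hh : 0 < h)
    {ψ g : ℝ → ℝ → ℝ} (hψ : ContDiff ℝ 1 (Function.uncurry ψ)) (hg : 𝒯.IsScalarFE m k g)
    (hgt : ∀ t y, pdt g t y = 0) {κ : ℝ} (hκ : 0 < κ) :
    |(∫ z in 𝒯.slab m, re z * ψ z.1 z.2)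
      - ∫ y in Ioo a b, (w (𝒯.t m.castSucc) y - wm y) * ψ (𝒯.t m.castSucc) y| ≤
    2 * κ * (h ^ 2 * (∫ z in 𝒯.slab m, ρ z ^ 2)
        + (𝒯.t m.succ - 𝒯.t m.castSucc) * ∫ y in Ioo a b, (w (𝒯.t m.castSucc) y - wm y) ^ 2)
      + κ⁻¹ * ((h ^ 2)⁻¹ * (∫ z in 𝒯.slab m, (ψ z.1 z.2 - g z.1 z.2) ^ 2)
        + δ₀ ^ 2 * (∫ z in 𝒯.slab m, pdx g z.1 z.2 ^ 2)
        + (𝒯.t m.succ - 𝒯.t m.castSucc)⁻¹ *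
          ∫ y in Ioo a b, (ψ (𝒯.t m.castSucc) y - g (𝒯.t m.castSucc) y) ^ 2) := by
  have ht₀m : 𝒯.t m.castSucc ∈ Icc (𝒯.t m.castSucc) (𝒯.t m.succ) :=
    left_mem_Icc.2 (𝒯.t_lt m).le
  have hτ : 0 < 𝒯.t m.succ - 𝒯.t m.castSucc := sub_pos.2 (𝒯.t_lt m)
  set τ := 𝒯.t m.succ - 𝒯.t m.castSucc
  have hψ1 : 𝒯.PiecewiseC1 m ψ := .of_contDiff hψ
  have hd := hψ1.sub hg.piecewiseC1
  have lψ := hψ1.piecewiseContinuous.memLp 2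
  have lg := hg.piecewiseC1.piecewiseContinuous.memLp 2
  have lgx := hg.piecewiseC1.piecewiseContinuous_pdx.memLp 2
  have lJ : MemLp (fun y => w (𝒯.t m.castSucc) y - wm y) 2 (volume.restrict (Ioo a b)) :=
    (H.fe.piecewiseC1.memLp_slice hab ht₀m 2).sub H.memLp_wm
  have lψ0 := hψ1.memLp_slice hab ht₀m 2
  have lg0 := hg.piecewiseC1.memLp_slice hab ht₀m 2
  have o := H.orth g hg
  -- As `g` is constant in time, only its space derivative meets the streamline term.
  simp only [hgt, mul_zero, zero_add] at o
  rw [integral_add (H.memLp_re.integrable_mul_fun lg)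
      ((H.memLp_rq.integrable_mul_fun lgx).const_mul _),
    integral_const_mul] at o
  have e1 : ∫ z in 𝒯.slab m, re z * (ψ z.1 z.2 - g z.1 z.2) =
      (∫ z in 𝒯.slab m, re z * ψ z.1 z.2) - ∫ z in 𝒯.slab m, re z * g z.1 z.2 := by
    rw [← integral_sub (H.memLp_re.integrable_mul_fun lψ) (H.memLp_re.integrable_mul_fun lg)]
    simp only [mul_sub]
  have e2 : ∫ y in Ioo a b, (w (𝒯.t m.castSucc) y - wm y) *
        (ψ (𝒯.t m.castSucc) y - g (𝒯.t m.castSucc) y) =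
      (∫ y in Ioo a b, (w (𝒯.t m.castSucc) y - wm y) * ψ (𝒯.t m.castSucc) y)
        - ∫ y in Ioo a b, (w (𝒯.t m.castSucc) y - wm y) * g (𝒯.t m.castSucc) y := by
    rw [← integral_sub (lJ.integrable_mul_fun lψ0) (lJ.integrable_mul_fun lg0)]
    simp only [mul_sub]
  have hsq : ∀ {r : ℝ × ℝ → ℝ}, MemLp r 2 (volume.restrict (𝒯.slab m)) →
      (∀ z, |r z| ≤ 2 * ρ z) →
      ∫ z in 𝒯.slab m, r z ^ 2 ≤ 4 * ∫ z in 𝒯.slab m, ρ z ^ 2 := fun {r} hr hb => by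
    rw [← integral_const_mul]
    refine integral_mono hr.integrable_sq (H.memLp_ρ.integrable_sq.const_mul _) fun z => ?_
    have := pow_le_pow_left₀ (abs_nonneg _) (hb z) 2
    rw [sq_abs] at this
    exact this.trans_eq (by ring)
  -- The quarter compensates |re|, |rq| ≤ 2 ρ. The two residual components then contribute κ h² ∫ ρ²
  -- each, whence the factor 2 κ.
  have b1 := integral_mul_le_of_pos H.memLp_re (lψ.sub lg) (κ := κ * h ^ 2 / 4) (by positivity)
  have b2 := integral_mul_le_of_pos H.memLp_rq (lgx.const_mul (δ₀ * h)) (κ := κ * h ^ 2 / 4)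
    (by positivity)
  have b3 := integral_mul_le_of_pos lJ (lψ0.sub lg0) (κ := κ * τ) (by positivity)
  have c1 := mul_le_mul_of_nonneg_left (hsq H.memLp_re H.re_le) (by positivity : 0 ≤ κ * h ^ 2 / 4)
  have c2 := mul_le_mul_of_nonneg_left (hsq H.memLp_rq H.rq_le) (by positivity : 0 ≤ κ * h ^ 2 / 4)
  simp only [Pi.sub_apply, mul_pow, integral_const_mul] at b1 b2 b3
  have e3 : ∫ z in 𝒯.slab m, rq z * (δ₀ * h * pdx g z.1 z.2) =
      δ₀ * h * ∫ z in 𝒯.slab m, rq z * pdx g z.1 z.2 := by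
    rw [← integral_const_mul]; exact integral_congr_ae (ae_of_all _ fun z => by ring)
  rw [e1] at b1
  rw [e2] at b3
  rw [e3] at b2
  have n3 : 0 ≤ ∫ y in Ioo a b, (ψ (𝒯.t m.castSucc) y - g (𝒯.t m.castSucc) y) ^ 2 :=
    integral_nonneg fun _ => sq_nonneg _
  have nJ : 0 ≤ ∫ y in Ioo a b, (w (𝒯.t m.castSucc) y - wm y) ^ 2 :=
    integral_nonneg fun _ => sq_nonneg _
  have f1 : (4 * (κ * h ^ 2 / 4))⁻¹ * (∫ z in 𝒯.slab m, (ψ z.1 z.2 - g z.1 z.2) ^ 2) =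
      κ⁻¹ * ((h ^ 2)⁻¹ * ∫ z in 𝒯.slab m, (ψ z.1 z.2 - g z.1 z.2) ^ 2) := by
    field_simp
  have f2 : (4 * (κ * h ^ 2 / 4))⁻¹ * (δ₀ ^ 2 * h ^ 2 * ∫ z in 𝒯.slab m, pdx g z.1 z.2 ^ 2) =
      κ⁻¹ * (δ₀ ^ 2 * ∫ z in 𝒯.slab m, pdx g z.1 z.2 ^ 2) := by
    field_simp
  have f3 : (4 * (κ * τ))⁻¹ *
      (∫ y in Ioo a b, (ψ (𝒯.t m.castSucc) y - g (𝒯.t m.castSucc) y) ^ 2) ≤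
      κ⁻¹ * (τ⁻¹ * ∫ y in Ioo a b, (ψ (𝒯.t m.castSucc) y - g (𝒯.t m.castSucc) y) ^ 2) := by
    rw [← mul_assoc κ⁻¹, ← mul_inv κ]
    refine mul_le_mul_of_nonneg_right (inv_anti₀ (by positivity) ?_) n3
    linarith [mul_pos hκ hτ]
  have g3 : 0 ≤ κ * (τ * ∫ y in Ioo a b, (w (𝒯.t m.castSucc) y - wm y) ^ 2) := by positivity
  rw [f1] at b1
  rw [f2] at b2
  rw [abs_le] at b1 b2 b3 ⊢
  constructor
  · linarith [b1.1, b2.2, b3.2]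
  · linarith [b1.2, b2.1, b3.1]

lemma le_two_mul_sqrt_mul_sqrt {X P Q : ℝ} (hP : 0 ≤ P) (hQ : 0 ≤ Q)
    (h : ∀ κ : ℝ, 0 < κ → X ≤ κ * P + κ⁻¹ * Q) : X ≤ 2 * (Real.sqrt P * Real.sqrt Q) := by
  refine le_of_forall_pos_le_add fun ε hε => ?_
  set p := Real.sqrt P with hp
  set q := Real.sqrt Q with hq
  have hp0 : 0 ≤ p := Real.sqrt_nonneg _
  have hq0 : 0 ≤ q := Real.sqrt_nonneg _
  have hpP : P = p ^ 2 := (Real.sq_sqrt hP).symm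
  have hqQ : Q = q ^ 2 := (Real.sq_sqrt hQ).symm
  -- The optimal κ is q / p. Shifting both by η admits p = 0 or q = 0 and changes the bound by at
  -- most η (p + q) < ε.
  set η := ε / (2 * (p + q + 1)) with hη
  have hη0 : 0 < η := by positivity
  have hηe : η * (2 * (p + q + 1)) = ε := by rw [hη]; field_simp
  have h1 := h ((q + η) / (p + η)) (by positivity)
  have h2 : (q + η) / (p + η) * P ≤ (q + η) * p := by
    rw [hpP, div_mul_eq_mul_div, div_le_iff₀ (by positivity)]
    nlinarith [mul_nonneg (mul_nonneg (by positivity : 0 ≤ q + η) hp0) hη0.le]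
  have h3 : ((q + η) / (p + η))⁻¹ * Q ≤ (p + η) * q := by
    rw [hqQ, inv_div, div_mul_eq_mul_div, div_le_iff₀ (by positivity)]
    nlinarith [mul_nonneg (mul_nonneg (by positivity : 0 ≤ p + η) hq0) hη0.le]
  nlinarith

end Duality


/-! ### Approximation of the dual function by functions that are constant in time on each slab. -/

section Interpolation

variable {T a b : ℝ}

/-- Cauchy-Schwarz, obtained from the non-negativity of the variance of f about its mean. -/
lemma sq_intervalIntegral_le {f : ℝ → ℝ} (hf : Continuous f) {x y : ℝ} (hxy : x ≤ y) :
    (∫ r in x..y, f r) ^ 2 ≤ (y - x) * ∫ r in x..y, f r ^ 2 := by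
  rcases hxy.eq_or_lt with rfl | h
  · simp
  have hpos := sub_pos.2 h
  set c := (∫ r in x..y, f r) / (y - x) with hc
  have h1 : 0 ≤ ∫ r in x..y, (f r - c) ^ 2 :=
    intervalIntegral.integral_nonneg hxy fun _ _ => sq_nonneg _
  have h2 : ∫ r in x..y, (f r - c) ^ 2 =
      (∫ r in x..y, f r ^ 2) - 2 * c * (∫ r in x..y, f r) + (y - x) * c ^ 2 := by
    have e : ∀ r, (f r - c) ^ 2 = f r ^ 2 - 2 * c * f r + c ^ 2 := fun r => by ring
    simp_rw [e]
    rw [intervalIntegral.integral_add, intervalIntegral.integral_sub,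
      intervalIntegral.integral_const_mul, intervalIntegral.integral_const, smul_eq_mul]
    all_goals exact Continuous.intervalIntegrable (by fun_prop) _ _
  have h3 : ∫ r in x..y, f r = c * (y - x) := by rw [hc]; field_simp
  rw [h2, h3] at h1
  rw [h3]
  nlinarith

lemma intervalIntegral_mono_interval {f : ℝ → ℝ} (hf : Continuous f) (h0 : ∀ r, 0 ≤ f r)
    {x y z : ℝ} (hxy : x ≤ y) (hyz : y ≤ z) : ∫ r in x..y, f r ≤ ∫ r in x..z, f r :=
  intervalIntegral.integral_mono_interval le_rfl hxy hyz (ae_of_all _ h0)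
    (hf.intervalIntegrable _ _)

lemma Mesh.integrableOn_Ioo_of_elem (𝒯 : Mesh T a b) {f : ℝ → ℝ}
    (hf : ∀ j : Fin 𝒯.N, ∃ F : ℝ → ℝ, Continuous F ∧
      ∀ y ∈ Ioo (𝒯.x j.castSucc) (𝒯.x j.succ), f y = F y) : IntegrableOn f (Ioo a b) := by
  rw [integrableOn_congr_set_ae 𝒯.Ioo_ae_eq, integrableOn_finite_iUnion]
  intro j
  obtain ⟨F, hF, hfF⟩ := hf j
  exact ((hF.integrableOn_Icc).mono_set Ioo_subset_Icc_self).congr_fun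
    (fun y hy => (hfF y hy).symm) measurableSet_Ioo

/-- Piecewise linear interpolation in space. -/
lemma Mesh.exists_interpolant {k : ℕ} (hk : 1 ≤ k) (𝒯 : Mesh T a b) {h : ℝ}
    (hℓ : ∀ j : Fin 𝒯.N, 𝒯.x j.succ - 𝒯.x j.castSucc ≤ h) {u u' : ℝ → ℝ}
    (hu : ∀ y, HasDerivAt u (u' y) y) (hu' : Continuous u') (ha : u a = 0) (hb : u b = 0) :
    ∃ g : ℝ → ℝ, (∀ m, 𝒯.IsScalarFE m k fun _ y => g y) ∧
      (∫ y in Ioo a b, (u y - g y) ^ 2) ≤ 4 * h ^ 2 * (∫ y in Ioo a b, u' y ^ 2) ∧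
      (∫ y in Ioo a b, deriv g y ^ 2) ≤ ∫ y in Ioo a b, u' y ^ 2 := by
  have huc : Continuous u := continuous_iff_continuousAt.2 fun y => (hu y).continuousAt
  have hx := 𝒯.x_strictMono
  set D : Fin 𝒯.N → ℝ := fun j =>
    (u (𝒯.x j.succ) - u (𝒯.x j.castSucc)) / (𝒯.x j.succ - 𝒯.x j.castSucc) with hD
  set G : Fin 𝒯.N → ℝ → ℝ := fun j y => u (𝒯.x j.castSucc) + D j * (y - 𝒯.x j.castSucc) with hG
  have hval : ∀ (j : Fin 𝒯.N), ∀ y ∈ Icc (𝒯.x j.castSucc) (𝒯.x j.succ), glue 𝒯.x G y = G j y := by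
    intro j y hy
    refine glue_of_mem_Icc hx (v := fun i => u (𝒯.x i)) (fun j => ⟨by simp [hG], ?_⟩)
      (by simp only [𝒯.x_zero, ha]) hy
    have := sub_pos.2 (𝒯.x_lt j)
    simp only [hG, hD, div_mul_cancel₀ _ this.ne']
    ring
  have hder : ∀ (j : Fin 𝒯.N), ∀ y ∈ Ioo (𝒯.x j.castSucc) (𝒯.x j.succ),
      deriv (glue 𝒯.x G) y = D j := by
    intro j y hy
    have h1 : glue 𝒯.x G =ᶠ[𝓝 y] G j := by
      filter_upwards [isOpen_Ioo.mem_nhds hy] with z hz using hval j z (Ioo_subset_Icc_self hz)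
    rw [h1.deriv_eq]
    have := (((hasDerivAt_id y).sub_const (𝒯.x j.castSucc)).const_mul (D j)).const_add
      (u (𝒯.x j.castSucc))
    exact this.deriv.trans (mul_one _)
  have hftc : ∀ x y : ℝ, ∫ r in x..y, u' r = u y - u x := fun x y =>
    intervalIntegral.integral_eq_sub_of_hasDerivAt (fun r _ => hu r) (hu'.intervalIntegrable _ _)
  have hIoo : ∀ j : Fin 𝒯.N, ∀ f : ℝ → ℝ, ∫ y in Ioo (𝒯.x j.castSucc) (𝒯.x j.succ), f y =
      ∫ y in (𝒯.x j.castSucc)..(𝒯.x j.succ), f y := fun j f => by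
    rw [← integral_Ioc_eq_integral_Ioo, intervalIntegral.integral_of_le (𝒯.x_lt j).le]
  have hu2 : Continuous fun y => u' y ^ 2 := hu'.pow 2
  have hu2i : IntegrableOn (fun y => u' y ^ 2) (Ioo a b) :=
    (hu2.integrableOn_Icc).mono_set Ioo_subset_Icc_self
  have hGc : ∀ j, Continuous (G j) := fun j => by simp only [hG]; fun_prop
  -- The slope `D j` is the mean of u' over the element, so by Cauchy-Schwarz interpolation does not
  -- increase the L₂ norm of the derivative.
  have hslope : ∀ j : Fin 𝒯.N, (u (𝒯.x j.succ) - u (𝒯.x j.castSucc)) ^ 2 ≤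
      (𝒯.x j.succ - 𝒯.x j.castSucc) * ∫ r in (𝒯.x j.castSucc)..(𝒯.x j.succ), u' r ^ 2 := fun j => by
    rw [← hftc]; exact sq_intervalIntegral_le hu' (𝒯.x_lt j).le
  refine ⟨glue 𝒯.x G, fun m => ⟨fun j => ⟨fun _ y => G j y, ?_, fun t _ y hy => hval j y hy⟩,
    fun t _ => ⟨?_, ?_⟩⟩, ?_, ?_⟩
  · have h0 := (isBiPoly_affine (k := k) 0 1 0 1 (i := 0) (l := 0) (by omega) (by omega)).const_mul
      (u (𝒯.x j.castSucc))
    have h1 := (isBiPoly_affine (k := k) 0 1 (𝒯.x j.castSucc) 1 (i := 0) (l := 1)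
      (by omega) (by omega)).const_mul (D j)
    convert h0.add h1 using 3
    simp [hG]
  · exact Finset.sum_eq_zero fun j _ => indicator_of_notMem
      (fun hm => absurd hm.1 (not_lt.2 (𝒯.a_le_x _))) _
  · refine Finset.sum_eq_zero fun j _ => ?_
    by_cases hm : b ∈ Ioc (𝒯.x j.castSucc) (𝒯.x j.succ)
    · have : b = 𝒯.x j.succ := le_antisymm hm.2 (𝒯.x_le_b _)
      have hGb : G j (𝒯.x j.succ) = u (𝒯.x j.succ) := by
        have := sub_pos.2 (𝒯.x_lt j)
        simp only [hG, hD, div_mul_cancel₀ _ this.ne']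
        ring
      rw [indicator_of_mem hm]
      exact (congrArg (G j) this).trans (hGb.trans ((congrArg u this).symm.trans hb))
    · exact indicator_of_notMem hm _
  · have hi : IntegrableOn (fun y => (u y - glue 𝒯.x G y) ^ 2) (Ioo a b) :=
      𝒯.integrableOn_Ioo_of_elem fun j => ⟨fun y => (u y - G j y) ^ 2,
        (huc.sub (hGc j)).pow 2, fun y hy => by rw [hval j y (Ioo_subset_Icc_self hy)]⟩
    rw [𝒯.integral_Ioo_eq_sum hi, 𝒯.integral_Ioo_eq_sum hu2i, Finset.mul_sum]
    refine Finset.sum_le_sum fun j _ => ?_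
    have hl := sub_pos.2 (𝒯.x_lt j)
    rw [hIoo, hIoo]
    set I := ∫ r in (𝒯.x j.castSucc)..(𝒯.x j.succ), u' r ^ 2 with hI
    have hI0 : 0 ≤ I := intervalIntegral.integral_nonneg (𝒯.x_lt j).le fun _ _ => sq_nonneg _
    -- The increments of u and of its interpolant from the left node have squares at most ℓ I each;
    -- the square of their difference is at most 4 ℓ I.
    have hpt : ∀ y ∈ Icc (𝒯.x j.castSucc) (𝒯.x j.succ),
        (u y - glue 𝒯.x G y) ^ 2 ≤ 4 * (𝒯.x j.succ - 𝒯.x j.castSucc) * I := by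
      intro y hy
      rw [hval j y hy]
      have e1 : (u y - u (𝒯.x j.castSucc)) ^ 2 ≤ (𝒯.x j.succ - 𝒯.x j.castSucc) * I := by
        rw [← hftc]
        refine (sq_intervalIntegral_le hu' hy.1).trans ?_
        have := intervalIntegral_mono_interval hu2 (fun r => sq_nonneg _) hy.1 hy.2
        have h0 : 0 ≤ ∫ r in (𝒯.x j.castSucc)..y, u' r ^ 2 :=
          intervalIntegral.integral_nonneg hy.1 fun _ _ => sq_nonneg _
        exact mul_le_mul (by linarith [hy.2]) this h0 hl.le
      have e2 : (D j * (y - 𝒯.x j.castSucc)) ^ 2 ≤ (𝒯.x j.succ - 𝒯.x j.castSucc) * I := by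
        refine le_trans ?_ (hslope j)
        have h1 : D j * (y - 𝒯.x j.castSucc) = (u (𝒯.x j.succ) - u (𝒯.x j.castSucc)) *
            ((y - 𝒯.x j.castSucc) / (𝒯.x j.succ - 𝒯.x j.castSucc)) := by
          simp only [hD]; ring
        have h2 := sub_div_sub_mem_Icc hy
        rw [h1, mul_pow]
        exact mul_le_of_le_one_right (sq_nonneg _) (pow_le_one₀ h2.1 h2.2)
      have e3 : u y - G j y = (u y - u (𝒯.x j.castSucc)) - D j * (y - 𝒯.x j.castSucc) := by
        simp only [hG]; ring
      rw [e3]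
      nlinarith [sq_nonneg ((u y - u (𝒯.x j.castSucc)) + D j * (y - 𝒯.x j.castSucc))]
    have := intervalIntegral.integral_mono_on (μ := volume) (𝒯.x_lt j).le (f := fun y =>
      (u y - glue 𝒯.x G y) ^ 2) (g := fun _ => 4 * (𝒯.x j.succ - 𝒯.x j.castSucc) * I) ?_ ?_ hpt
    · refine this.trans ?_
      rw [intervalIntegral.integral_const, smul_eq_mul]
      have : (𝒯.x j.succ - 𝒯.x j.castSucc) ^ 2 ≤ h ^ 2 := pow_le_pow_left₀ hl.le (hℓ j) 2
      nlinarith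
    · rw [intervalIntegrable_iff_integrableOn_Ioo_of_le (𝒯.x_lt j).le]
      exact hi.mono_set fun y hy =>
        ⟨(𝒯.a_le_x _).trans_lt hy.1, hy.2.trans_le (𝒯.x_le_b _)⟩
    · exact intervalIntegrable_const
  · have hi : IntegrableOn (fun y => deriv (glue 𝒯.x G) y ^ 2) (Ioo a b) :=
      𝒯.integrableOn_Ioo_of_elem fun j => ⟨fun _ => D j ^ 2, continuous_const,
        fun y hy => by rw [hder j y hy]⟩
    rw [𝒯.integral_Ioo_eq_sum hi, 𝒯.integral_Ioo_eq_sum hu2i]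
    refine Finset.sum_le_sum fun j _ => ?_
    have hl := sub_pos.2 (𝒯.x_lt j)
    have e : ∫ y in Ioo (𝒯.x j.castSucc) (𝒯.x j.succ), deriv (glue 𝒯.x G) y ^ 2 =
        ∫ y in Ioo (𝒯.x j.castSucc) (𝒯.x j.succ), D j ^ 2 :=
      setIntegral_congr_fun measurableSet_Ioo fun y hy => by simp only [hder j y hy]
    rw [e, setIntegral_const, Real.volume_real_Ioo_of_le (𝒯.x_lt j).le, smul_eq_mul, hIoo]
    have h2 : (𝒯.x j.succ - 𝒯.x j.castSucc) * D j ^ 2 * (𝒯.x j.succ - 𝒯.x j.castSucc) =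
        (u (𝒯.x j.succ) - u (𝒯.x j.castSucc)) ^ 2 := by
      simp only [hD]; field_simp
    have h3 := hslope j
    rw [← h2] at h3
    nlinarith

lemma Mesh.integral_slab_le (𝒯 : Mesh T a b) (m : Fin 𝒯.M) {f : ℝ × ℝ → ℝ}
    (hf : Integrable f (volume.restrict (𝒯.slab m))) {Λ : ℝ}
    (h : ∀ t ∈ Icc (𝒯.t m.castSucc) (𝒯.t m.succ), ∫ y in Ioo a b, f (t, y) ≤ Λ) :
    ∫ z in 𝒯.slab m, f z ≤ (𝒯.t m.succ - 𝒯.t m.castSucc) * Λ := by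
  rw [𝒯.restrict_slab] at hf ⊢
  rw [integral_prod _ hf]
  calc _ ≤ ∫ _ in Ioc (𝒯.t m.castSucc) (𝒯.t m.succ), Λ :=
        setIntegral_mono_on hf.integral_prod_left (integrable_const _) measurableSet_Ioc
          fun t ht => h t (Ioc_subset_Icc_self ht)
    _ = _ := by
        rw [setIntegral_const, Real.volume_real_Ioc_of_le (𝒯.t_lt m).le, smul_eq_mul]

lemma Mesh.integrable_slab_of_continuous (𝒯 : Mesh T a b) (m : Fin 𝒯.M) {f : ℝ × ℝ → ℝ}
    (hf : Continuous f) : Integrable f (volume.restrict (𝒯.slab m)) :=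
  Mesh.PiecewiseContinuous.integrable fun _ => ⟨f, hf, fun _ _ => rfl⟩

lemma Mesh.sum_steps (𝒯 : Mesh T a b) : ∑ m : Fin 𝒯.M, (𝒯.t m.succ - 𝒯.t m.castSucc) = T := by
  have h : 𝒯.t 0 + ∑ m : Fin 𝒯.M, 𝒯.t m.succ =
      (∑ m : Fin 𝒯.M, 𝒯.t m.castSucc) + 𝒯.t (Fin.last 𝒯.M) := by
    rw [← Fin.sum_univ_succ, Fin.sum_univ_castSucc]
  rw [Finset.sum_sub_distrib]
  rw [𝒯.t_zero, 𝒯.t_last] at h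
  linarith

/-- The difference between a smooth function and its value at the initial time of a slab. -/
lemma Mesh.integral_sub_initial_sq_le (𝒯 : Mesh T a b) (m : Fin 𝒯.M) {ψ : ℝ → ℝ → ℝ}
    (hψ : ContDiff ℝ 1 (Function.uncurry ψ)) {Λ : ℝ}
    (h : ∀ t ∈ Icc (𝒯.t m.castSucc) (𝒯.t m.succ), ∫ y in Ioo a b, pdt ψ t y ^ 2 ≤ Λ) :
    ∫ z in 𝒯.slab m, (ψ z.1 z.2 - ψ (𝒯.t m.castSucc) z.2) ^ 2 ≤
      (𝒯.t m.succ - 𝒯.t m.castSucc) ^ 3 * Λ := by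
  set t₀ := 𝒯.t m.castSucc with ht₀
  set t₁ := 𝒯.t m.succ with ht₁
  have hlt : t₀ < t₁ := 𝒯.t_lt m
  have hτ := sub_pos.2 hlt
  have hc : Continuous fun z : ℝ × ℝ => pdt ψ z.1 z.2 := continuous_pdt hψ
  have hψc : Continuous (Function.uncurry ψ) := hψ.continuous
  have hi : Integrable (fun z : ℝ × ℝ => pdt ψ z.1 z.2 ^ 2) (volume.restrict (𝒯.slab m)) :=
    𝒯.integrable_slab_of_continuous m (hc.pow 2)
  have hsl := 𝒯.integral_slab_le m hi h
  have hpt : ∀ t ∈ Icc t₀ t₁, ∀ y, (ψ t y - ψ t₀ y) ^ 2 ≤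
      (t₁ - t₀) * ∫ r in t₀..t₁, pdt ψ r y ^ 2 := by
    intro t ht y
    have hcy : Continuous fun r => pdt ψ r y := hc.comp (by fun_prop : Continuous fun r => (r, y))
    have e : ∫ r in t₀..t, pdt ψ r y = ψ t y - ψ t₀ y :=
      intervalIntegral.integral_eq_sub_of_hasDerivAt (f := fun r => ψ r y)
        (fun r _ => hasDerivAt_pdt hψ r y) (hcy.intervalIntegrable _ _)
    rw [← e]
    refine (sq_intervalIntegral_le hcy ht.1).trans ?_
    exact mul_le_mul (by linarith [ht.2])
      (intervalIntegral_mono_interval (hcy.pow 2) (fun r => sq_nonneg _) ht.1 ht.2)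
      (intervalIntegral.integral_nonneg ht.1 fun _ _ => sq_nonneg _) hτ.le
  have hE : ∫ y in Ioo a b, ∫ r in t₀..t₁, pdt ψ r y ^ 2 = ∫ z in 𝒯.slab m, pdt ψ z.1 z.2 ^ 2 := by
    rw [𝒯.restrict_slab] at hi ⊢
    rw [integral_prod_symm _ hi]
    simp only [intervalIntegral.integral_of_le hlt.le]
    rfl
  have hcont : Continuous fun z : ℝ × ℝ => (ψ z.1 z.2 - ψ t₀ z.2) ^ 2 := by
    have h1 : Continuous fun z : ℝ × ℝ => ψ z.1 z.2 := hψc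
    have h2 : Continuous fun z : ℝ × ℝ => ψ t₀ z.2 :=
      hψc.comp (by fun_prop : Continuous fun z : ℝ × ℝ => (t₀, z.2))
    exact (h1.sub h2).pow 2
  refine (𝒯.integral_slab_le m (𝒯.integrable_slab_of_continuous m hcont)
    (Λ := (t₁ - t₀) * ((t₁ - t₀) * Λ)) fun t ht => ?_).trans_eq (by ring)
  have hcE : Continuous fun y => ∫ r in t₀..t₁, pdt ψ r y ^ 2 :=
    intervalIntegral.continuous_parametric_intervalIntegral_of_continuous'
      ((hc.comp continuous_swap).pow 2) _ _
  calc ∫ y in Ioo a b, (ψ t y - ψ t₀ y) ^ 2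
      ≤ ∫ y in Ioo a b, (t₁ - t₀) * ∫ r in t₀..t₁, pdt ψ r y ^ 2 := by
        refine integral_mono ?_ ?_ fun y => hpt t ht y
        · exact ((hcont.comp (by fun_prop : Continuous fun y => (t, y))).integrableOn_Icc).mono_set
            Ioo_subset_Icc_self
        · exact ((continuous_const.mul hcE).integrableOn_Icc).mono_set Ioo_subset_Icc_self
    _ = (t₁ - t₀) * ∫ z in 𝒯.slab m, pdt ψ z.1 z.2 ^ 2 := by rw [integral_const_mul, hE]
    _ ≤ _ := mul_le_mul_of_nonneg_left hsl hτ.le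

/-- Approximation of a smooth function by finite element functions that are constant in time on
each slab. -/
lemma Mesh.exists_dual_approximation {k : ℕ} (hk : 1 ≤ k) (𝒯 : Mesh T a b) {c₀ h : ℝ} (hc₀ : 0 < c₀)
    (hh : 0 < h) (hqu : 𝒯.IsQuasiUniform c₀ h) {ψ : ℝ → ℝ → ℝ}
    (hψ : ContDiff ℝ 1 (Function.uncurry ψ)) {Λ : ℝ} (hΛ : 0 ≤ Λ)
    (h0 : ∀ t ∈ Icc 0 T, ψ t a = 0 ∧ ψ t b = 0)
    (ht : ∀ t ∈ Icc 0 T, ∫ y in Ioo a b, pdt ψ t y ^ 2 ≤ Λ)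
    (hx : ∀ t ∈ Icc 0 T, ∫ y in Ioo a b, pdx ψ t y ^ 2 ≤ Λ) (δ₀ : ℝ) :
    ∃ g : Fin 𝒯.M → ℝ → ℝ → ℝ, (∀ m, 𝒯.IsScalarFE m k (g m)) ∧ (∀ m t y, pdt (g m) t y = 0) ∧
      ∑ m, ((h ^ 2)⁻¹ * (∫ z in 𝒯.slab m, (ψ z.1 z.2 - g m z.1 z.2) ^ 2)
        + δ₀ ^ 2 * (∫ z in 𝒯.slab m, pdx (g m) z.1 z.2 ^ 2)
        + (𝒯.t m.succ - 𝒯.t m.castSucc)⁻¹ *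
          ∫ y in Ioo a b, (ψ (𝒯.t m.castSucc) y - g m (𝒯.t m.castSucc) y) ^ 2) ≤
        T * ((10 + δ₀ ^ 2 + 4 / c₀ ^ 2) * Λ) := by
  have hmem : ∀ i, 𝒯.t i ∈ Icc 0 T := fun i => ⟨𝒯.t_nonneg i, 𝒯.t_le i⟩
  have hcx : Continuous fun z : ℝ × ℝ => pdx ψ z.1 z.2 := continuous_pdx hψ
  have hint := fun m : Fin 𝒯.M => 𝒯.exists_interpolant hk (fun j => (hqu.2 j).2)
    (fun y => hasDerivAt_pdx hψ (𝒯.t m.castSucc) y)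
    (hcx.comp (by fun_prop : Continuous fun y => (𝒯.t m.castSucc, y)))
    (h0 _ (hmem _)).1 (h0 _ (hmem _)).2
  choose g hg hg1 hg2 using hint
  refine ⟨fun m _ y => g m y, fun m => hg m m, fun m t y => deriv_const _ _, ?_⟩
  -- Each slab contributes at most its length times a constant, and the lengths add up to `T`.
  refine le_trans (Finset.sum_le_sum fun m _ => ?_)
    (le_of_eq ((Finset.sum_mul _ _ _).symm.trans (congrArg (· * _) 𝒯.sum_steps)))
  have hτ := sub_pos.2 (𝒯.t_lt m)
  have hτh := (hqu.1 m).2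
  have hτc := (hqu.1 m).1
  set τ := 𝒯.t m.succ - 𝒯.t m.castSucc
  have hsub : ∀ t ∈ Icc (𝒯.t m.castSucc) (𝒯.t m.succ), t ∈ Icc 0 T := fun t ht =>
    ⟨(𝒯.t_nonneg _).trans ht.1, ht.2.trans (𝒯.t_le _)⟩
  have hX := hx _ (hmem m.castSucc)
  have b1 : ∫ y in Ioo a b, (ψ (𝒯.t m.castSucc) y - g m y) ^ 2 ≤ 4 * h ^ 2 * Λ :=
    (hg1 m).trans (by gcongr)
  have b2 : ∫ y in Ioo a b, deriv (g m) y ^ 2 ≤ Λ := (hg2 m).trans hX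
  have b3 := 𝒯.integral_sub_initial_sq_le m hψ fun t htm => ht t (hsub t htm)
  have hψ1 : 𝒯.PiecewiseC1 m ψ := .of_contDiff hψ
  have hψ0 : 𝒯.PiecewiseC1 m fun _ y => ψ (𝒯.t m.castSucc) y :=
    .of_contDiff (hψ.comp (by fun_prop :
      ContDiff ℝ 1 fun z : ℝ × ℝ => (𝒯.t m.castSucc, z.2)))
  have hgm := (hg m m).piecewiseC1
  have i1 := ((hψ1.sub hψ0).piecewiseContinuous.memLp 2).integrable_sq
  have i2 := ((hψ0.sub hgm).piecewiseContinuous.memLp 2).integrable_sq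
  have i3 := ((hψ1.sub hgm).piecewiseContinuous.memLp 2).integrable_sq
  have i4 := (hgm.piecewiseContinuous_pdx.memLp 2).integrable_sq
  have b4 : ∫ z in 𝒯.slab m, (ψ (𝒯.t m.castSucc) z.2 - g m z.2) ^ 2 ≤ τ * (4 * h ^ 2 * Λ) :=
    𝒯.integral_slab_le m i2 fun t _ => b1
  have b5 : ∫ z in 𝒯.slab m, pdx (fun _ y => g m y) z.1 z.2 ^ 2 ≤ τ * Λ :=
    𝒯.integral_slab_le m i4 fun t _ => b2
  -- The error is split at the value of ψ at the initial time of the slab: the constant is 2 · 1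
  -- from freezing time plus 2 · 4 from interpolation.
  have b6 : ∫ z in 𝒯.slab m, (ψ z.1 z.2 - g m z.2) ^ 2 ≤ h ^ 2 * (10 * τ * Λ) := by
    have : ∫ z in 𝒯.slab m, (ψ z.1 z.2 - g m z.2) ^ 2 ≤
        2 * (∫ z in 𝒯.slab m, (ψ z.1 z.2 - ψ (𝒯.t m.castSucc) z.2) ^ 2)
        + 2 * ∫ z in 𝒯.slab m, (ψ (𝒯.t m.castSucc) z.2 - g m z.2) ^ 2 := by
      rw [← integral_const_mul, ← integral_const_mul,
        ← integral_add (i1.const_mul 2) (i2.const_mul 2)]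
      refine integral_mono i3 ((i1.const_mul 2).add (i2.const_mul 2)) fun z => ?_
      beta_reduce
      nlinarith [sq_nonneg ((ψ z.1 z.2 - ψ (𝒯.t m.castSucc) z.2)
        - (ψ (𝒯.t m.castSucc) z.2 - g m z.2))]
    have h3 : τ ^ 3 * Λ ≤ h ^ 2 * (τ * Λ) := by
      have : τ ^ 2 ≤ h ^ 2 := pow_le_pow_left₀ hτ.le hτh 2
      calc τ ^ 3 * Λ = τ ^ 2 * (τ * Λ) := by ring
        _ ≤ _ := by gcongr
    linarith
  have c1 : (h ^ 2)⁻¹ * (∫ z in 𝒯.slab m, (ψ z.1 z.2 - g m z.2) ^ 2) ≤ 10 * τ * Λ := by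
    rw [inv_mul_le_iff₀ (by positivity)]; exact b6
  have c2 : δ₀ ^ 2 * (∫ z in 𝒯.slab m, pdx (fun _ y => g m y) z.1 z.2 ^ 2) ≤ δ₀ ^ 2 * (τ * Λ) := by
    gcongr
  have c3 : τ⁻¹ * (∫ y in Ioo a b, (ψ (𝒯.t m.castSucc) y - g m y) ^ 2) ≤ τ * (4 / c₀ ^ 2 * Λ) := by
    rw [inv_mul_le_iff₀ hτ]
    refine b1.trans ?_
    have : h ^ 2 ≤ τ ^ 2 / c₀ ^ 2 := by
      rw [le_div_iff₀ (by positivity), ← mul_pow]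
      exact pow_le_pow_left₀ (by positivity) (by linarith) 2
    calc 4 * h ^ 2 * Λ ≤ 4 * (τ ^ 2 / c₀ ^ 2) * Λ := by gcongr
      _ = _ := by ring
  linarith

/-- On a coarse mesh the zero function is a sufficient approximation. -/
lemma Mesh.coarse_dual_approximation {k : ℕ} (𝒯 : Mesh T a b) {c₀ h h₀ : ℝ} (hc₀ : 0 < c₀)
    (hh₀ : 0 < h₀) (hh : h₀ ≤ h) (hqu : 𝒯.IsQuasiUniform c₀ h) {ψ : ℝ → ℝ → ℝ}
    (hψ : ContDiff ℝ 1 (Function.uncurry ψ)) {Λ : ℝ} (hΛ : 0 ≤ Λ)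
    (hb : ∀ t ∈ Icc 0 T, ∫ y in Ioo a b, ψ t y ^ 2 ≤ Λ) (δ₀ : ℝ) :
    ∃ g : Fin 𝒯.M → ℝ → ℝ → ℝ, (∀ m, 𝒯.IsScalarFE m k (g m)) ∧ (∀ m t y, pdt (g m) t y = 0) ∧
      ∑ m, ((h ^ 2)⁻¹ * (∫ z in 𝒯.slab m, (ψ z.1 z.2 - g m z.1 z.2) ^ 2)
        + δ₀ ^ 2 * (∫ z in 𝒯.slab m, pdx (g m) z.1 z.2 ^ 2)
        + (𝒯.t m.succ - 𝒯.t m.castSucc)⁻¹ *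
          ∫ y in Ioo a b, (ψ (𝒯.t m.castSucc) y - g m (𝒯.t m.castSucc) y) ^ 2) ≤
        T * (((h₀ ^ 2)⁻¹ + ((c₀ * h₀) ^ 2)⁻¹) * Λ) := by
  refine ⟨fun _ _ _ => 0, fun m => ⟨fun j => ⟨fun _ _ => 0, ⟨0, by simp⟩, fun _ _ _ _ => rfl⟩,
    fun _ _ => ⟨rfl, rfl⟩⟩, fun m t y => deriv_const _ _, ?_⟩
  refine le_trans (Finset.sum_le_sum fun m _ => ?_)
    (le_of_eq ((Finset.sum_mul _ _ _).symm.trans (congrArg (· * _) 𝒯.sum_steps)))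
  have hh' : 0 < h := hh₀.trans_le hh
  have hτ := sub_pos.2 (𝒯.t_lt m)
  have hτc := (hqu.1 m).1
  set τ := 𝒯.t m.succ - 𝒯.t m.castSucc
  have e : ∀ t y, pdx (fun _ _ => (0 : ℝ)) t y = 0 := fun t y => deriv_const _ _
  have b1 := hb _ ⟨𝒯.t_nonneg m.castSucc, 𝒯.t_le _⟩
  have hc : Continuous fun z : ℝ × ℝ => ψ z.1 z.2 := hψ.continuous
  have b2 : ∫ z in 𝒯.slab m, ψ z.1 z.2 ^ 2 ≤ τ * Λ :=
    𝒯.integral_slab_le m (𝒯.integrable_slab_of_continuous m (hc.pow 2)) fun t ht =>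
      hb t ⟨(𝒯.t_nonneg _).trans ht.1, ht.2.trans (𝒯.t_le _)⟩
  simp only [e, sub_zero, ne_eq, OfNat.ofNat_ne_zero, not_false_eq_true, zero_pow,
    integral_zero, mul_zero, add_zero]
  -- No smallness is needed here: h ≥ h₀ turns the negative powers of h into constants.
  have c1 : (h ^ 2)⁻¹ * (∫ z in 𝒯.slab m, ψ z.1 z.2 ^ 2) ≤ (h₀ ^ 2)⁻¹ * (τ * Λ) := by
    gcongr
  have c2 : τ⁻¹ * (∫ y in Ioo a b, ψ (𝒯.t m.castSucc) y ^ 2) ≤ τ * (((c₀ * h₀) ^ 2)⁻¹ * Λ) := by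
    have h1 : τ⁻¹ ≤ τ * ((c₀ * h₀) ^ 2)⁻¹ := by
      have h2 : c₀ * h₀ ≤ τ := (mul_le_mul_of_nonneg_left hh hc₀.le).trans hτc
      have h3 : (c₀ * h₀) ^ 2 ≤ τ ^ 2 := pow_le_pow_left₀ (by positivity) h2 2
      rw [← div_eq_mul_inv, le_div_iff₀ (by positivity), inv_mul_le_iff₀ hτ]
      nlinarith
    calc _ ≤ τ⁻¹ * Λ := by gcongr
      _ ≤ τ * ((c₀ * h₀) ^ 2)⁻¹ * Λ := by gcongr
      _ = _ := by ring
  linarith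

end Interpolation


/-! ### The cut-off dual function and the error representation for one component. -/

section ScalarEstimate

variable {T a b : ℝ}

/-- Translation preserves the integral over the whole line, and f lives in the interval; what is
shifted out of the interval is lost. -/
lemma integral_translate_sq_le {f : ℝ → ℝ} (hf : Continuous f) (hc : HasCompactSupport f)
    (hs : Function.support f ⊆ Ioo a b) (r : ℝ) :
    ∫ y in Ioo a b, f (y + r) ^ 2 ≤ ∫ y in Ioo a b, f y ^ 2 := by
  have hi : Integrable fun y => f y ^ 2 := by
    refine (hf.pow 2).integrable_of_hasCompactSupport ?_
    refine hc.mono' ((fun y hy => subset_tsupport _ ?_ : Function.support (fun y => f y ^ 2) ⊆ _))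
    rw [Function.mem_support] at hy ⊢
    exact fun h => hy (by simp [h])
  calc ∫ y in Ioo a b, f (y + r) ^ 2 ≤ ∫ y, f (y + r) ^ 2 :=
        setIntegral_le_integral (hi.comp_add_right r) (ae_of_all _ fun _ => sq_nonneg _)
    _ = ∫ y, f y ^ 2 := integral_add_right_eq_self (fun y => f y ^ 2) r
    _ = ∫ y in Ioo a b, f y ^ 2 := by
        refine (setIntegral_eq_integral_of_forall_compl_eq_zero fun y hy => ?_).symm
        have : f y = 0 := by
          by_contra h
          exact hy (hs h)
        simp [this]

/-- Smooth scalar test functions on the space interval. -/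
structure IsTest (a b : ℝ) (χ : ℝ → ℝ) : Prop where
  contDiff : ContDiff ℝ ∞ χ
  hasCompactSupport : HasCompactSupport χ
  tsupport_subset : tsupport χ ⊆ Ioo a b

lemma IsTest.hasDerivAt {χ : ℝ → ℝ} (hχ : IsTest a b χ) (y : ℝ) : HasDerivAt χ (deriv χ y) y :=
  (hχ.contDiff.differentiable (by simp) y).hasDerivAt

lemma IsTest.continuous_deriv {χ : ℝ → ℝ} (hχ : IsTest a b χ) : Continuous (deriv χ) :=
  hχ.contDiff.continuous_deriv (by simp)

lemma IsTest.eq_zero {χ : ℝ → ℝ} (hχ : IsTest a b χ) {y : ℝ} (hy : y ∉ Ioo a b) : χ y = 0 :=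
  image_eq_zero_of_notMem_tsupport fun h => hy (hχ.tsupport_subset h)

lemma IsTest.integral_translate_le {χ : ℝ → ℝ} (hχ : IsTest a b χ) (r : ℝ) :
    ∫ y in Ioo a b, χ (y + r) ^ 2 ≤ ∫ y in Ioo a b, χ y ^ 2 :=
  integral_translate_sq_le hχ.contDiff.continuous hχ.hasCompactSupport
    ((subset_tsupport _).trans hχ.tsupport_subset) r

lemma IsTest.integral_deriv_translate_le {χ : ℝ → ℝ} (hχ : IsTest a b χ) (r : ℝ) :
    ∫ y in Ioo a b, deriv χ (y + r) ^ 2 ≤ ∫ y in Ioo a b, deriv χ y ^ 2 :=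
  integral_translate_sq_le hχ.continuous_deriv hχ.hasCompactSupport.deriv
    (support_deriv_subset.trans hχ.tsupport_subset) r

/-- The test function transported backward in time and cut off in space. -/
noncomputable def dualFun (T s : ℝ) (η χ : ℝ → ℝ) (t y : ℝ) : ℝ := η y * χ (y + s * (T - t))

lemma contDiff_dualFun {s : ℝ} {η χ : ℝ → ℝ} (hη : ContDiff ℝ ∞ η) (hχ : ContDiff ℝ ∞ χ) :
    ContDiff ℝ ∞ (Function.uncurry (dualFun T s η χ)) := by
  have h1 : ContDiff ℝ ∞ fun z : ℝ × ℝ => η z.2 := hη.comp contDiff_snd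
  have h2 : ContDiff ℝ ∞ fun z : ℝ × ℝ => χ (z.2 + s * (T - z.1)) :=
    hχ.comp (by fun_prop : ContDiff ℝ ∞ fun z : ℝ × ℝ => z.2 + s * (T - z.1))
  exact h1.mul h2

lemma pdt_dualFun {s : ℝ} {η χ : ℝ → ℝ} (hχ : IsTest a b χ) (t y : ℝ) :
    pdt (dualFun T s η χ) t y = -(s * η y * deriv χ (y + s * (T - t))) := by
  have h1 : HasDerivAt (fun t : ℝ => y + s * (T - t)) (s * (-1)) t :=
    (((hasDerivAt_id t).const_sub T).const_mul s).const_add y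
  refine (((hχ.hasDerivAt _).comp t h1).const_mul (η y)).deriv.trans ?_
  ring

lemma pdx_dualFun {s : ℝ} {η χ : ℝ → ℝ} (hη : ContDiff ℝ ∞ η) (hχ : IsTest a b χ) (t y : ℝ) :
    pdx (dualFun T s η χ) t y =
      deriv η y * χ (y + s * (T - t)) + η y * deriv χ (y + s * (T - t)) := by
  have h1 : HasDerivAt (fun y : ℝ => y + s * (T - t)) 1 y := (hasDerivAt_id y).add_const _
  have h2 : HasDerivAt η (deriv η y) y := (hη.differentiable (by simp) y).hasDerivAt
  refine (h2.mul ((hχ.hasDerivAt _).comp y h1)).deriv.trans ?_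
  simp only [Function.comp_apply]
  ring

variable {𝒯 : Mesh T a b} {k : ℕ} {δ₀ h : ℝ} {w : Fin 𝒯.M → ℝ → ℝ → ℝ}
  {re rp rq ρ : Fin 𝒯.M → ℝ × ℝ → ℝ} {w0 : ℝ → ℝ}

lemma Mesh.exists_succ_eq_last (𝒯 : Mesh T a b) (hT : 0 < T) :
    ∃ n : Fin 𝒯.M, n.succ = Fin.last 𝒯.M := by
  rcases Fin.eq_zero_or_eq_succ (Fin.last 𝒯.M) with h0 | ⟨n, hn⟩
  · exact absurd (𝒯.t_last.symm.trans ((congrArg 𝒯.t h0).trans 𝒯.t_zero)) hT.ne'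
  · exact ⟨n, hn.symm⟩

/-- Error representation through the dual problem. -/
lemma Mesh.error_representation (hT : 0 < T) (hab : a < b)
    (H : ∀ m, 𝒯.IsScalarSD m k (δ₀ * h) (w m) (re m) (rp m) (rq m) (ρ m)
      (𝒯.trace w0 w m.castSucc)) {s : ℝ} {K : Set ℝ}
    {fe : ℝ × ℝ → ℝ} {WT : ℝ → ℝ} (hWT : MemLp WT 2 (volume.restrict (Ioo a b)))
    (hre : ∀ m, ∀ᵐ z ∂(volume.restrict (𝒯.slab m)),
      re m z = fe z - (pdt (w m) z.1 z.2 + s * pdx (w m) z.1 z.2))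
    (hfe : ∀ m, ∀ᵐ z ∂(volume.restrict (𝒯.slab m)), z.2 ∉ K → fe z = 0)
    (hw0 : ∀ᵐ y ∂(volume.restrict (Ioo a b)), y ∉ K → w0 y = 0) (hWK : ∀ y, y ∉ K → WT y = 0)
    {χ : ℝ → ℝ} (hχ : IsTest a b χ)
    (hW : (∫ y in Ioo a b, WT y * χ y) - (∫ y in Ioo a b, w0 y * χ (y + s * T)) =
      ∑ m, ∫ z in 𝒯.slab m, fe z * χ (z.2 + s * (T - z.1)))
    {η : ℝ → ℝ} (hη : ContDiff ℝ ∞ η) (hηK : ∀ y ∈ K, η y = 1) :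
    ∫ y in Ioo a b, (WT y - 𝒯.trace w0 w (Fin.last 𝒯.M) y) * (η y * χ y) =
      ∑ m, ((∫ z in 𝒯.slab m, re m z * dualFun T s η χ z.1 z.2)
        - ∫ y in Ioo a b, 𝒯.jump w0 w m y * dualFun T s η χ (𝒯.t m.castSucc) y)
      - ∑ m, ∫ z in 𝒯.slab m, w m z.1 z.2 * (s * (deriv η z.2 * χ (z.2 + s * (T - z.1)))) := by
  set ψ := dualFun T s η χ with hψ
  have hψ1 : ContDiff ℝ 1 (Function.uncurry ψ) := (contDiff_dualFun hη hχ.contDiff).of_le (by simp)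
  have lψs : ∀ t, MemLp (ψ t) 2 (volume.restrict (Ioo a b)) := fun t => by
    have hc : Continuous (ψ t) := hψ1.continuous.comp (by fun_prop : Continuous fun y => (t, y))
    obtain ⟨B, hB⟩ := isCompact_Icc.exists_bound_of_continuousOn (hc.continuousOn (s := Icc a b))
    refine MemLp.of_bound hc.aestronglyMeasurable B ?_
    filter_upwards [ae_restrict_mem measurableSet_Ioo] with y hy using hB y (Ioo_subset_Icc_self hy)
  have hψT : ∀ y, ψ T y = η y * χ y := fun y => by simp [hψ, dualFun]
  have hslab : ∀ m : Fin 𝒯.M, (∫ z in 𝒯.slab m, re m z * ψ z.1 z.2)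
      - (∫ y in Ioo a b, 𝒯.jump w0 w m y * ψ (𝒯.t m.castSucc) y) =
      (∫ z in 𝒯.slab m, fe z * χ (z.2 + s * (T - z.1)))
      - (∫ y in Ioo a b, 𝒯.trace w0 w m.succ y * ψ (𝒯.t m.succ) y)
      + (∫ y in Ioo a b, 𝒯.trace w0 w m.castSucc y * ψ (𝒯.t m.castSucc) y)
      + ∫ z in 𝒯.slab m, w m z.1 z.2 * (s * (deriv η z.2 * χ (z.2 + s * (T - z.1)))) := by
    intro m
    have hw := (H m).fe.piecewiseC1
    have hψp : 𝒯.PiecewiseC1 m ψ := .of_contDiff hψ1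
    have green := hw.integral_transport_mul hψ1 hab (H m).fe.2 s
    -- Transport annihilates χ(y + s (T - t)), so only the derivative of the cutoff survives.
    have e1 : ∀ z : ℝ × ℝ, pdt ψ z.1 z.2 + s * pdx ψ z.1 z.2 =
        s * (deriv η z.2 * χ (z.2 + s * (T - z.1))) := fun z => by
      rw [hψ, pdt_dualFun hχ, pdx_dualFun hη hχ]; ring
    simp only [e1] at green
    have lD : MemLp (fun z : ℝ × ℝ => pdt (w m) z.1 z.2 + s * pdx (w m) z.1 z.2) 2
        (volume.restrict (𝒯.slab m)) :=
      (hw.piecewiseContinuous_pdt.memLp 2).add ((hw.piecewiseContinuous_pdx.memLp 2).const_mul s)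
    have lψ := hψp.piecewiseContinuous.memLp 2
    -- The source lives on `K`, where the cutoff is 1, so testing it with the cut-off function gives
    -- the uncut integral that appears in the duality identity of the exact solution.
    have e2 : ∫ z in 𝒯.slab m, fe z * χ (z.2 + s * (T - z.1)) =
        (∫ z in 𝒯.slab m, re m z * ψ z.1 z.2)
          + ∫ z in 𝒯.slab m, (pdt (w m) z.1 z.2 + s * pdx (w m) z.1 z.2) * ψ z.1 z.2 := by
      rw [← integral_add ((H m).memLp_re.integrable_mul_fun lψ) (lD.integrable_mul_fun lψ)]
      refine integral_congr_ae ?_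
      filter_upwards [hfe m, hre m] with z hz hzm
      rw [← add_mul, hzm, sub_add_cancel, hψ, dualFun]
      by_cases hK : z.2 ∈ K
      · rw [hηK _ hK, one_mul]
      · rw [hz hK]; simp
    have ht₀ : 𝒯.t m.castSucc ∈ Icc (𝒯.t m.castSucc) (𝒯.t m.succ) :=
      left_mem_Icc.2 (𝒯.t_lt m).le
    have e3 : ∫ y in Ioo a b, 𝒯.jump w0 w m y * ψ (𝒯.t m.castSucc) y =
        (∫ y in Ioo a b, w m (𝒯.t m.castSucc) y * ψ (𝒯.t m.castSucc) y)
        - ∫ y in Ioo a b, 𝒯.trace w0 w m.castSucc y * ψ (𝒯.t m.castSucc) y := by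
      rw [← integral_sub ((hw.memLp_slice hab ht₀ 2).integrable_mul_fun (lψs _))
        ((H m).memLp_wm.integrable_mul_fun (lψs _))]
      simp only [Mesh.jump, sub_mul]
    simp only [Mesh.trace_succ]
    rw [e3, e2, green]
    ring
  have htel : ∑ m : Fin 𝒯.M, (-(∫ y in Ioo a b, 𝒯.trace w0 w m.succ y * ψ (𝒯.t m.succ) y)
      + ∫ y in Ioo a b, 𝒯.trace w0 w m.castSucc y * ψ (𝒯.t m.castSucc) y) =
      (∫ y in Ioo a b, 𝒯.trace w0 w 0 y * ψ (𝒯.t 0) y)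
      - ∫ y in Ioo a b, 𝒯.trace w0 w (Fin.last 𝒯.M) y * ψ (𝒯.t (Fin.last 𝒯.M)) y := by
    set u : Fin (𝒯.M + 1) → ℝ := fun n => ∫ y in Ioo a b, 𝒯.trace w0 w n y * ψ (𝒯.t n) y
    have : u 0 + ∑ m : Fin 𝒯.M, u m.succ = (∑ m : Fin 𝒯.M, u m.castSucc) + u (Fin.last 𝒯.M) := by
      rw [← Fin.sum_univ_succ, Fin.sum_univ_castSucc]
    rw [Finset.sum_add_distrib, Finset.sum_neg_distrib]
    linarith
  have hlast : MemLp (𝒯.trace w0 w (Fin.last 𝒯.M)) 2 (volume.restrict (Ioo a b)) := by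
    obtain ⟨n, hn⟩ := 𝒯.exists_succ_eq_last hT
    rw [← hn]
    exact (H n).fe.piecewiseC1.memLp_slice hab (right_mem_Icc.2 (𝒯.t_lt n).le) 2
  have e0 : ∫ y in Ioo a b, 𝒯.trace w0 w 0 y * ψ (𝒯.t 0) y =
      ∫ y in Ioo a b, w0 y * χ (y + s * T) := by
    refine integral_congr_ae ?_
    filter_upwards [hw0] with y hy
    change w0 y * ψ (𝒯.t 0) y = _
    rw [𝒯.t_zero, hψ, dualFun, sub_zero]
    by_cases hK : y ∈ K
    · rw [hηK _ hK, one_mul]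
    · rw [hy hK]; simp
  have e1 : ∫ y in Ioo a b, (WT y - 𝒯.trace w0 w (Fin.last 𝒯.M) y) * (η y * χ y) =
      (∫ y in Ioo a b, WT y * χ y)
        - ∫ y in Ioo a b, 𝒯.trace w0 w (Fin.last 𝒯.M) y * ψ (𝒯.t (Fin.last 𝒯.M)) y := by
    have hWe : ∫ y in Ioo a b, WT y * χ y = ∫ y in Ioo a b, WT y * ψ T y :=
      integral_congr_ae (ae_of_all _ fun y => by
        simp only [hψT]
        by_cases hK : y ∈ K
        · rw [hηK _ hK, one_mul]
        · rw [hWK y hK]; simp)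
    rw [𝒯.t_last, hWe, ← integral_sub (hWT.integrable_mul_fun (lψs T))
      (hlast.integrable_mul_fun (lψs T))]
    simp only [sub_mul, hψT]
  have e2 := Finset.sum_congr (rfl : (Finset.univ : Finset (Fin 𝒯.M)) = _) fun m _ => hslab m
  rw [e2, Finset.sum_add_distrib, add_sub_cancel_right, e1]
  have e3 := hW
  rw [← e0] at e3
  simp only [sub_eq_add_neg, add_assoc] at htel e3 ⊢
  rw [Finset.sum_add_distrib, htel, ← e3]
  ring

/-- Only the total approximation cost `Q` of ψ enters, so that interpolation on fine meshes and the
zero function on coarse meshes lead to the same bound. -/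
lemma Mesh.abs_residual_functional_le (hab : a < b) (hh : 0 < h)
    (H : ∀ m, 𝒯.IsScalarSD m k (δ₀ * h) (w m) (re m) (rp m) (rq m) (ρ m)
      (𝒯.trace w0 w m.castSucc)) {ψ : ℝ → ℝ → ℝ} (hψ : ContDiff ℝ 1 (Function.uncurry ψ))
    {Q : ℝ} (hQ : ∃ g : Fin 𝒯.M → ℝ → ℝ → ℝ, (∀ m, 𝒯.IsScalarFE m k (g m)) ∧
      (∀ m t y, pdt (g m) t y = 0) ∧
      ∑ m, ((h ^ 2)⁻¹ * (∫ z in 𝒯.slab m, (ψ z.1 z.2 - g m z.1 z.2) ^ 2)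
        + δ₀ ^ 2 * (∫ z in 𝒯.slab m, pdx (g m) z.1 z.2 ^ 2)
        + (𝒯.t m.succ - 𝒯.t m.castSucc)⁻¹ *
          ∫ y in Ioo a b, (ψ (𝒯.t m.castSucc) y - g m (𝒯.t m.castSucc) y) ^ 2) ≤ Q)
    {κ : ℝ} (hκ : 0 < κ) :
    |∑ m, ((∫ z in 𝒯.slab m, re m z * ψ z.1 z.2)
        - ∫ y in Ioo a b, 𝒯.jump w0 w m y * ψ (𝒯.t m.castSucc) y)| ≤
      κ * (2 * 𝒯.energy h ρ w0 w) + κ⁻¹ * Q := by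
  obtain ⟨g, hg, hgt, hgQ⟩ := hQ
  refine (Finset.abs_sum_le_sum_abs _ _).trans ((Finset.sum_le_sum fun m _ =>
    (H m).dual_bound hab hh hψ (hg m) (hgt m) hκ).trans ?_)
  rw [Finset.sum_add_distrib, ← Finset.mul_sum, ← Finset.mul_sum]
  refine add_le_add (le_of_eq ?_) (mul_le_mul_of_nonneg_left hgQ (inv_pos.2 hκ).le)
  change 2 * κ * 𝒯.energy h ρ w0 w = _
  ring

/-- A smooth cutoff that vanishes on one side of the interval. -/
lemma exists_cutoff (s e : ℝ) {d : ℝ} (hd : 0 < d) (a b : ℝ) :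
    ∃ (η : ℝ → ℝ) (L : ℝ), 0 ≤ L ∧ ContDiff ℝ ∞ η ∧ η e = 0 ∧ (∀ y, 0 ≤ η y ∧ η y ≤ 1) ∧
      (∀ y, d / 2 ≤ s * (y - e) → η y = 1) ∧ (∀ y, d / 2 < s * (y - e) → deriv η y = 0) ∧
      ∀ y ∈ Icc a b, |deriv η y| ≤ L := by
  set η : ℝ → ℝ := fun y => Real.smoothTransition (2 * (s * (y - e)) / d) with hη
  have hηc : ContDiff ℝ ∞ η :=
    Real.smoothTransition.contDiff.comp (by fun_prop : ContDiff ℝ ∞ fun y => 2 * (s * (y - e)) / d)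
  have h1 : ∀ y, d / 2 ≤ s * (y - e) → η y = 1 := fun y hy =>
    Real.smoothTransition.one_of_one_le (by rw [le_div_iff₀ hd]; linarith)
  obtain ⟨L, hL⟩ := isCompact_Icc.exists_bound_of_continuousOn
    ((hηc.continuous_deriv (by simp)).continuousOn (s := Icc a b))
  refine ⟨η, max L 0, le_max_right _ _, hηc, by simp [hη], fun y =>
    ⟨Real.smoothTransition.nonneg _, Real.smoothTransition.le_one _⟩, h1, fun y hy => ?_,
    fun y hy => (hL y hy).trans (le_max_left _ _)⟩
  have : η =ᶠ[𝓝 y] fun _ => 1 := by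
    have ho : IsOpen {y | d / 2 < s * (y - e)} := isOpen_lt continuous_const (by fun_prop)
    filter_upwards [ho.mem_nhds (by rwa [mem_ofPred_eq])] with z hz
    exact h1 z hz.le
  rw [this.deriv_eq, deriv_const]

/-- On a fine mesh there is a node close to, but not too close to, the inflow boundary. -/
lemma Mesh.exists_node (𝒯 : Mesh T a b) {c₀ : ℝ} (hqu : 𝒯.IsQuasiUniform c₀ h) {s d : ℝ}
    (hs : s = 1 ∨ s = -1) (hd : 0 < d) (hdab : a + d < b) (hhd : h ≤ d / 4) :
    ∃ i : Fin (𝒯.N + 1), 3 * d / 4 ≤ s * (𝒯.x i - if s = 1 then a else b) ∧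
      s * (𝒯.x i - if s = 1 then a else b) ≤ d := by
  -- The node is the upstream end of the element that contains the point at distance d from the
  -- inflow end; the element is no longer than d / 4.
  rcases hs with rfl | rfl
  · obtain ⟨j, hj⟩ := 𝒯.exists_x_mem (y := a + d) ⟨by linarith, hdab.le⟩
    refine ⟨j.castSucc, ?_, ?_⟩ <;> simp only [if_true] <;> linarith [hj.1, hj.2, (hqu.2 j).2]
  · obtain ⟨j, hj⟩ := 𝒯.exists_x_mem (y := b - d) ⟨by linarith, by linarith⟩
    have : ((-1 : ℝ) = 1) = False := by norm_num
    refine ⟨j.succ, ?_, ?_⟩ <;> simp only [this, if_false] <;> linarith [hj.1, hj.2, (hqu.2 j).2]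

/-- This lets the weighted energy control the trace at the final time: the factor θ = 1 - η is
nonzero only where the strip weight is at least d / 4. -/
lemma mul_le_weighted_sq {κ d β v χ θ : ℝ} (hκ : 0 < κ) (hd : 0 < d) (hθ0 : 0 ≤ θ) (hθ1 : θ ≤ 1)
    (hβ0 : 0 ≤ β) (hβ : θ = 0 ∨ d / 4 ≤ β) :
    |v * (θ * χ)| ≤ κ * (β * v ^ 2) + κ⁻¹ * (d⁻¹ * χ ^ 2) := by
  have hp : 0 ≤ κ⁻¹ * (d⁻¹ * χ ^ 2) := by positivity
  rcases hβ with rfl | hβ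
  · have : 0 ≤ κ * (β * v ^ 2) := by positivity
    simp only [zero_mul, mul_zero, abs_zero]; linarith
  · have h1 : |v * (θ * χ)| ≤ |v| * |χ| := by
      rw [abs_mul, abs_mul, abs_of_nonneg hθ0]
      have := mul_le_of_le_one_left (abs_nonneg χ) hθ1
      gcongr
    have h2 : κ * (d / 4 * v ^ 2) ≤ κ * (β * v ^ 2) := by gcongr
    have h3 : κ * (d / 4 * v ^ 2) + κ⁻¹ * (d⁻¹ * χ ^ 2) - |v| * |χ| =
        κ * d * (|v| / 2 - (κ * d)⁻¹ * |χ|) ^ 2 := by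
      rw [← sq_abs v, ← sq_abs χ]; field_simp; ring
    have h4 : 0 ≤ κ * d * (|v| / 2 - (κ * d)⁻¹ * |χ|) ^ 2 := by positivity
    linarith

end ScalarEstimate


/-! ### The error estimate for one component, on coarse and on fine meshes. -/

section ScalarTheorem

variable {T a b : ℝ}

lemma dualFun_one {s : ℝ} (χ : ℝ → ℝ) (t y : ℝ) :
    dualFun T s (fun _ => 1) χ t y = χ (y + s * (T - t)) := one_mul _

lemma le_of_forall_le_mul_add {X A B E D : ℝ} (hA : 0 ≤ A) (hB : 0 ≤ B) (hE : 0 ≤ E) (hD : 0 ≤ D)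
    (h : ∀ κ : ℝ, 0 < κ → X ≤ κ * (A * E) + κ⁻¹ * (B * D)) :
    X ≤ 2 * Real.sqrt A * Real.sqrt B * (Real.sqrt E * Real.sqrt D) := by
  refine (le_two_mul_sqrt_mul_sqrt (by positivity) (by positivity) h).trans_eq ?_
  rw [Real.sqrt_mul hA, Real.sqrt_mul hB]
  ring

lemma integrableOn_Ioo_of_continuous {f : ℝ → ℝ} (hf : Continuous f) :
    IntegrableOn f (Ioo a b) := hf.integrableOn_Icc.mono_set Ioo_subset_Icc_self

lemma memLp_Ioo_of_continuous {f : ℝ → ℝ} (hf : Continuous f) (p : ℝ≥0∞) :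
    MemLp f p (volume.restrict (Ioo a b)) := by
  obtain ⟨B, hB⟩ := isCompact_Icc.exists_bound_of_continuousOn (hf.continuousOn (s := Icc a b))
  refine MemLp.of_bound hf.aestronglyMeasurable B ?_
  filter_upwards [ae_restrict_mem measurableSet_Ioo] with y hy using hB y (Ioo_subset_Icc_self hy)

/-- The data of the scalar error estimate for one component `w` with direction `s`: the residual
components, the exact solution at the final time and the duality identity it satisfies. -/
structure Mesh.IsScalarErrorProblem (𝒯 : Mesh T a b) (k : ℕ) (δ : ℝ) (s : ℝ) (K : Set ℝ)
    (w : Fin 𝒯.M → ℝ → ℝ → ℝ) (re rp rq ρ : Fin 𝒯.M → ℝ × ℝ → ℝ) (w0 WT : ℝ → ℝ)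
    (fe : ℝ × ℝ → ℝ) : Prop where
  sd : ∀ m, 𝒯.IsScalarSD m k δ (w m) (re m) (rp m) (rq m) (ρ m) (𝒯.trace w0 w m.castSucc)
  memLp_WT : MemLp WT 2 (volume.restrict (Ioo a b))
  re_eq : ∀ m, ∀ᵐ z ∂(volume.restrict (𝒯.slab m)),
    re m z = fe z - (pdt (w m) z.1 z.2 + s * pdx (w m) z.1 z.2)
  off_support : ∀ m, ∀ᵐ z ∂(volume.restrict (𝒯.slab m)), z.2 ∉ K →
    fe z = 0 ∧ pdt (w m) z.1 z.2 * rp m z + pdx (w m) z.1 z.2 * rq m z ≤ 0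
  w0_eq_zero : ∀ᵐ y ∂(volume.restrict (Ioo a b)), y ∉ K → w0 y = 0
  WT_eq_zero : ∀ y, y ∉ K → WT y = 0
  duality : ∀ χ, IsTest a b χ →
    (∫ y in Ioo a b, WT y * χ y) - (∫ y in Ioo a b, w0 y * χ (y + s * T)) =
      ∑ m, ∫ z in 𝒯.slab m, fe z * χ (z.2 + s * (T - z.1))

variable {𝒯 : Mesh T a b} {k : ℕ} {δ₀ h s : ℝ} {K : Set ℝ} {w : Fin 𝒯.M → ℝ → ℝ → ℝ}
  {re rp rq ρ : Fin 𝒯.M → ℝ × ℝ → ℝ} {w0 WT : ℝ → ℝ} {fe : ℝ × ℝ → ℝ}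

/-- Square of the `H¹` norm of a scalar test function. -/
noncomputable def h1Sq (a b : ℝ) (χ : ℝ → ℝ) : ℝ :=
  (∫ y in Ioo a b, χ y ^ 2) + ∫ y in Ioo a b, deriv χ y ^ 2

lemma integral_sq_nonneg (f : ℝ → ℝ) : 0 ≤ ∫ y in Ioo a b, f y ^ 2 :=
  integral_nonneg fun _ => sq_nonneg _

lemma h1Sq_nonneg (χ : ℝ → ℝ) : 0 ≤ h1Sq a b χ :=
  add_nonneg (integral_sq_nonneg _) (integral_sq_nonneg _)

lemma Mesh.IsScalarErrorProblem.representation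
    (P : 𝒯.IsScalarErrorProblem k (δ₀ * h) s K w re rp rq ρ w0 WT fe) (hT : 0 < T) (hab : a < b)
    {χ : ℝ → ℝ} (hχ : IsTest a b χ) {η : ℝ → ℝ} (hη : ContDiff ℝ ∞ η) (hηK : ∀ y ∈ K, η y = 1) :
    ∫ y in Ioo a b, (WT y - 𝒯.trace w0 w (Fin.last 𝒯.M) y) * (η y * χ y) =
      ∑ m, ((∫ z in 𝒯.slab m, re m z * dualFun T s η χ z.1 z.2)
        - ∫ y in Ioo a b, 𝒯.jump w0 w m y * dualFun T s η χ (𝒯.t m.castSucc) y)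
      - ∑ m, ∫ z in 𝒯.slab m, w m z.1 z.2 * (s * (deriv η z.2 * χ (z.2 + s * (T - z.1)))) :=
  Mesh.error_representation hT hab P.sd P.memLp_WT P.re_eq
    (fun m => (P.off_support m).mono fun _ hz hK => (hz hK).1) P.w0_eq_zero P.WT_eq_zero hχ
    (P.duality χ hχ) hη hηK

/-- The scalar error estimate on coarse meshes. -/
lemma Mesh.IsScalarErrorProblem.coarse_bound
    (P : 𝒯.IsScalarErrorProblem k (δ₀ * h) s K w re rp rq ρ w0 WT fe) (hT : 0 < T) (hab : a < b)
    {c₀ h₀ : ℝ} (hc₀ : 0 < c₀) (hh₀ : 0 < h₀) (hh : h₀ ≤ h) (hqu : 𝒯.IsQuasiUniform c₀ h)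
    {χ : ℝ → ℝ} (hχ : IsTest a b χ) {κ : ℝ} (hκ : 0 < κ) :
    |∫ y in Ioo a b, (WT y - 𝒯.trace w0 w (Fin.last 𝒯.M) y) * χ y| ≤
      κ * (2 * 𝒯.energy h ρ w0 w)
        + κ⁻¹ * (T * ((h₀ ^ 2)⁻¹ + ((c₀ * h₀) ^ 2)⁻¹) * h1Sq a b χ) := by
  -- The zero comparison function imposes no boundary condition on the dual function, so no cutoff
  -- is needed.
  have rep := P.representation hT hab hχ (η := fun _ => 1) contDiff_const fun _ _ => rfl
  simp only [deriv_const, zero_mul, mul_zero, integral_zero, Finset.sum_const_zero, sub_zero,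
    one_mul] at rep
  have hψ : ContDiff ℝ 1 (Function.uncurry (dualFun T s (fun _ => 1) χ)) :=
    (contDiff_dualFun contDiff_const hχ.contDiff).of_le (by simp)
  rw [rep]
  refine (Mesh.abs_residual_functional_le hab (hh₀.trans_le hh) P.sd hψ
    (𝒯.coarse_dual_approximation hc₀ hh₀ hh hqu hψ (h1Sq_nonneg χ) (fun t _ => ?_) δ₀) hκ).trans_eq
    (by ring)
  simp only [dualFun_one]
  refine (hχ.integral_translate_le _).trans ?_
  exact le_add_of_nonneg_right (integral_sq_nonneg _)

/-- The contribution of the strip upstream of the support to the error. -/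
lemma Mesh.abs_strip_functional_le (hs : s = 1 ∨ s = -1) (hfe : ∀ m, 𝒯.IsScalarFE m k (w m))
    {i : Fin (𝒯.N + 1)}
    {η : ℝ → ℝ} (hη : ContDiff ℝ ∞ η) {L : ℝ} (hL : ∀ y ∈ Icc a b, |deriv η y| ≤ L)
    (hηs : ∀ y, y ∉ strip s (𝒯.x i) → deriv η y = 0) {χ : ℝ → ℝ} (hχ : IsTest a b χ) {κ S : ℝ}
    (hκ : 0 < κ) (hS : ∑ m, (∫ z in 𝒯.slab m,
      (univ ×ˢ strip s (𝒯.x i)).indicator (fun z => w m z.1 z.2 ^ 2) z) ≤ S) :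
    |∑ m, ∫ z in 𝒯.slab m, w m z.1 z.2 * (s * (deriv η z.2 * χ (z.2 + s * (T - z.1))))| ≤
      κ * S + κ⁻¹ * (T * L ^ 2 * h1Sq a b χ) := by
  have hs2 : s ^ 2 = 1 := by rcases hs with rfl | rfl <;> norm_num
  have hηc := hη.continuous_deriv (by simp)
  have hm : ∀ m : Fin 𝒯.M,
      |∫ z in 𝒯.slab m, w m z.1 z.2 * (s * (deriv η z.2 * χ (z.2 + s * (T - z.1))))| ≤
      κ * (∫ z in 𝒯.slab m, (univ ×ˢ strip s (𝒯.x i)).indicator (fun z => w m z.1 z.2 ^ 2) z)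
        + κ⁻¹ * ((𝒯.t m.succ - 𝒯.t m.castSucc) * (L ^ 2 * h1Sq a b χ)) := by
    intro m
    set f : ℝ × ℝ → ℝ := (univ ×ˢ strip s (𝒯.x i)).indicator fun z => w m z.1 z.2 with hf
    set g : ℝ × ℝ → ℝ := fun z => s * (deriv η z.2 * χ (z.2 + s * (T - z.1))) with hg
    have hgc : Continuous g := by
      have h1 : Continuous fun z : ℝ × ℝ => deriv η z.2 := hηc.comp continuous_snd
      have h2 : Continuous fun z : ℝ × ℝ => χ (z.2 + s * (T - z.1)) :=
        hχ.contDiff.continuous.comp (by fun_prop)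
      exact continuous_const.mul (h1.mul h2)
    have lf : MemLp f 2 (volume.restrict (𝒯.slab m)) :=
      ((hfe m).piecewiseC1.piecewiseContinuous.memLp 2).indicator
        (MeasurableSet.univ.prod (isOpen_strip _ _).measurableSet)
    have lg : MemLp g 2 (volume.restrict (𝒯.slab m)) :=
      Mesh.PiecewiseContinuous.memLp (fun _ => ⟨g, hgc, fun _ _ => rfl⟩) 2
    -- The derivative of the cutoff vanishes outside the strip, so only the part of w controlled by
    -- the strip estimate is seen.
    have e1 : ∀ z, w m z.1 z.2 * g z = f z * g z := fun z => by
      by_cases hz : z.2 ∈ strip s (𝒯.x i)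
      · rw [hf, indicator_of_mem (mem_prod.2 ⟨mem_univ _, hz⟩)]
      · rw [hg]; simp [hηs _ hz]
    have e2 : ∀ z, f z ^ 2 = (univ ×ˢ strip s (𝒯.x i)).indicator (fun z => w m z.1 z.2 ^ 2) z :=
      fun z => by
        by_cases hz : z ∈ univ ×ˢ strip s (𝒯.x i)
        · rw [hf, indicator_of_mem hz, indicator_of_mem hz]
        · rw [hf, indicator_of_notMem hz, indicator_of_notMem hz, zero_pow two_ne_zero]
    have e3 : ∫ z in 𝒯.slab m, g z ^ 2 ≤
        (𝒯.t m.succ - 𝒯.t m.castSucc) * (L ^ 2 * h1Sq a b χ) := by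
      refine 𝒯.integral_slab_le m lg.integrable_sq fun t _ => ?_
      have hχc : Continuous fun y => L ^ 2 * χ (y + s * (T - t)) ^ 2 :=
        continuous_const.mul ((hχ.contDiff.continuous.comp (by fun_prop)).pow 2)
      calc ∫ y in Ioo a b, g (t, y) ^ 2 ≤ ∫ y in Ioo a b, L ^ 2 * χ (y + s * (T - t)) ^ 2 := by
            refine setIntegral_mono_on ?_ (integrableOn_Ioo_of_continuous hχc) measurableSet_Ioo
              fun y hy => ?_
            · exact integrableOn_Ioo_of_continuous
                ((hgc.comp (by fun_prop : Continuous fun y => (t, y))).pow 2)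
            · simp only [hg, mul_pow, hs2, one_mul]
              rw [← sq_abs (deriv η y)]
              have := pow_le_pow_left₀ (abs_nonneg _) (hL y (Ioo_subset_Icc_self hy)) 2
              gcongr
        _ ≤ L ^ 2 * h1Sq a b χ := by
            rw [integral_const_mul]
            refine mul_le_mul_of_nonneg_left ((hχ.integral_translate_le _).trans ?_) (sq_nonneg _)
            exact le_add_of_nonneg_right (integral_sq_nonneg _)
    have key := integral_mul_le_of_pos lf lg hκ
    simp only [e2] at key
    rw [show (∫ z in 𝒯.slab m, w m z.1 z.2 * (s * (deriv η z.2 * χ (z.2 + s * (T - z.1))))) =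
      ∫ z in 𝒯.slab m, f z * g z from integral_congr_ae (ae_of_all _ e1)]
    refine key.trans (add_le_add le_rfl ?_)
    have hi : (4 * κ)⁻¹ ≤ κ⁻¹ := inv_anti₀ hκ (by linarith)
    have hn : 0 ≤ ∫ z in 𝒯.slab m, g z ^ 2 := integral_nonneg fun _ => sq_nonneg _
    exact mul_le_mul hi e3 hn (inv_pos.2 hκ).le
  refine (Finset.abs_sum_le_sum_abs _ _).trans ((Finset.sum_le_sum fun m _ => hm m).trans ?_)
  rw [Finset.sum_add_distrib, ← Finset.mul_sum, ← Finset.mul_sum]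
  have hsum : ∑ m : Fin 𝒯.M, (𝒯.t m.succ - 𝒯.t m.castSucc) * (L ^ 2 * h1Sq a b χ) =
      T * L ^ 2 * h1Sq a b χ :=
    ((Finset.sum_mul _ _ _).symm.trans (congrArg (· * _) 𝒯.sum_steps)).trans (by ring)
  rw [hsum]
  gcongr

lemma integral_pdt_dualFun_sq_le (hs : s = 1 ∨ s = -1) {η χ : ℝ → ℝ} (hηc : Continuous η)
    (hη : ∀ y, 0 ≤ η y ∧ η y ≤ 1) (hχ : IsTest a b χ) (t : ℝ) :
    ∫ y in Ioo a b, pdt (dualFun T s η χ) t y ^ 2 ≤ h1Sq a b χ := by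
  have hs2 : s ^ 2 = 1 := by rcases hs with rfl | rfl <;> norm_num
  have hc : Continuous fun y => deriv χ (y + s * (T - t)) :=
    hχ.continuous_deriv.comp (by fun_prop)
  simp only [pdt_dualFun hχ]
  calc _ ≤ ∫ y in Ioo a b, deriv χ (y + s * (T - t)) ^ 2 := by
        refine integral_mono (integrableOn_Ioo_of_continuous
          ((((continuous_const.mul hηc).mul hc).neg).pow 2))
          (integrableOn_Ioo_of_continuous (hc.pow 2)) fun y => ?_
        simp only [neg_sq, mul_pow, hs2, one_mul]
        exact mul_le_of_le_one_left (sq_nonneg _) (pow_le_one₀ (hη y).1 (hη y).2)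
    _ ≤ _ := (hχ.integral_deriv_translate_le _).trans
        (le_add_of_nonneg_left (integral_sq_nonneg _))

lemma integral_pdx_dualFun_sq_le {η χ : ℝ → ℝ} (hηc : ContDiff ℝ ∞ η)
    (hη : ∀ y, 0 ≤ η y ∧ η y ≤ 1) {L : ℝ} (hL : ∀ y ∈ Icc a b, |deriv η y| ≤ L)
    (hχ : IsTest a b χ) (t : ℝ) :
    ∫ y in Ioo a b, pdx (dualFun T s η χ) t y ^ 2 ≤ 2 * (L ^ 2 + 1) * h1Sq a b χ := by
  have hc' : Continuous fun y => deriv χ (y + s * (T - t)) :=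
    hχ.continuous_deriv.comp (by fun_prop)
  have hc : Continuous fun y => χ (y + s * (T - t)) := hχ.contDiff.continuous.comp (by fun_prop)
  have hdc := hηc.continuous_deriv (by simp)
  have h1 := hχ.integral_translate_le (s * (T - t))
  have h2 := hχ.integral_deriv_translate_le (s * (T - t))
  simp only [pdx_dualFun hηc hχ]
  calc _ ≤ ∫ y in Ioo a b, (2 * L ^ 2 * χ (y + s * (T - t)) ^ 2
          + 2 * deriv χ (y + s * (T - t)) ^ 2) := by
        refine setIntegral_mono_on (integrableOn_Ioo_of_continuous
          (((hdc.mul hc).add (hηc.continuous.mul hc')).pow 2))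
          (integrableOn_Ioo_of_continuous ((continuous_const.mul (hc.pow 2)).add
            (continuous_const.mul (hc'.pow 2)))) measurableSet_Ioo fun y hy => ?_
        have e1 : (deriv η y * χ (y + s * (T - t))) ^ 2 ≤ L ^ 2 * χ (y + s * (T - t)) ^ 2 := by
          rw [mul_pow, ← sq_abs (deriv η y)]
          have := pow_le_pow_left₀ (abs_nonneg _) (hL y (Ioo_subset_Icc_self hy)) 2
          gcongr
        have e2 : (η y * deriv χ (y + s * (T - t))) ^ 2 ≤ deriv χ (y + s * (T - t)) ^ 2 := by
          rw [mul_pow]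
          exact mul_le_of_le_one_left (sq_nonneg _) (pow_le_one₀ (hη y).1 (hη y).2)
        linarith [sq_nonneg (deriv η y * χ (y + s * (T - t)) - η y * deriv χ (y + s * (T - t))),
          add_sq (deriv η y * χ (y + s * (T - t))) (η y * deriv χ (y + s * (T - t))),
          sub_sq (deriv η y * χ (y + s * (T - t))) (η y * deriv χ (y + s * (T - t)))]
    _ = 2 * L ^ 2 * (∫ y in Ioo a b, χ (y + s * (T - t)) ^ 2)
        + 2 * ∫ y in Ioo a b, deriv χ (y + s * (T - t)) ^ 2 := by
        rw [integral_add, integral_const_mul, integral_const_mul]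
        · exact integrableOn_Ioo_of_continuous (continuous_const.mul (hc.pow 2))
        · exact integrableOn_Ioo_of_continuous (continuous_const.mul (hc'.pow 2))
    _ ≤ 2 * L ^ 2 * (∫ y in Ioo a b, χ y ^ 2) + 2 * ∫ y in Ioo a b, deriv χ y ^ 2 := by gcongr
    _ ≤ _ := by
        unfold h1Sq
        nlinarith [integral_sq_nonneg (a := a) (b := b) χ,
          mul_nonneg (sq_nonneg L) (integral_sq_nonneg (a := a) (b := b) (deriv χ))]

/-- At the inflow end the cutoff vanishes. At the outflow end the shifted point has left the
interval, where χ is zero. -/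
lemma dualFun_boundary (hs : s = 1 ∨ s = -1) {η χ : ℝ → ℝ} (hχ : IsTest a b χ)
    (hη : η (if s = 1 then a else b) = 0) {t : ℝ} (ht : t ≤ T) :
    dualFun T s η χ t a = 0 ∧ dualFun T s η χ t b = 0 := by
  unfold dualFun
  rcases hs with rfl | rfl
  · rw [if_pos rfl] at hη
    rw [hη, zero_mul, hχ.eq_zero (fun h => by linarith [h.2] : b + 1 * (T - t) ∉ Ioo a b), mul_zero]
    exact ⟨rfl, rfl⟩
  · rw [if_neg (by norm_num)] at hη
    rw [hη, zero_mul, hχ.eq_zero (fun h => by linarith [h.1] : a + -1 * (T - t) ∉ Ioo a b),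
      mul_zero]
    exact ⟨rfl, rfl⟩

/-- The scalar error estimate. -/
theorem Mesh.exists_scalar_bound (hT : 0 < T) (hab : a < b) {k : ℕ} (hk : 1 ≤ k) {δ₀ c₀ : ℝ}
    (hδ₀ : 0 < δ₀) (hc₀ : 0 < c₀) {d : ℝ} (hd : 0 < d) (hdab : a + d < b)
    (hK : K ⊆ Icc (a + d) (b - d)) (hs : s = 1 ∨ s = -1) :
    ∃ C : ℝ, 0 ≤ C ∧ ∀ (𝒯 : Mesh T a b) (h : ℝ), 0 < h → 𝒯.IsQuasiUniform c₀ h →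
    ∀ (w : Fin 𝒯.M → ℝ → ℝ → ℝ) (re rp rq ρ : Fin 𝒯.M → ℝ × ℝ → ℝ) (w0 WT : ℝ → ℝ)
      (fe : ℝ × ℝ → ℝ), 𝒯.IsScalarErrorProblem k (δ₀ * h) s K w re rp rq ρ w0 WT fe →
    ∀ χ, IsTest a b χ → |∫ y in Ioo a b, (WT y - 𝒯.trace w0 w (Fin.last 𝒯.M) y) * χ y| ≤
      C * (Real.sqrt (𝒯.energy h ρ w0 w) * Real.sqrt (h1Sq a b χ)) := by
  obtain ⟨Cs, hCs, hstrip⟩ := Mesh.exists_strip_estimate k hk hδ₀ hc₀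
  set e : ℝ := if s = 1 then a else b with he
  obtain ⟨η, L, hL0, hη, hηe, hη01, hη1, hηd, hL⟩ := exists_cutoff s e hd a b
  have hKe : ∀ y ∈ K, d ≤ s * (y - e) := by
    intro y hy
    have := hK hy
    rcases hs with rfl | rfl
    · rw [he, if_pos rfl]; linarith [this.1]
    · rw [he, if_neg (by norm_num)]; linarith [this.2]
  -- The summands pay, in this order, for approximating the dual function, for the term with the
  -- derivative of the cutoff and for the trace at time T. `M₂` belongs to coarse meshes.
  set M₁ := T * ((10 + δ₀ ^ 2 + 4 / c₀ ^ 2) * (2 * (L ^ 2 + 1))) + T * L ^ 2 + d⁻¹ with hM₁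
  set M₂ := T * (((d / 4) ^ 2)⁻¹ + ((c₀ * (d / 4)) ^ 2)⁻¹) with hM₂
  have hM₁0 : 0 ≤ M₁ := by positivity
  have hM₂0 : 0 ≤ M₂ := by positivity
  -- The constant adds a fine-mesh and a coarse-mesh part, and each case drops the other part. In 2
  -- + 2 `Cs` the 2 is from the residual functional, and the strip estimate enters twice.
  refine ⟨2 * Real.sqrt (2 + 2 * Cs) * Real.sqrt M₁ + 2 * Real.sqrt 2 * Real.sqrt M₂,
    by positivity, ?_⟩
  intro 𝒯 h hh hqu w re rp rq ρ w0 WT fe P χ hχ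
  have hE := 𝒯.energy_nonneg h ρ w0 w
  have hD := h1Sq_nonneg (a := a) (b := b) χ
  set E := 𝒯.energy h ρ w0 w with hEd
  set D := h1Sq a b χ with hDd
  rw [add_mul]
  rcases le_total (d / 4) h with hc | hc
  · refine le_trans ?_ (le_add_of_nonneg_left (by positivity))
    exact le_of_forall_le_mul_add (by norm_num) hM₂0 hE hD fun κ hκ =>
      P.coarse_bound hT hab hc₀ (by positivity) hc hqu hχ hκ
  refine le_trans ?_ (le_add_of_nonneg_right (by positivity))
  refine le_of_forall_le_mul_add (by positivity) hM₁0 hE hD fun κ hκ => ?_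
  obtain ⟨i, hi1, hi2⟩ := 𝒯.exists_node hqu hs hd hdab hc
  rw [← he] at hi1 hi2
  -- The strip ends at distance at most d from the inflow end, and `K` starts no closer than d; so
  -- source and initial datum vanish in the strip.
  have hKs : ∀ y ∈ strip s (𝒯.x i), y ∉ K := fun y hy hyK => by
    have h1 := mem_strip.1 hy
    have h2 := hKe y hyK
    linarith
  obtain ⟨hS1, hS2⟩ := hstrip hab 𝒯 h hh hqu w re rp rq ρ w0 P.sd s hs i
    (fun m => by
      filter_upwards [P.off_support m, P.re_eq m] with z hz hre hzs
      obtain ⟨h1, h2⟩ := hz (hKs _ hzs)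
      exact ⟨by rw [hre, h1, zero_sub], h2⟩)
    (P.w0_eq_zero.mono fun y hy hys => hy (hKs _ hys))
  rw [← hEd] at hS1 hS2
  have hψ : ContDiff ℝ 1 (Function.uncurry (dualFun T s η χ)) :=
    (contDiff_dualFun hη hχ.contDiff).of_le (by simp)
  have hΛ : 0 ≤ 2 * (L ^ 2 + 1) * D := by positivity
  have B1 := Mesh.abs_residual_functional_le hab hh P.sd hψ
    (𝒯.exists_dual_approximation hk hc₀ hh hqu hψ hΛ
      (fun t ht => dualFun_boundary hs hχ hηe ht.2)
      (fun t _ => (integral_pdt_dualFun_sq_le hs hη.continuous hη01 hχ t).trans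
        (by nlinarith [mul_nonneg (sq_nonneg L) hD]))
      (fun t _ => integral_pdx_dualFun_sq_le hη hη01 hL hχ t) δ₀) hκ
  have B2 := Mesh.abs_strip_functional_le hs (fun m => (P.sd m).fe) hη hL
    (fun y hy => hηd y (by
      have := not_lt.1 (mem_strip.not.1 hy)
      linarith)) hχ hκ hS2
  have rep := P.representation hT hab hχ hη fun y hy => hη1 y (by linarith [hKe y hy])
  set v := 𝒯.trace w0 w (Fin.last 𝒯.M) with hv
  have lv : MemLp v 2 (volume.restrict (Ioo a b)) := by
    obtain ⟨n, hn⟩ := 𝒯.exists_succ_eq_last hT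
    rw [hv, ← hn]
    exact (P.sd n).fe.piecewiseC1.memLp_slice hab (right_mem_Icc.2 (𝒯.t_lt n).le) 2
  have lχ := memLp_Ioo_of_continuous (a := a) (b := b) hχ.contDiff.continuous 2
  have lηχ : MemLp (fun y => η y * χ y) 2 (volume.restrict (Ioo a b)) :=
    memLp_Ioo_of_continuous (hη.continuous.mul hχ.contDiff.continuous) 2
  have lηχ' : MemLp (fun y => (1 - η y) * χ y) 2 (volume.restrict (Ioo a b)) :=
    memLp_Ioo_of_continuous ((continuous_const.sub hη.continuous).mul hχ.contDiff.continuous) 2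
  have lWv : MemLp (fun y => WT y - v y) 2 (volume.restrict (Ioo a b)) := P.memLp_WT.sub lv
  have B3 : |∫ y in Ioo a b, v y * ((1 - η y) * χ y)| ≤ κ * (Cs * E) + κ⁻¹ * (d⁻¹ * D) := by
    have i1 : Integrable (fun y => stripWeight s (𝒯.x i) y * v y ^ 2)
        (volume.restrict (Ioo a b)) :=
      memLp_one_iff_integrable.1 ((memLp_one_iff_integrable.2 lv.integrable_sq).mul
        (memLp_Ioo_of_continuous (continuous_stripWeight s (𝒯.x i)) ⊤))
    have i2 := lχ.integrable_sq
    calc _ ≤ ∫ y in Ioo a b, |v y * ((1 - η y) * χ y)| := abs_integral_le_integral_abs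
      _ ≤ ∫ y in Ioo a b, (κ * (stripWeight s (𝒯.x i) y * v y ^ 2) + κ⁻¹ * (d⁻¹ * χ y ^ 2)) := by
          refine integral_mono (lv.integrable_mul_fun lηχ').abs
            ((i1.const_mul κ).add ((i2.const_mul _).const_mul _)) fun y => ?_
          refine mul_le_weighted_sq hκ hd (sub_nonneg.2 (hη01 y).2) (by linarith [(hη01 y).1])
            (stripWeight_nonneg _ _ _) ?_
          rcases le_or_gt (d / 2) (s * (y - e)) with hy | hy
          · left; rw [hη1 y hy, sub_self]
          · right; refine le_trans ?_ (le_max_left _ _); linarith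
      _ = κ * (∫ y in Ioo a b, stripWeight s (𝒯.x i) y * v y ^ 2)
          + κ⁻¹ * (d⁻¹ * ∫ y in Ioo a b, χ y ^ 2) := by
          rw [integral_add (i1.const_mul κ) ((i2.const_mul _).const_mul _)]
          simp only [integral_const_mul]
      _ ≤ _ := by
          have : ∫ y in Ioo a b, χ y ^ 2 ≤ D := le_add_of_nonneg_right (integral_sq_nonneg _)
          gcongr
  -- The exact solution at time T lives where η = 1, so the part with 1 - η sees the numerical trace
  -- alone.
  have hsplit : ∫ y in Ioo a b, (WT y - v y) * χ y =
      (∫ y in Ioo a b, (WT y - v y) * (η y * χ y)) - ∫ y in Ioo a b, v y * ((1 - η y) * χ y) := by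
    rw [← integral_sub (lWv.integrable_mul_fun lηχ) (lv.integrable_mul_fun lηχ')]
    refine integral_congr_ae (ae_of_all _ fun y => ?_)
    by_cases hy : y ∈ K
    · have := hη1 y (by linarith [hKe y hy])
      simp only [this]; ring
    · simp only [P.WT_eq_zero y hy]; ring
  rw [hsplit, rep]
  have tri : ∀ x y z : ℝ, |x - y - z| ≤ |x| + |y| + |z| := fun x y z =>
    (abs_sub _ _).trans (by linarith [abs_sub x y])
  refine (tri _ _ _).trans ?_
  calc _ ≤ _ := add_le_add (add_le_add B1 B2) B3
    _ = _ := by rw [hM₁]; ring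

end ScalarTheorem


/-! ### Algebra of the matrices and the three characteristic directions. -/

section Characteristics

lemma act_smul (A : Matrix (Fin 4) (Fin 3) ℝ) (c : ℝ) (v : Vec 3) :
    act A (c • v) = c • act A v := by
  simp [act, Matrix.mulVec_smul]

lemma act_zero (A : Matrix (Fin 4) (Fin 3) ℝ) : act A 0 = 0 := by
  simp [act]

lemma hat_smul (c : ℝ) (v : Vec 3) : hat (c • v) = c • hat v := by
  ext i; fin_cases i <;> simp [hat]

lemma act_M₁ (v : Vec 3) : act M₁ v = !₂[0, v 0, v 1, v 2] := by
  ext i; fin_cases i <;> simp [act, M₁, dotProduct, Fin.sum_univ_three]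

lemma act_M₂ (v : Vec 3) : act M₂ v = !₂[v 0, 0, v 2, v 1] := by
  ext i; fin_cases i <;> simp [act, M₂, dotProduct, Fin.sum_univ_three]

lemma inner_act_M₁_hat (v n : Vec 3) : inner ℝ (act M₁ v) (hat n) = inner ℝ v n := by
  simp [act_M₁, hat, PiLp.inner_apply, Fin.sum_univ_succ]

/-- A component along `n` of the Maxwell system is a transport equation with speed `s`. -/
structure IsCharacteristic (s : ℝ) (n : Vec 3) : Prop where
  inner_act_M₂_hat : ∀ v, inner ℝ (act M₂ v) (hat n) = s * inner ℝ v n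
  dissipative : ∀ u v, 0 ≤ inner ℝ u n * inner ℝ (act M₁ u + act M₂ v) (act M₁ n)
    + inner ℝ v n * inner ℝ (act M₁ u + act M₂ v) (act M₂ n)
  norm_le : ‖n‖ ≤ 2
  norm_hat_le : ‖hat n‖ ≤ 2
  norm_M₁_le : ‖act M₁ n‖ ≤ 2
  norm_M₂_le : ‖act M₂ n‖ ≤ 2

/-- E₁ satisfies two equations, one for each derivative. Pairing with `hat n` adds them, which gives
speed 1, while the stabilisation keeps them apart: the dissipation form is the sum of the squares of
the first components of u and v. -/
lemma isCharacteristic_electric : IsCharacteristic 1 !₂[1, 0, 0] where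
  inner_act_M₂_hat v := by simp [act_M₂, hat, PiLp.inner_apply, Fin.sum_univ_succ]
  dissipative u v := by
    simp [act_M₁, act_M₂, PiLp.inner_apply, Fin.sum_univ_succ]
    nlinarith [sq_nonneg (u 0), sq_nonneg (v 0)]
  norm_le := by
    rw [EuclideanSpace.norm_eq]; refine Real.sqrt_le_iff.2 ⟨by norm_num, ?_⟩
    simp [Fin.sum_univ_succ]
  norm_hat_le := by
    rw [EuclideanSpace.norm_eq]; refine Real.sqrt_le_iff.2 ⟨by norm_num, ?_⟩
    simp [hat, Fin.sum_univ_succ]; norm_num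
  norm_M₁_le := by
    rw [EuclideanSpace.norm_eq]; refine Real.sqrt_le_iff.2 ⟨by norm_num, ?_⟩
    simp [act_M₁, Fin.sum_univ_succ]
  norm_M₂_le := by
    rw [EuclideanSpace.norm_eq]; refine Real.sqrt_le_iff.2 ⟨by norm_num, ?_⟩
    simp [act_M₂, Fin.sum_univ_succ]

/-- With U and V the components of u and v along n, the dissipation form is exactly (U + s V)², the
square of the transport operator. -/
lemma isCharacteristic_transverse {s : ℝ} (hs : s = 1 ∨ s = -1) :
    IsCharacteristic s !₂[0, 1, s] where
  inner_act_M₂_hat v := by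
    rcases hs with rfl | rfl <;> simp [act_M₂, hat, PiLp.inner_apply, Fin.sum_univ_succ]; ring
  dissipative u v := by
    have h : ∀ c : ℝ, c = (u 1 + s * u 2 + s * (v 1 + s * v 2)) ^ 2 → 0 ≤ c := fun c hc =>
      hc ▸ sq_nonneg _
    refine h _ ?_
    rcases hs with rfl | rfl <;>
      simp [act_M₁, act_M₂, PiLp.inner_apply, Fin.sum_univ_succ] <;> ring
  norm_le := by
    rw [EuclideanSpace.norm_eq]; refine Real.sqrt_le_iff.2 ⟨by norm_num, ?_⟩
    rcases hs with rfl | rfl <;> simp [Fin.sum_univ_succ] <;> norm_num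
  norm_hat_le := by
    rw [EuclideanSpace.norm_eq]; refine Real.sqrt_le_iff.2 ⟨by norm_num, ?_⟩
    rcases hs with rfl | rfl <;> simp [hat, Fin.sum_univ_succ] <;> norm_num
  norm_M₁_le := by
    rw [EuclideanSpace.norm_eq]; refine Real.sqrt_le_iff.2 ⟨by norm_num, ?_⟩
    rcases hs with rfl | rfl <;> simp [act_M₁, Fin.sum_univ_succ] <;> norm_num
  norm_M₂_le := by
    rw [EuclideanSpace.norm_eq]; refine Real.sqrt_le_iff.2 ⟨by norm_num, ?_⟩
    rcases hs with rfl | rfl <;> simp [act_M₂, Fin.sum_univ_succ] <;> norm_num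

/-- The three directions are orthogonal with squared lengths 1, 2, 2. -/
lemma inner_eq_characteristic_sum (u v : Vec 3) :
    inner ℝ u v = inner ℝ u !₂[1, 0, 0] * inner ℝ v !₂[1, 0, 0]
      + 1 / 2 * (inner ℝ u !₂[0, 1, 1] * inner ℝ v !₂[0, 1, 1])
      + 1 / 2 * (inner ℝ u !₂[0, 1, -1] * inner ℝ v !₂[0, 1, -1]) := by
  simp [PiLp.inner_apply, Fin.sum_univ_succ]; ring

lemma abs_inner_le_two_mul_norm {d : ℕ} (u v : Vec d) (hv : ‖v‖ ≤ 2) : |inner ℝ u v| ≤ 2 * ‖u‖ :=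
  (abs_real_inner_le_norm u v).trans (by nlinarith [norm_nonneg u])

end Characteristics

/-! ### Scalar components of finite element functions and their derivatives. -/

section Components

variable {T a b : ℝ} {𝒯 : Mesh T a b} {m : Fin 𝒯.M} {k : ℕ} {g : Fin 𝒯.M → ℝ → ℝ → Vec 3}

lemma Mesh.isScalarFE_inner (hg : g ∈ 𝒯.feSpace k) (m : Fin 𝒯.M) (n : Vec 3) :
    𝒯.IsScalarFE m k fun t y => inner ℝ (g m t y) n := by
  refine ⟨fun j => ?_, fun t ht => ?_⟩
  · obtain ⟨c, hc⟩ := (hg m).1 j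
    refine ⟨_, ⟨fun i l => inner ℝ (c i l) n, fun t y => rfl⟩, fun t ht y hy => ?_⟩
    simp only [hc t ht y hy]
    simp only [sum_inner, real_inner_smul_left]
  · simp [(hg m).2 t ht]

/-- Jumps between slabs are allowed, so a test function may vanish on all slabs but one; this
localises the scheme. -/
lemma Mesh.smul_mem_feSpace {u : ℝ → ℝ → ℝ} (hu : 𝒯.IsScalarFE m k u) (n : Vec 3) :
    (fun m' t y => if m' = m then u t y • n else 0) ∈ 𝒯.feSpace k := by
  intro m'
  by_cases hm : m' = m
  · subst hm
    simp only [if_true]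
    refine ⟨fun j => ?_, fun t ht => by simp [hu.2 t ht]⟩
    obtain ⟨F, ⟨c, hc⟩, hF⟩ := hu.1 j
    refine ⟨fun i l => c i l • n, fun t ht y hy => ?_⟩
    rw [hF t ht y hy, hc]
    simp only [Finset.sum_smul, smul_smul]
  · simp only [if_neg hm]
    exact ⟨fun j => ⟨0, by simp⟩, by simp⟩

lemma differentiableAt_of_inner {f : ℝ → Vec 3} {t : ℝ}
    (h : ∀ n : Vec 3, DifferentiableAt ℝ (fun s => inner ℝ (f s) n) t) :
    DifferentiableAt ℝ f t := by
  rw [differentiableAt_euclidean]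
  intro i
  have := h (EuclideanSpace.single i 1)
  simpa [EuclideanSpace.inner_single_right] using this

lemma deriv_inner_const {f : ℝ → Vec 3} {t : ℝ} (h : DifferentiableAt ℝ f t) (n : Vec 3) :
    deriv (fun s => inner ℝ (f s) n) t = inner ℝ (deriv f t) n := by
  have := (h.hasDerivAt.inner ℝ (hasDerivAt_const t n)).deriv
  simpa using this

lemma Mesh.pdt_inner (hg : g ∈ 𝒯.feSpace k) {j : Fin 𝒯.N} {z : ℝ × ℝ} (hz : z ∈ 𝒯.elem m j)
    (n : Vec 3) : pdt (fun t y => inner ℝ (g m t y) n) z.1 z.2 = inner ℝ (dt (g m) z.1 z.2) n :=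
  deriv_inner_const (differentiableAt_of_inner fun n =>
    ((𝒯.isScalarFE_inner hg m n).piecewiseC1.hasDerivAt_t hz).differentiableAt) n

lemma Mesh.pdx_inner (hg : g ∈ 𝒯.feSpace k) {j : Fin 𝒯.N} {z : ℝ × ℝ} (hz : z ∈ 𝒯.elem m j)
    (n : Vec 3) : pdx (fun t y => inner ℝ (g m t y) n) z.1 z.2 = inner ℝ (dx (g m) z.1 z.2) n :=
  deriv_inner_const (differentiableAt_of_inner fun n =>
    ((𝒯.isScalarFE_inner hg m n).piecewiseC1.hasDerivAt_x hz).differentiableAt) n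

lemma memLp_of_inner {α : Type*} [MeasurableSpace α] {μ : Measure α} {d : ℕ} {f : α → Vec d}
    {p : ℝ≥0∞} (h : ∀ n : Vec d, MemLp (fun z => inner ℝ (f z) n) p μ) : MemLp f p μ := by
  refine MemLp.of_eval_piLp fun i => ?_
  have := h (EuclideanSpace.single i 1)
  simpa [EuclideanSpace.inner_single_right] using this

lemma Mesh.memLp_dt (hg : g ∈ 𝒯.feSpace k) (m : Fin 𝒯.M) :
    MemLp (fun z : ℝ × ℝ => dt (g m) z.1 z.2) 2 (volume.restrict (𝒯.slab m)) := by
  refine memLp_of_inner fun n => ?_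
  refine ((𝒯.isScalarFE_inner hg m n).piecewiseC1.piecewiseContinuous_pdt.memLp 2).ae_eq ?_
  filter_upwards [𝒯.ae_exists_elem m] with z ⟨j, hj⟩ using 𝒯.pdt_inner hg hj n

lemma Mesh.memLp_dx (hg : g ∈ 𝒯.feSpace k) (m : Fin 𝒯.M) :
    MemLp (fun z : ℝ × ℝ => dx (g m) z.1 z.2) 2 (volume.restrict (𝒯.slab m)) := by
  refine memLp_of_inner fun n => ?_
  refine ((𝒯.isScalarFE_inner hg m n).piecewiseC1.piecewiseContinuous_pdx.memLp 2).ae_eq ?_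
  filter_upwards [𝒯.ae_exists_elem m] with z ⟨j, hj⟩ using 𝒯.pdx_inner hg hj n

lemma _root_.MeasureTheory.MemLp.act {α : Type*} [MeasurableSpace α] {μ : Measure α}
    {f : α → Vec 3} {p : ℝ≥0∞} (hf : MemLp f p μ) (A : Matrix (Fin 4) (Fin 3) ℝ) :
    MemLp (fun z => act A (f z)) p μ := by
  refine MemLp.of_eval_piLp fun i => ?_
  have : ∀ z, VlasovMaxwell.act A (f z) i = inner ℝ (f z) (WithLp.toLp 2 (A i)) := fun z => by
    simp [VlasovMaxwell.act, Matrix.mulVec, dotProduct, PiLp.inner_apply]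
  simp only [this]
  exact hf.inner_const _

lemma Mesh.memLp_maxwellOp (hg : g ∈ 𝒯.feSpace k) (m : Fin 𝒯.M) :
    MemLp (maxwellOp (g m)) 2 (volume.restrict (𝒯.slab m)) :=
  ((𝒯.memLp_dt hg m).act M₁).add ((𝒯.memLp_dx hg m).act M₂)

lemma Mesh.maxwellOp_smul {u : ℝ → ℝ → ℝ} (hu : 𝒯.PiecewiseC1 m u) (n : Vec 3) {j : Fin 𝒯.N}
    {z : ℝ × ℝ} (hz : z ∈ 𝒯.elem m j) : maxwellOp (fun t y => u t y • n) z =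
      pdt u z.1 z.2 • act M₁ n + pdx u z.1 z.2 • act M₂ n := by
  unfold maxwellOp dt dx
  rw [((hu.hasDerivAt_t hz).smul_const n).deriv, ((hu.hasDerivAt_x hz).smul_const n).deriv,
    act_smul, act_smul]

end Components


/-! ### The scalar scheme satisfied by a characteristic component. -/

section Orthogonality

variable {T a b : ℝ} {𝒯 : Mesh T a b} {k : ℕ} {δ s : ℝ} {F : ℝ × ℝ → Vec 4}
  {W0 : ℝ → Vec 3} {Wh : Fin 𝒯.M → ℝ → ℝ → Vec 3} {n : Vec 3}

lemma Mesh.slab_subset_cylinder (𝒯 : Mesh T a b) (m : Fin 𝒯.M) : 𝒯.slab m ⊆ cylinder T a b :=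
  prod_mono (fun _ ht => ⟨(𝒯.t_nonneg _).trans ht.1.le, ht.2.trans (𝒯.t_le _)⟩) Subset.rfl

/-- The residual of the Maxwell system on a slab. -/
noncomputable def Mesh.slabResidual (𝒯 : Mesh T a b) (F : ℝ × ℝ → Vec 4)
    (Wh : Fin 𝒯.M → ℝ → ℝ → Vec 3) (m : Fin 𝒯.M) (z : ℝ × ℝ) : Vec 4 :=
  F z - maxwellOp (Wh m) z

lemma Mesh.memLp_slabResidual (hF : MemLp F 2 (volume.restrict (cylinder T a b)))
    (hWh : Wh ∈ 𝒯.feSpace k) (m : Fin 𝒯.M) :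
    MemLp (𝒯.slabResidual F Wh m) 2 (volume.restrict (𝒯.slab m)) :=
  (hF.mono_measure (Measure.restrict_mono (𝒯.slab_subset_cylinder m) le_rfl)).sub
    (𝒯.memLp_maxwellOp hWh m)

lemma Mesh.trace_inner (𝒯 : Mesh T a b) (W0 : ℝ → Vec 3) (Wh : Fin 𝒯.M → ℝ → ℝ → Vec 3)
    (n : Vec 3) (i : Fin (𝒯.M + 1)) (y : ℝ) :
    𝒯.trace (fun y => inner ℝ (W0 y) n) (fun m t y => inner ℝ (Wh m t y) n) i y =
      inner ℝ (𝒯.minus W0 Wh i y) n := by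
  cases i using Fin.cases <;> rfl

lemma Mesh.memLp_minus (hab : a < b) (hW0 : MemLp W0 2 (volume.restrict (Ioo a b)))
    (hWh : Wh ∈ 𝒯.feSpace k) (i : Fin (𝒯.M + 1)) :
    MemLp (𝒯.minus W0 Wh i) 2 (volume.restrict (Ioo a b)) := by
  cases i using Fin.cases with
  | zero => exact hW0
  | succ m =>
    exact memLp_of_inner fun n => (𝒯.isScalarFE_inner hWh m n).piecewiseC1.memLp_slice hab
      (right_mem_Icc.2 (𝒯.t_lt m).le) 2

lemma Mesh.memLp_plus (hab : a < b) (hWh : Wh ∈ 𝒯.feSpace k) (m : Fin 𝒯.M) :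
    MemLp (𝒯.plus Wh m) 2 (volume.restrict (Ioo a b)) :=
  memLp_of_inner fun n => (𝒯.isScalarFE_inner hWh m n).piecewiseC1.memLp_slice hab
    (left_mem_Icc.2 (𝒯.t_lt m).le) 2

lemma Mesh.integrable_inner_test {V : ℝ × ℝ → Vec 4} {m : Fin 𝒯.M}
    (hV : MemLp V 2 (volume.restrict (𝒯.slab m))) {u : ℝ → ℝ → ℝ} (hu : 𝒯.PiecewiseC1 m u)
    (δ : ℝ) (n : Vec 3) :
    Integrable (fun z => inner ℝ (V z) (hat n) * u z.1 z.2
      + δ * (inner ℝ (V z) (act M₁ n) * pdt u z.1 z.2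
        + inner ℝ (V z) (act M₂ n) * pdx u z.1 z.2)) (volume.restrict (𝒯.slab m)) :=
  ((hV.inner_const _).integrable_mul_fun (hu.piecewiseContinuous.memLp 2)).add
    ((((hV.inner_const _).integrable_mul_fun (hu.piecewiseContinuous_pdt.memLp 2)).add
      ((hV.inner_const _).integrable_mul_fun (hu.piecewiseContinuous_pdx.memLp 2))).const_mul δ)

lemma Mesh.integral_inner_test (V : ℝ × ℝ → Vec 4) {m : Fin 𝒯.M} {u : ℝ → ℝ → ℝ}
    (hu : 𝒯.PiecewiseC1 m u) (δ : ℝ) (n : Vec 3) :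
    ∫ z in 𝒯.slab m, inner ℝ (V z) (hat (u z.1 z.2 • n)
      + δ • maxwellOp (fun t y => u t y • n) z) =
    ∫ z in 𝒯.slab m, (inner ℝ (V z) (hat n) * u z.1 z.2
      + δ * (inner ℝ (V z) (act M₁ n) * pdt u z.1 z.2
        + inner ℝ (V z) (act M₂ n) * pdx u z.1 z.2)) := by
  refine integral_congr_ae ?_
  filter_upwards [𝒯.ae_exists_elem m] with z ⟨j, hj⟩
  rw [𝒯.maxwellOp_smul hu n hj, hat_smul]
  simp only [inner_add_right, real_inner_smul_right]
  ring

/-- Galerkin orthogonality of a component of a streamline diffusion solution. -/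
lemma Mesh.IsSDSolution.orthogonality (H : 𝒯.IsSDSolution k δ F W0 Wh) (hab : a < b)
    (hF : MemLp F 2 (volume.restrict (cylinder T a b)))
    (hW0 : MemLp W0 2 (volume.restrict (Ioo a b))) (n : Vec 3) (m : Fin 𝒯.M) {u : ℝ → ℝ → ℝ}
    (hu : 𝒯.IsScalarFE m k u) :
    ∫ z in 𝒯.slab m, (inner ℝ (𝒯.slabResidual F Wh m z) (hat n) * u z.1 z.2
      + δ * (inner ℝ (𝒯.slabResidual F Wh m z) (act M₁ n) * pdt u z.1 z.2
        + inner ℝ (𝒯.slabResidual F Wh m z) (act M₂ n) * pdx u z.1 z.2)) =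
    ∫ y in Ioo a b, (inner ℝ (𝒯.plus Wh m y) n - inner ℝ (𝒯.minus W0 Wh m.castSucc y) n)
      * u (𝒯.t m.castSucc) y := by
  have hc := hu.piecewiseC1
  have key := H.2 m _ (𝒯.smul_mem_feSpace hu n)
  have hF' := hF.mono_measure (Measure.restrict_mono (𝒯.slab_subset_cylinder m) le_rfl)
  simp only [if_true, Mesh.plus, 𝒯.integral_inner_test _ hc, real_inner_smul_right] at key
  have hs : MemLp (u (𝒯.t m.castSucc)) 2 (volume.restrict (Ioo a b)) :=
    hc.memLp_slice hab (left_mem_Icc.2 (𝒯.t_lt m).le) 2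
  have e1 := integral_sub (𝒯.integrable_inner_test hF' hc δ n)
    (𝒯.integrable_inner_test (𝒯.memLp_maxwellOp H.1 m) hc δ n)
  have e2 := integral_sub
    (hs.integrable_mul_fun ((𝒯.memLp_plus hab H.1 m).inner_const n))
    (hs.integrable_mul_fun ((𝒯.memLp_minus hab hW0 H.1 m.castSucc).inner_const n))
  have e3 : ∀ z, inner ℝ (𝒯.slabResidual F Wh m z) (hat n) * u z.1 z.2
      + δ * (inner ℝ (𝒯.slabResidual F Wh m z) (act M₁ n) * pdt u z.1 z.2
        + inner ℝ (𝒯.slabResidual F Wh m z) (act M₂ n) * pdx u z.1 z.2) =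
      (inner ℝ (F z) (hat n) * u z.1 z.2 + δ * (inner ℝ (F z) (act M₁ n) * pdt u z.1 z.2
        + inner ℝ (F z) (act M₂ n) * pdx u z.1 z.2))
      - (inner ℝ (maxwellOp (Wh m) z) (hat n) * u z.1 z.2
        + δ * (inner ℝ (maxwellOp (Wh m) z) (act M₁ n) * pdt u z.1 z.2
        + inner ℝ (maxwellOp (Wh m) z) (act M₂ n) * pdx u z.1 z.2)) := fun z => by
    simp only [Mesh.slabResidual, inner_sub_left]; ring
  have e4 : ∀ y, (inner ℝ (𝒯.plus Wh m y) n - inner ℝ (𝒯.minus W0 Wh m.castSucc y) n)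
      * u (𝒯.t m.castSucc) y = u (𝒯.t m.castSucc) y * inner ℝ (𝒯.plus Wh m y) n
        - u (𝒯.t m.castSucc) y * inner ℝ (𝒯.minus W0 Wh m.castSucc y) n := fun y => by ring
  simp only [e3, e4]
  rw [e1, e2]
  simp only [Mesh.plus] at *
  linarith

lemma Mesh.IsSDSolution.isScalarSD (H : 𝒯.IsSDSolution k δ F W0 Wh) (hab : a < b)
    (hF : MemLp F 2 (volume.restrict (cylinder T a b)))
    (hW0 : MemLp W0 2 (volume.restrict (Ioo a b))) (hn : IsCharacteristic s n) (m : Fin 𝒯.M) :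
    𝒯.IsScalarSD m k δ (fun t y => inner ℝ (Wh m t y) n)
      (fun z => inner ℝ (𝒯.slabResidual F Wh m z) (hat n))
      (fun z => inner ℝ (𝒯.slabResidual F Wh m z) (act M₁ n))
      (fun z => inner ℝ (𝒯.slabResidual F Wh m z) (act M₂ n))
      (fun z => ‖𝒯.slabResidual F Wh m z‖)
      (𝒯.trace (fun y => inner ℝ (W0 y) n) (fun m t y => inner ℝ (Wh m t y) n) m.castSucc) where
  fe := 𝒯.isScalarFE_inner H.1 m n
  memLp_re := (𝒯.memLp_slabResidual hF H.1 m).inner_const _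
  memLp_rp := (𝒯.memLp_slabResidual hF H.1 m).inner_const _
  memLp_rq := (𝒯.memLp_slabResidual hF H.1 m).inner_const _
  memLp_ρ := (𝒯.memLp_slabResidual hF H.1 m).norm
  memLp_wm := by
    simp only [funext (𝒯.trace_inner W0 Wh n m.castSucc)]
    exact (𝒯.memLp_minus hab hW0 H.1 _).inner_const n
  re_le z := abs_inner_le_two_mul_norm _ _ hn.norm_hat_le
  rp_le z := abs_inner_le_two_mul_norm _ _ hn.norm_M₁_le
  rq_le z := abs_inner_le_two_mul_norm _ _ hn.norm_M₂_le
  orth u hu := by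
    simp only [𝒯.trace_inner]
    exact H.orthogonality hab hF hW0 n m hu

end Orthogonality

/-! ### Vanishing of the source outside the support of the exact solution. -/

section WeakEquation

variable {T a b : ℝ} {F : ℝ × ℝ → Vec 4} {W0 : ℝ → Vec 3} {W : ℝ → ℝ → Vec 3} {K : Set ℝ}

lemma deriv_eq_zero_of_notMem_tsupport {ψ : ℝ × ℝ → Vec 4} {p : ℝ × ℝ} (hp : p ∉ tsupport ψ) :
    deriv (fun s => ψ (s, p.2)) p.1 = 0 ∧ deriv (fun y => ψ (p.1, y)) p.2 = 0 := by
  have h : ψ =ᶠ[𝓝 (p.1, p.2)] 0 := notMem_tsupport_iff_eventuallyEq.1 hp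
  have h1 : (fun s => ψ (s, p.2)) =ᶠ[𝓝 p.1] fun _ => 0 :=
    (Continuous.tendsto (by fun_prop : Continuous fun s : ℝ => (s, p.2)) p.1).eventually h
  have h2 : (fun y => ψ (p.1, y)) =ᶠ[𝓝 p.2] fun _ => 0 :=
    (Continuous.tendsto (by fun_prop : Continuous fun y : ℝ => (p.1, y)) p.2).eventually h
  rw [h1.deriv_eq, h2.deriv_eq]
  simp

lemma measurableSet_cylinder : MeasurableSet (cylinder T a b) :=
  measurableSet_Icc.prod measurableSet_Ioo

instance isFiniteMeasure_cylinder : IsFiniteMeasure (volume.restrict (cylinder T a b)) := by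
  unfold cylinder
  rw [Measure.volume_eq_prod, ← Measure.prod_restrict]
  infer_instance

/-- The source vanishes wherever the exact solution does. -/
lemma IsMaxwellSolution.ae_source_eq_zero (H : IsMaxwellSolution T a b F W0 W) (hT : 0 < T)
    (hF : MemLp F 2 (volume.restrict (cylinder T a b))) (hK : IsClosed K)
    (hW : ∀ t ∈ Icc 0 T, Function.support (W t) ⊆ K) :
    ∀ᵐ z : ℝ × ℝ, z ∈ Ioo 0 T ×ˢ (Ioo a b \ K) → F z = 0 := by
  set U : Set (ℝ × ℝ) := Ioo 0 T ×ˢ (Ioo a b \ K) with hU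
  have hUo : IsOpen U := isOpen_Ioo.prod (isOpen_Ioo.sdiff hK)
  have hUc : U ⊆ cylinder T a b := prod_mono Ioo_subset_Icc_self sdiff_subset
  have hcomp : ∀ i : Fin 4, ∀ᵐ z : ℝ × ℝ, z ∈ U → F z i = 0 := by
    intro i
    refine hUo.ae_eq_zero_of_integral_contDiff_smul_eq_zero ?_ fun g hg hgc hgU => ?_
    · refine IntegrableOn.locallyIntegrableOn ?_
      exact IntegrableOn.mono_set ((hF.eval_piLp i).integrable (by norm_num)) hUc
    -- A test function in each coordinate direction, supported in the open set where W = 0. Every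
    -- term with W drops out of the weak equation, so all four components of the source vanish
    -- there, as the dissipation argument requires.
    · set ψ : ℝ × ℝ → Vec 4 := fun p => g p • EuclideanSpace.single i 1 with hψ
      have hψs : tsupport ψ ⊆ tsupport g := closure_mono fun p hp hg0 => hp (by simp [hψ, hg0])
      have hψ0 : ∀ p, p ∉ U → ψ p = 0 := fun p hp =>
        image_eq_zero_of_notMem_tsupport fun h => hp (hgU (hψs h))
      have key := H.equation ψ (hg.smul contDiff_const) (hgc.smul_right)
        (fun p hp => ⟨mem_univ _, (hgU (hψs hp)).2.1⟩) T ⟨hT.le, le_rfl⟩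
      have z1 : ∀ x, ψ (T, x) = 0 := fun x => hψ0 _ fun h => lt_irrefl _ h.1.2
      have z2 : ∀ x, ψ (0, x) = 0 := fun x => hψ0 _ fun h => lt_irrefl _ h.1.1
      have z3 : ∫ p in cylinder T a b,
          (inner ℝ (act M₁ (W p.1 p.2)) (deriv (fun s => ψ (s, p.2)) p.1)
            + inner ℝ (act M₂ (W p.1 p.2)) (deriv (fun y => ψ (p.1, y)) p.2)) = 0 := by
        refine setIntegral_eq_zero_of_forall_eq_zero fun p hp => ?_
        by_cases hpU : p ∈ tsupport ψ
        · have : W p.1 p.2 = 0 := by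
            by_contra h
            exact (hgU (hψs hpU)).2.2 (hW p.1 hp.1 h)
          rw [this, act_zero, act_zero, inner_zero_left, inner_zero_left, add_zero]
        · obtain ⟨h1, h2⟩ := deriv_eq_zero_of_notMem_tsupport hpU
          rw [h1, h2, inner_zero_right, inner_zero_right, add_zero]
      simp only [z1, z2, z3, inner_zero_right, integral_zero, sub_zero] at key
      have e1 : ∀ p, inner ℝ (F p) (ψ p) = g p • F p i := fun p => by
        simp [hψ, real_inner_smul_right, EuclideanSpace.inner_single_right]
      simp only [e1] at key
      rw [key, setIntegral_eq_integral_of_forall_compl_eq_zero]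
      intro p hp
      rw [image_eq_zero_of_notMem_tsupport fun h => hp (hUc (hgU h)), zero_smul]
  filter_upwards [ae_all_iff.2 hcomp] with z hz hzU
  ext i
  exact hz i hzU

end WeakEquation


/-! ### Testing the weak equation with the transported test function. -/

section WeakDuality

variable {T a b : ℝ} {F : ℝ × ℝ → Vec 4} {W0 : ℝ → Vec 3} {W : ℝ → ℝ → Vec 3} {K : Set ℝ}

lemma ae_cylinder_of_ae_interior {P : ℝ × ℝ → Prop}
    (h : ∀ᵐ z : ℝ × ℝ, z ∈ Ioo 0 T ×ˢ Ioo a b → P z) :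
    ∀ᵐ z ∂(volume.restrict (cylinder T a b)), P z := by
  rw [ae_restrict_iff' measurableSet_cylinder]
  have h2 : ∀ᵐ p : ℝ × ℝ, p.1 ∉ ({0, T} : Set ℝ) :=
    Measure.quasiMeasurePreserving_fst.ae ((toFinite ({0, T} : Set ℝ)).countable.ae_notMem volume)
  filter_upwards [h, h2] with z hz h2 hzc
  simp only [mem_insert_iff, mem_singleton_iff, not_or] at h2
  exact hz ⟨⟨lt_of_le_of_ne hzc.1.1 (Ne.symm h2.1), lt_of_le_of_ne hzc.1.2 h2.2⟩, hzc.2⟩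

lemma IsMaxwellSolution.ae_source_eq_zero_cylinder (H : IsMaxwellSolution T a b F W0 W)
    (hT : 0 < T) (hF : MemLp F 2 (volume.restrict (cylinder T a b))) (hK : IsClosed K)
    (hW : ∀ t ∈ Icc 0 T, Function.support (W t) ⊆ K) :
    ∀ᵐ z ∂(volume.restrict (cylinder T a b)), z.2 ∉ K → F z = 0 := by
  refine ae_cylinder_of_ae_interior ?_
  filter_upwards [H.ae_source_eq_zero hT hF hK hW] with z hz hzi hzK
  exact hz ⟨hzi.1, hzi.2, hzK⟩

lemma IsMaxwellSolution.ae_initial_eq_zero (H : IsMaxwellSolution T a b F W0 W) (hT : 0 < T)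
    (hW : ∀ t ∈ Icc 0 T, Function.support (W t) ⊆ K) :
    ∀ᵐ y ∂(volume.restrict (Ioo a b)), y ∉ K → W0 y = 0 := by
  filter_upwards [H.initial] with y hy hyK
  rw [← hy]
  by_contra h
  exact hyK (hW 0 ⟨le_rfl, hT.le⟩ h)

lemma exists_bump (c : ℝ) {r R : ℝ} (hr : 0 < r) (hrR : r < R) :
    ∃ ζ : ℝ → ℝ, ContDiff ℝ ∞ ζ ∧ HasCompactSupport ζ ∧ tsupport ζ ⊆ Icc (c - R) (c + R) ∧
      ∀ y ∈ Icc (c - r) (c + r), ζ y = 1 := by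
  let f : ContDiffBump c := ⟨r, R, hr, hrR⟩
  refine ⟨f, f.contDiff, f.hasCompactSupport, ?_, fun y hy => ?_⟩
  · rw [f.tsupport_eq, Real.closedBall_eq_Icc]
  · exact f.one_of_mem_closedBall (by rwa [Real.closedBall_eq_Icc])

/-- A component of the exact solution is transported along its characteristic. -/
lemma IsMaxwellSolution.duality (H : IsMaxwellSolution T a b F W0 W) (hT : 0 < T)
    (hF : MemLp F 2 (volume.restrict (cylinder T a b))) (hK : IsClosed K)
    (hW : ∀ t ∈ Icc 0 T, Function.support (W t) ⊆ K) {d : ℝ} (hd : 0 < d) (hdab : a + d < b)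
    (hKd : K ⊆ Icc (a + d) (b - d)) {s : ℝ} {n : Vec 3} (hn : IsCharacteristic s n) {χ : ℝ → ℝ}
    (hχ : IsTest a b χ) :
    (∫ y in Ioo a b, inner ℝ (W T y) n * χ y) - (∫ y in Ioo a b, inner ℝ (W0 y) n * χ (y + s * T))
      = ∫ p in cylinder T a b, inner ℝ (F p) (hat n) * χ (p.2 + s * (T - p.1)) := by
  -- The transported function is not compactly supported in the strip. The cutoffs equal 1 on [-T/2,
  -- 3T/2] and on [a + d/2, b - d/2], neighbourhoods of [0, T] and of `K`, so neither they nor their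
  -- derivatives are noticed where W is nonzero.
  obtain ⟨θ, hθ, hθc, -, hθ1⟩ := exists_bump (T / 2) hT (by linarith : T < 2 * T)
  obtain ⟨ζ, hζ, hζc, hζs, hζ1⟩ := exists_bump ((a + b) / 2)
    (by linarith : 0 < (b - a) / 2 - d / 2)
    (by linarith : (b - a) / 2 - d / 2 < (b - a) / 2 - d / 4)
  set u : ℝ × ℝ → ℝ := fun p => χ (p.2 + s * (T - p.1)) with hu
  set ψ : ℝ × ℝ → Vec 4 := fun p => (θ p.1 * ζ p.2 * u p) • hat n with hψ
  have huc : ContDiff ℝ ∞ u :=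
    hχ.contDiff.comp (by fun_prop : ContDiff ℝ ∞ fun p : ℝ × ℝ => p.2 + s * (T - p.1))
  have hψc : ContDiff ℝ ∞ ψ :=
    (((hθ.comp contDiff_fst).mul (hζ.comp contDiff_snd)).mul huc).smul contDiff_const
  have hsub : Function.support ψ ⊆ tsupport θ ×ˢ tsupport ζ := fun p hp => by
    refine ⟨subset_tsupport _ fun h => hp ?_, subset_tsupport _ fun h => hp ?_⟩ <;> simp [hψ, h]
  have hts : tsupport ψ ⊆ tsupport θ ×ˢ tsupport ζ :=
    closure_minimal hsub ((isClosed_tsupport _).prod (isClosed_tsupport _))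
  have key := H.equation ψ hψc
    (HasCompactSupport.of_support_subset_isCompact (hθc.isCompact.prod hζc.isCompact) hsub)
    (fun p hp => ⟨mem_univ _, by
      have := hζs (hts hp).2
      exact ⟨by linarith [this.1], by linarith [this.2]⟩⟩) T ⟨hT.le, le_rfl⟩
  have hθI : ∀ t ∈ Icc 0 T, θ t = 1 := fun t ht => hθ1 t ⟨by linarith [ht.1], by linarith [ht.2]⟩
  have hζK : ∀ y ∈ K, ζ y = 1 := fun y hy => by
    have := hKd hy
    exact hζ1 y ⟨by linarith [this.1], by linarith [this.2]⟩
  have e1 : ∀ y, inner ℝ (act M₁ (W T y)) (ψ (T, y)) = inner ℝ (W T y) n * χ y := fun y => by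
    by_cases hy : y ∈ K
    · simp [hψ, hu, hζK y hy, hθI T ⟨hT.le, le_rfl⟩, real_inner_smul_right, inner_act_M₁_hat,
        mul_comm]
    · have : W T y = 0 := by
        by_contra h
        exact hy (hW T ⟨hT.le, le_rfl⟩ h)
      simp [this, act_zero]
  have e2 : ∫ y in Ioo a b, inner ℝ (act M₁ (W0 y)) (ψ (0, y)) =
      ∫ y in Ioo a b, inner ℝ (W0 y) n * χ (y + s * T) := by
    refine integral_congr_ae ?_
    filter_upwards [H.ae_initial_eq_zero hT hW] with y hy0
    by_cases hy : y ∈ K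
    · simp [hψ, hu, hζK y hy, hθI 0 ⟨le_rfl, hT.le⟩, real_inner_smul_right, inner_act_M₁_hat,
        mul_comm]
    · simp [hy0 hy, act_zero]
  -- At points of `K` the two terms are -s χ' (W, n) and χ' s (W, n), by the characteristic property
  -- of n; elsewhere W = 0.
  have e3 : ∫ p in cylinder T a b,
      (inner ℝ (act M₁ (W p.1 p.2)) (deriv (fun r => ψ (r, p.2)) p.1)
        + inner ℝ (act M₂ (W p.1 p.2)) (deriv (fun y => ψ (p.1, y)) p.2)) = 0 := by
    refine setIntegral_eq_zero_of_forall_eq_zero fun p hp => ?_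
    by_cases hpK : p.2 ∈ K
    · have hKp := hKd hpK
      have h1 : (fun r => ψ (r, p.2)) =ᶠ[𝓝 p.1] fun r => χ (p.2 + s * (T - r)) • hat n := by
        filter_upwards [Ioo_mem_nhds (by linarith [hp.1.1] : T / 2 - T < p.1)
          (by linarith [hp.1.2] : p.1 < T / 2 + T)] with r hr
        simp [hψ, hu, hθ1 r (Ioo_subset_Icc_self hr), hζK _ hpK]
      have h2 : (fun y => ψ (p.1, y)) =ᶠ[𝓝 p.2] fun y => χ (y + s * (T - p.1)) • hat n := by
        filter_upwards [Ioo_mem_nhds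
          (by linarith [hKp.1] : (a + b) / 2 - ((b - a) / 2 - d / 2) < p.2)
          (by linarith [hKp.2] : p.2 < (a + b) / 2 + ((b - a) / 2 - d / 2))] with y hy
        simp [hψ, hu, hζ1 y (Ioo_subset_Icc_self hy), hθI _ hp.1]
      have d1 : HasDerivAt (fun r => χ (p.2 + s * (T - r)))
          (deriv χ (p.2 + s * (T - p.1)) * (s * -1)) p.1 :=
        (hχ.hasDerivAt _).comp p.1 ((((hasDerivAt_id p.1).const_sub T).const_mul s).const_add p.2)
      have d2 : HasDerivAt (fun y => χ (y + s * (T - p.1)))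
          (deriv χ (p.2 + s * (T - p.1)) * 1) p.2 :=
        (hχ.hasDerivAt _).comp p.2 ((hasDerivAt_id p.2).add_const _)
      rw [h1.deriv_eq, h2.deriv_eq, (d1.smul_const _).deriv, (d2.smul_const _).deriv,
        real_inner_smul_right, real_inner_smul_right, inner_act_M₁_hat, hn.inner_act_M₂_hat]
      ring
    · have : W p.1 p.2 = 0 := by
        by_contra h
        exact hpK (hW p.1 hp.1 h)
      rw [this, act_zero, act_zero, inner_zero_left, inner_zero_left, add_zero]
  have e4 : ∫ p in cylinder T a b, inner ℝ (F p) (ψ p) =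
      ∫ p in cylinder T a b, inner ℝ (F p) (hat n) * χ (p.2 + s * (T - p.1)) := by
    refine integral_congr_ae ?_
    filter_upwards [H.ae_source_eq_zero_cylinder hT hF hK hW,
      ae_restrict_mem measurableSet_cylinder] with p hp0 hpc
    by_cases hpK : p.2 ∈ K
    · simp [hψ, hu, hζK _ hpK, hθI _ hpc.1, real_inner_smul_right, mul_comm]
    · simp [hp0 hpK]
  simp only [e1] at key
  rw [e2, e3, e4, sub_zero] at key
  exact key

end WeakDuality

/-! ### Splitting the cylinder into slabs. -/

section Slabs

variable {T a b : ℝ}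

lemma Mesh.pairwise_disjoint_slab (𝒯 : Mesh T a b) :
    Pairwise (Function.onFun Disjoint 𝒯.slab) := fun _ _ hij =>
  Set.disjoint_prod.2 (Or.inl (disjoint_Ioc_nodes 𝒯.t_strictMono hij))

lemma Mesh.iUnion_slab_ae_eq (𝒯 : Mesh T a b) : cylinder T a b =ᵐ[volume] ⋃ m, 𝒯.slab m := by
  have h2 : ∀ᵐ p : ℝ × ℝ, p.1 ∉ ({0} : Set ℝ) :=
    Measure.quasiMeasurePreserving_fst.ae ((countable_singleton _).ae_notMem volume)
  filter_upwards [h2] with p hp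
  refine propext ⟨fun h => ?_, fun h => ?_⟩
  · obtain ⟨m, hm⟩ := 𝒯.exists_t_mem ⟨lt_of_le_of_ne h.1.1 (Ne.symm hp), h.1.2⟩
    exact mem_iUnion.2 ⟨m, hm, h.2⟩
  · obtain ⟨m, hm⟩ := mem_iUnion.1 h
    exact 𝒯.slab_subset_cylinder m hm

lemma Mesh.integral_cylinder_eq_sum (𝒯 : Mesh T a b) {f : ℝ × ℝ → ℝ}
    (hf : IntegrableOn f (cylinder T a b)) :
    ∫ p in cylinder T a b, f p = ∑ m, ∫ p in 𝒯.slab m, f p := by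
  rw [setIntegral_congr_set 𝒯.iUnion_slab_ae_eq]
  exact integral_iUnion_fintype 𝒯.measurableSet_slab 𝒯.pairwise_disjoint_slab
    fun m => hf.mono_set (𝒯.slab_subset_cylinder m)

lemma memLp_cylinder_of_continuous {f : ℝ × ℝ → ℝ} (hf : Continuous f) (p : ℝ≥0∞) :
    MemLp f p (volume.restrict (cylinder T a b)) := by
  obtain ⟨B, hB⟩ := ((isCompact_Icc (a := (0 : ℝ)) (b := T)).prod
    (isCompact_Icc (a := a) (b := b))).exists_bound_of_continuousOn hf.continuousOn
  refine MemLp.of_bound hf.aestronglyMeasurable B ?_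
  filter_upwards [ae_restrict_mem measurableSet_cylinder] with z hz
  exact hB z ⟨hz.1, Ioo_subset_Icc_self hz.2⟩

end Slabs

/-! ### Reduction of the Maxwell problem to scalar error problems. -/

section Problem

variable {T a b : ℝ} {𝒯 : Mesh T a b} {k : ℕ} {δ s : ℝ} {F : ℝ × ℝ → Vec 4} {K : Set ℝ}
  {W0 : ℝ → Vec 3} {W : ℝ → ℝ → Vec 3} {Wh : Fin 𝒯.M → ℝ → ℝ → Vec 3} {n : Vec 3}

lemma IsMaxwellSolution.memLp_initial (H : IsMaxwellSolution T a b F W0 W) (hT : 0 < T) :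
    MemLp W0 2 (volume.restrict (Ioo a b)) :=
  (H.memLp_slice 0 ⟨le_rfl, hT.le⟩).ae_eq H.initial

/-- Every characteristic component of the error solves a scalar error problem. -/
lemma IsMaxwellSolution.isScalarErrorProblem (H : IsMaxwellSolution T a b F W0 W) (hT : 0 < T)
    (hF : MemLp F 2 (volume.restrict (cylinder T a b))) (hK : IsClosed K)
    (hW : ∀ t ∈ Icc 0 T, Function.support (W t) ⊆ K) {d : ℝ} (hd : 0 < d) (hdab : a + d < b)
    (hKd : K ⊆ Icc (a + d) (b - d)) (hWh : 𝒯.IsSDSolution k δ F W0 Wh)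
    (hn : IsCharacteristic s n) :
    𝒯.IsScalarErrorProblem k δ s K (fun m t y => inner ℝ (Wh m t y) n)
      (fun m z => inner ℝ (𝒯.slabResidual F Wh m z) (hat n))
      (fun m z => inner ℝ (𝒯.slabResidual F Wh m z) (act M₁ n))
      (fun m z => inner ℝ (𝒯.slabResidual F Wh m z) (act M₂ n))
      (fun m z => ‖𝒯.slabResidual F Wh m z‖)
      (fun y => inner ℝ (W0 y) n) (fun y => inner ℝ (W T y) n)
      (fun z => inner ℝ (F z) (hat n)) where
  sd := hWh.isScalarSD (by linarith) hF (H.memLp_initial hT) hn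
  memLp_WT := (H.memLp_slice T ⟨hT.le, le_rfl⟩).inner_const n
  re_eq m := by
    filter_upwards [𝒯.ae_exists_elem m] with z ⟨j, hj⟩
    rw [𝒯.pdt_inner hWh.1 hj, 𝒯.pdx_inner hWh.1 hj, Mesh.slabResidual, maxwellOp, inner_sub_left,
      inner_add_left, inner_act_M₁_hat, hn.inner_act_M₂_hat]
  off_support m := by
    have h0 := ae_restrict_of_ae_restrict_of_subset (𝒯.slab_subset_cylinder m)
      (H.ae_source_eq_zero_cylinder hT hF hK hW)
    filter_upwards [𝒯.ae_exists_elem m, h0] with z ⟨j, hj⟩ hz hzK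
    rw [𝒯.pdt_inner hWh.1 hj, 𝒯.pdx_inner hWh.1 hj, Mesh.slabResidual, hz hzK, zero_sub,
      inner_neg_left, inner_neg_left, inner_zero_left]
    have := hn.dissipative (dt (Wh m) z.1 z.2) (dx (Wh m) z.1 z.2)
    exact ⟨rfl, by rw [maxwellOp]; linarith⟩
  w0_eq_zero := (H.ae_initial_eq_zero hT hW).mono fun y hy hyK => by rw [hy hyK, inner_zero_left]
  WT_eq_zero y hy := by
    have : W T y = 0 := by
      by_contra h
      exact hy (hW T ⟨hT.le, le_rfl⟩ h)
    rw [this, inner_zero_left]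
  duality χ hχ := by
    rw [H.duality hT hF hK hW hd hdab hKd hn hχ]
    refine 𝒯.integral_cylinder_eq_sum ((hF.inner_const _).integrable_mul_fun ?_)
    exact memLp_cylinder_of_continuous (hχ.contDiff.continuous.comp (by fun_prop)) 2

end Problem


/-! ### The scalar energy in terms of the residual norms. -/

section ResidualNorms

variable {T a b : ℝ} {𝒯 : Mesh T a b} {k : ℕ} {δ s : ℝ} {F : ℝ × ℝ → Vec 4}
  {W0 : ℝ → Vec 3} {Wh : Fin 𝒯.M → ℝ → ℝ → Vec 3} {n : Vec 3}

lemma ofReal_sqrt_integral_norm_sq {α E : Type*} [MeasurableSpace α] {μ : Measure α}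
    [NormedAddCommGroup E] {f : α → E} (hf : MemLp f 2 μ) :
    ENNReal.ofReal (Real.sqrt (∫ z, ‖f z‖ ^ 2 ∂μ)) = eLpNorm f 2 μ := by
  rw [hf.eLpNorm_eq_integral_rpow_norm two_ne_zero ENNReal.ofNat_ne_top, Real.sqrt_eq_rpow]
  simp

variable {d : ℕ} {f : Fin 𝒯.M → ℝ × ℝ → Vec d}

lemma Mesh.sum_indicator_slab (𝒯 : Mesh T a b) (f : Fin 𝒯.M → ℝ × ℝ → Vec d) {m : Fin 𝒯.M}
    {z : ℝ × ℝ} (hz : z ∈ 𝒯.slab m) : ∑ i, (𝒯.slab i).indicator (f i) z = f m z := by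
  rw [Finset.sum_eq_single m, indicator_of_mem hz]
  · intro i _ hi
    exact indicator_of_notMem (fun h => (𝒯.pairwise_disjoint_slab hi).le_bot ⟨h, hz⟩) _
  · exact fun h => absurd (Finset.mem_univ m) h

lemma Mesh.memLp_sum_indicator_slab (hf : ∀ m, MemLp (f m) 2 (volume.restrict (𝒯.slab m))) :
    MemLp (fun z => ∑ m, (𝒯.slab m).indicator (f m) z) 2 (volume.restrict (cylinder T a b)) := by
  refine memLp_finsetSum _ fun m _ => ?_
  rw [memLp_indicator_iff_restrict (𝒯.measurableSet_slab m),
    Measure.restrict_restrict_of_subset (𝒯.slab_subset_cylinder m)]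
  exact hf m

lemma Mesh.integral_norm_sq_sum_indicator_slab
    (hf : ∀ m, MemLp (f m) 2 (volume.restrict (𝒯.slab m))) (c : ℝ) :
    ∫ z in cylinder T a b, ‖c • ∑ m, (𝒯.slab m).indicator (f m) z‖ ^ 2 =
      ∑ m, c ^ 2 * ∫ z in 𝒯.slab m, ‖f m z‖ ^ 2 := by
  have l := ((𝒯.memLp_sum_indicator_slab hf).const_smul c).norm.integrable_sq
  refine (𝒯.integral_cylinder_eq_sum l).trans (Finset.sum_congr rfl fun m _ => ?_)
  rw [← integral_const_mul]
  refine setIntegral_congr_fun (𝒯.measurableSet_slab m) fun z hz => ?_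
  simp only [Pi.smul_apply]
  rw [𝒯.sum_indicator_slab f hz, norm_smul, mul_pow, Real.norm_eq_abs, sq_abs]

lemma Mesh.integral_slab_snd (𝒯 : Mesh T a b) (m : Fin 𝒯.M) (f : ℝ → ℝ) :
    ∫ z in 𝒯.slab m, f z.2 = (𝒯.t m.succ - 𝒯.t m.castSucc) * ∫ y in Ioo a b, f y := by
  rw [𝒯.restrict_slab m, integral_fun_snd]
  simp [(𝒯.t_lt m).le]

lemma Mesh.memLp_slab_snd (𝒯 : Mesh T a b) (m : Fin 𝒯.M) {f : ℝ → Vec d}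
    (hf : MemLp f 2 (volume.restrict (Ioo a b))) :
    MemLp (fun z : ℝ × ℝ => f z.2) 2 (volume.restrict (𝒯.slab m)) := by
  rw [𝒯.restrict_slab m]
  exact hf.comp_snd _

lemma Mesh.memLp_residual₁ (hF : MemLp F 2 (volume.restrict (cylinder T a b)))
    (hWh : Wh ∈ 𝒯.feSpace k) :
    MemLp (𝒯.residual₁ F Wh) 2 (volume.restrict (cylinder T a b)) :=
  𝒯.memLp_sum_indicator_slab fun m => 𝒯.memLp_slabResidual hF hWh m

lemma Mesh.memLp_slab_jump (hab : a < b) (hW0 : MemLp W0 2 (volume.restrict (Ioo a b)))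
    (hWh : Wh ∈ 𝒯.feSpace k) (h : ℝ) (m : Fin 𝒯.M) :
    MemLp (fun z : ℝ × ℝ => h⁻¹ • (𝒯.plus Wh m z.2 - 𝒯.minus W0 Wh m.castSucc z.2)) 2
      (volume.restrict (𝒯.slab m)) :=
  𝒯.memLp_slab_snd m (((𝒯.memLp_plus hab hWh m).sub (𝒯.memLp_minus hab hW0 hWh _)).const_smul h⁻¹)

lemma Mesh.memLp_residual₂ (hab : a < b) (hW0 : MemLp W0 2 (volume.restrict (Ioo a b)))
    (hWh : Wh ∈ 𝒯.feSpace k) (h : ℝ) :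
    MemLp (𝒯.residual₂ h W0 Wh) 2 (volume.restrict (cylinder T a b)) :=
  𝒯.memLp_sum_indicator_slab fun m => 𝒯.memLp_slab_jump hab hW0 hWh h m

/-- The second residual is the jump divided by h and constant in time, so h times it has as squared
norm the sum of the step lengths times the squared jumps, with no power of h left. The factor 4
comes from ‖n‖ ≤ 2. -/
lemma Mesh.energy_le (hab : a < b) (hF : MemLp F 2 (volume.restrict (cylinder T a b)))
    (hW0 : MemLp W0 2 (volume.restrict (Ioo a b))) (hWh : Wh ∈ 𝒯.feSpace k) {h : ℝ} (hh : 0 < h)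
    (hn : IsCharacteristic s n) :
    𝒯.energy h (fun m z => ‖𝒯.slabResidual F Wh m z‖) (fun y => inner ℝ (W0 y) n)
        (fun m t y => inner ℝ (Wh m t y) n) ≤
      4 * ((∫ z in cylinder T a b, ‖h • 𝒯.residual₁ F Wh z‖ ^ 2)
        + ∫ z in cylinder T a b, ‖h • 𝒯.residual₂ h W0 Wh z‖ ^ 2) := by
  have e1 : ∫ z in cylinder T a b, ‖h • 𝒯.residual₁ F Wh z‖ ^ 2 =
      ∑ m, h ^ 2 * ∫ z in 𝒯.slab m, ‖𝒯.slabResidual F Wh m z‖ ^ 2 :=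
    𝒯.integral_norm_sq_sum_indicator_slab (fun m => 𝒯.memLp_slabResidual hF hWh m) h
  have e2 : ∫ z in cylinder T a b, ‖h • 𝒯.residual₂ h W0 Wh z‖ ^ 2 =
      ∑ m, (𝒯.t m.succ - 𝒯.t m.castSucc) *
        ∫ y in Ioo a b, ‖𝒯.plus Wh m y - 𝒯.minus W0 Wh m.castSucc y‖ ^ 2 := by
    refine (𝒯.integral_norm_sq_sum_indicator_slab
      (fun m => 𝒯.memLp_slab_jump hab hW0 hWh h m) h).trans (Finset.sum_congr rfl fun m _ => ?_)
    rw [← 𝒯.integral_slab_snd m fun y => ‖𝒯.plus Wh m y - 𝒯.minus W0 Wh m.castSucc y‖ ^ 2,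
      ← integral_const_mul]
    refine integral_congr_ae (ae_of_all _ fun z => ?_)
    simp only [norm_smul, mul_pow, norm_inv, Real.norm_eq_abs, inv_pow, sq_abs]
    field_simp
  rw [e1, e2, ← Finset.sum_add_distrib, Finset.mul_sum]
  refine Finset.sum_le_sum fun m _ => ?_
  have lJ : MemLp (fun y => 𝒯.plus Wh m y - 𝒯.minus W0 Wh m.castSucc y) 2
      (volume.restrict (Ioo a b)) := (𝒯.memLp_plus hab hWh m).sub (𝒯.memLp_minus hab hW0 hWh _)
  have hJ : ∀ y, 𝒯.jump (fun y => inner ℝ (W0 y) n) (fun m t y => inner ℝ (Wh m t y) n) m y =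
      inner ℝ (𝒯.plus Wh m y - 𝒯.minus W0 Wh m.castSucc y) n := fun y => by
    rw [Mesh.jump, 𝒯.trace_inner, inner_sub_left]; rfl
  have i1 : ∫ y in Ioo a b,
      𝒯.jump (fun y => inner ℝ (W0 y) n) (fun m t y => inner ℝ (Wh m t y) n) m y ^ 2 ≤
      4 * ∫ y in Ioo a b, ‖𝒯.plus Wh m y - 𝒯.minus W0 Wh m.castSucc y‖ ^ 2 := by
    simp only [hJ]
    rw [← integral_const_mul]
    refine integral_mono (lJ.inner_const n).integrable_sq (lJ.norm.integrable_sq.const_mul _)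
      fun y => ?_
    have := pow_le_pow_left₀ (abs_nonneg _) (abs_inner_le_two_mul_norm
      (𝒯.plus Wh m y - 𝒯.minus W0 Wh m.castSucc y) n hn.norm_le) 2
    rw [sq_abs] at this
    exact this.trans_eq (by ring)
  have i2 : 0 ≤ h ^ 2 * ∫ z in 𝒯.slab m, ‖𝒯.slabResidual F Wh m z‖ ^ 2 :=
    mul_nonneg (sq_nonneg _) (integral_nonneg fun _ => sq_nonneg _)
  have i3 := mul_le_mul_of_nonneg_left i1 (sub_nonneg.2 (𝒯.t_lt m).le)
  linarith

end ResidualNorms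

/-! ### Components of vector test functions and the margin around K. -/

section TestFunctions

variable {a b : ℝ}

lemma isTest_inner {χ : ℝ → Vec 3} (h1 : ContDiff ℝ ∞ χ) (h2 : HasCompactSupport χ)
    (h3 : tsupport χ ⊆ Ioo a b) (n : Vec 3) : IsTest a b fun y => inner ℝ (χ y) n := by
  have hs : Function.support (fun y => inner ℝ (χ y) n) ⊆ Function.support χ := fun y hy h => by
    exact hy (by simp [h])
  exact ⟨h1.inner ℝ contDiff_const, h2.mono hs, (closure_mono hs).trans h3⟩

lemma memLp_Ioo_of_continuous_vec {f : ℝ → Vec 3} (hf : Continuous f) (p : ℝ≥0∞) :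
    MemLp f p (volume.restrict (Ioo a b)) :=
  memLp_of_inner fun _ => memLp_Ioo_of_continuous (hf.inner continuous_const) p

lemma integral_inner_sq_le {χ : ℝ → Vec 3} (hχ : Continuous χ) {n : Vec 3} (hn : ‖n‖ ≤ 2) :
    ∫ y in Ioo a b, inner ℝ (χ y) n ^ 2 ≤ 4 * ∫ y in Ioo a b, ‖χ y‖ ^ 2 := by
  have l := memLp_Ioo_of_continuous_vec (a := a) (b := b) hχ 2
  rw [← integral_const_mul]
  refine integral_mono (l.inner_const n).integrable_sq (l.norm.integrable_sq.const_mul _)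
    fun y => ?_
  have := pow_le_pow_left₀ (abs_nonneg _) (abs_inner_le_two_mul_norm (χ y) n hn) 2
  rw [sq_abs] at this
  exact this.trans_eq (by ring)

lemma sqrt_h1Sq_inner_le {χ : ℝ → Vec 3} (hχ : ContDiff ℝ ∞ χ) {n : Vec 3} (hn : ‖n‖ ≤ 2) :
    Real.sqrt (h1Sq a b fun y => inner ℝ (χ y) n) ≤ 2 * h1Norm a b χ := by
  have h2 : (2 : ℝ) = Real.sqrt 4 := by
    rw [show (4 : ℝ) = 2 ^ 2 by norm_num, Real.sqrt_sq zero_le_two]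
  rw [h1Norm, h2, ← Real.sqrt_mul (by norm_num), mul_add]
  have e : deriv (fun y => inner ℝ (χ y) n) = fun y => inner ℝ (deriv χ y) n :=
    funext fun y => deriv_inner_const (hχ.differentiable (by simp) y) n
  rw [h1Sq, e]
  exact Real.sqrt_le_sqrt (add_le_add (integral_inner_sq_le hχ.continuous hn)
    (integral_inner_sq_le (hχ.continuous_deriv (by simp)) hn))

lemma sqrt_add_le_add_sqrt {x y : ℝ} (hx : 0 ≤ x) (hy : 0 ≤ y) :
    Real.sqrt (x + y) ≤ Real.sqrt x + Real.sqrt y := by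
  refine Real.sqrt_le_iff.2 ⟨by positivity, ?_⟩
  rw [add_sq, Real.sq_sqrt hx, Real.sq_sqrt hy]
  linarith [mul_nonneg (Real.sqrt_nonneg x) (Real.sqrt_nonneg y)]

lemma exists_margin {K : Set ℝ} (hab : a < b) (hK : IsCompact K) (hKΩ : K ⊆ Ioo a b) :
    ∃ d, 0 < d ∧ a + d < b ∧ K ⊆ Icc (a + d) (b - d) := by
  rcases K.eq_empty_or_nonempty with rfl | hne
  · exact ⟨(b - a) / 2, by linarith, by linarith, empty_subset _⟩
  obtain ⟨x, hx⟩ := hK.exists_isLeast hne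
  obtain ⟨y, hy⟩ := hK.exists_isGreatest hne
  refine ⟨min (x - a) (b - y), lt_min (by linarith [(hKΩ hx.1).1]) (by linarith [(hKΩ hy.1).2]),
    ?_, fun z hz => ⟨?_, ?_⟩⟩
  · linarith [min_le_left (x - a) (b - y), (hKΩ hx.1).2]
  · linarith [min_le_left (x - a) (b - y), hx.2 hz]
  · linarith [min_le_right (x - a) (b - y), hy.2 hz]

end TestFunctions


/-! ### Recombination of the components and the final estimate. -/

section ErrorEstimate

variable {T a b : ℝ}

/-- The error estimate tested with a smooth vector field. -/
theorem Mesh.exists_error_bound (hT : 0 < T) (hab : a < b) {K : Set ℝ} (hK : IsClosed K)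
    {d : ℝ} (hd : 0 < d) (hdab : a + d < b) (hKd : K ⊆ Icc (a + d) (b - d)) {k : ℕ} (hk : 1 ≤ k)
    {δ₀ c₀ : ℝ} (hδ₀ : 0 < δ₀) (hc₀ : 0 < c₀) :
    ∃ C : ℝ, 0 ≤ C ∧ ∀ (𝒯 : Mesh T a b) (h : ℝ), 0 < h → 𝒯.IsQuasiUniform c₀ h →
    ∀ (F : ℝ × ℝ → Vec 4), MemLp F 2 (volume.restrict (cylinder T a b)) →
    ∀ (W0 : ℝ → Vec 3) (W : ℝ → ℝ → Vec 3), IsMaxwellSolution T a b F W0 W →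
    (∀ t ∈ Icc 0 T, Function.support (W t) ⊆ K) →
    ∀ Wh : Fin 𝒯.M → ℝ → ℝ → Vec 3, 𝒯.IsSDSolution k (δ₀ * h) F W0 Wh →
    ∀ χ : ℝ → Vec 3, ContDiff ℝ ∞ χ → HasCompactSupport χ → tsupport χ ⊆ Ioo a b →
    ∫ y in Ioo a b, inner ℝ (W T y - 𝒯.minus W0 Wh (Fin.last 𝒯.M) y) (χ y) ≤
      C * (Real.sqrt ((∫ z in cylinder T a b, ‖h • 𝒯.residual₁ F Wh z‖ ^ 2)
        + ∫ z in cylinder T a b, ‖h • 𝒯.residual₂ h W0 Wh z‖ ^ 2) * h1Norm a b χ) := by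
  obtain ⟨C₁, hC₁, hb₁⟩ := Mesh.exists_scalar_bound hT hab hk hδ₀ hc₀ hd hdab hKd (Or.inl rfl)
  obtain ⟨C₂, hC₂, hb₂⟩ := Mesh.exists_scalar_bound hT hab hk hδ₀ hc₀ hd hdab hKd (Or.inr rfl)
  -- Each component costs 4 `C`, a factor 2 from the energy and 2 from the test function. The
  -- weights are 1 and 1/2 for the two components of speed 1, and 1/2 for the one of speed -1.
  refine ⟨6 * C₁ + 2 * C₂, by positivity, ?_⟩
  intro 𝒯 h hh hqu F hF W0 W H hW Wh hWh χ h1 h2 h3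
  have hW0 := H.memLp_initial hT
  set E := (∫ z in cylinder T a b, ‖h • 𝒯.residual₁ F Wh z‖ ^ 2)
    + ∫ z in cylinder T a b, ‖h • 𝒯.residual₂ h W0 Wh z‖ ^ 2 with hE
  set D := h1Norm a b χ with hD
  set e : ℝ → Vec 3 := fun y => W T y - 𝒯.minus W0 Wh (Fin.last 𝒯.M) y with he
  have le : MemLp e 2 (volume.restrict (Ioo a b)) :=
    (H.memLp_slice T ⟨hT.le, le_rfl⟩).sub (𝒯.memLp_minus hab hW0 hWh.1 _)
  have lχ := memLp_Ioo_of_continuous_vec (a := a) (b := b) h1.continuous 2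
  have comp : ∀ {s : ℝ} {n : Vec 3} {C : ℝ}, IsCharacteristic s n → 0 ≤ C →
      (∀ (𝒯 : Mesh T a b) (h : ℝ), 0 < h → 𝒯.IsQuasiUniform c₀ h →
        ∀ (w : Fin 𝒯.M → ℝ → ℝ → ℝ) (re rp rq ρ : Fin 𝒯.M → ℝ × ℝ → ℝ) (w0 WT : ℝ → ℝ)
          (fe : ℝ × ℝ → ℝ), 𝒯.IsScalarErrorProblem k (δ₀ * h) s K w re rp rq ρ w0 WT fe →
        ∀ χ, IsTest a b χ → |∫ y in Ioo a b, (WT y - 𝒯.trace w0 w (Fin.last 𝒯.M) y) * χ y| ≤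
          C * (Real.sqrt (𝒯.energy h ρ w0 w) * Real.sqrt (h1Sq a b χ))) →
      ∫ y in Ioo a b, inner ℝ (e y) n * inner ℝ (χ y) n ≤ 4 * C * (Real.sqrt E * D) := by
    intro s n C hn hC hb
    have key := hb 𝒯 h hh hqu _ _ _ _ _ _ _ _
      (H.isScalarErrorProblem hT hF hK hW hd hdab hKd hWh hn) _ (isTest_inner h1 h2 h3 n)
    simp only [𝒯.trace_inner, ← inner_sub_left] at key
    refine (le_abs_self _).trans (key.trans ?_)
    have k1 : Real.sqrt (𝒯.energy h (fun m z => ‖𝒯.slabResidual F Wh m z‖)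
        (fun y => inner ℝ (W0 y) n) (fun m t y => inner ℝ (Wh m t y) n)) ≤ 2 * Real.sqrt E := by
      have h2 : (2 : ℝ) = Real.sqrt 4 := by
        rw [show (4 : ℝ) = 2 ^ 2 by norm_num, Real.sqrt_sq zero_le_two]
      rw [h2, ← Real.sqrt_mul (by norm_num)]
      exact Real.sqrt_le_sqrt (𝒯.energy_le hab hF hW0 hWh.1 hh hn)
    have k2 := sqrt_h1Sq_inner_le (a := a) (b := b) h1 hn.norm_le
    calc _ ≤ C * ((2 * Real.sqrt E) * (2 * D)) := by gcongr
      _ = _ := by ring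
  have i : ∀ n, Integrable (fun y => inner ℝ (e y) n * inner ℝ (χ y) n)
      (volume.restrict (Ioo a b)) := fun n =>
    (le.inner_const n).integrable_mul_fun (lχ.inner_const n)
  have c1 := comp isCharacteristic_electric hC₁ hb₁
  have c2 := comp (isCharacteristic_transverse (Or.inl rfl)) hC₁ hb₁
  have c3 := comp (isCharacteristic_transverse (Or.inr rfl)) hC₂ hb₂
  have i12 : Integrable (fun y => inner ℝ (e y) !₂[1, 0, 0] * inner ℝ (χ y) !₂[1, 0, 0]
      + 1 / 2 * (inner ℝ (e y) !₂[0, 1, 1] * inner ℝ (χ y) !₂[0, 1, 1]))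
      (volume.restrict (Ioo a b)) := (i _).add ((i _).const_mul _)
  rw [integral_congr_ae (ae_of_all _ fun y => inner_eq_characteristic_sum (e y) (χ y)),
    integral_add i12 ((i _).const_mul _),
    integral_add (i _) ((i _).const_mul _), integral_const_mul, integral_const_mul]
  linarith

end ErrorEstimate

end VlasovMaxwell

theorem mainTheorem2 (T : ℝ) (hT : 0 < T) (a b : ℝ) (hab : a < b)
    (K : Set ℝ) (hK : IsCompact K) (hKΩ : K ⊆ Ioo a b)
    (k : ℕ) (hk : 1 ≤ k) (δ₀ : ℝ) (hδ₀ : 0 < δ₀) (c₀ : ℝ) (hc₀ : 0 < c₀) :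
    ∃ C : ℝ, 0 ≤ C ∧
      ∀ (𝒯 : VlasovMaxwell.Mesh T a b) (h : ℝ), 0 < h → 𝒯.IsQuasiUniform c₀ h →
      ∀ (Ωv : Set (VlasovMaxwell.Vec 2)) (ρb : ℝ → ℝ) (f : ℝ → ℝ → VlasovMaxwell.Vec 2 → ℝ),
        (∀ᵐ p ∂(volume.restrict (VlasovMaxwell.cylinder T a b)), IntegrableOn (f p.1 p.2) Ωv) →
        MemLp (VlasovMaxwell.source Ωv ρb f) 2 (volume.restrict (VlasovMaxwell.cylinder T a b)) →
      ∀ (W0 : ℝ → VlasovMaxwell.Vec 3) (W : ℝ → ℝ → VlasovMaxwell.Vec 3),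
        VlasovMaxwell.IsMaxwellSolution T a b (VlasovMaxwell.source Ωv ρb f) W0 W →
        (∀ t ∈ Icc 0 T, Function.support (W t) ⊆ K) →
      ∀ Wh : Fin 𝒯.M → ℝ → ℝ → VlasovMaxwell.Vec 3,
        𝒯.IsSDSolution k (δ₀ * h) (VlasovMaxwell.source Ωv ρb f) W0 Wh →
        VlasovMaxwell.hNegOneNorm a b (fun x => W T x - 𝒯.minus W0 Wh (Fin.last 𝒯.M) x) ≤
          ENNReal.ofReal C *
            (eLpNorm (fun p => h • 𝒯.residual₁ (VlasovMaxwell.source Ωv ρb f) Wh p) 2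
                (volume.restrict (VlasovMaxwell.cylinder T a b))
              + eLpNorm (fun p => h • 𝒯.residual₂ h W0 Wh p) 2
                (volume.restrict (VlasovMaxwell.cylinder T a b))) := by
  obtain ⟨d, hd, hdab, hKd⟩ := VlasovMaxwell.exists_margin hab hK hKΩ
  obtain ⟨C, hC, hbound⟩ := VlasovMaxwell.Mesh.exists_error_bound hT hab hK.isClosed hd hdab hKd hk
    hδ₀ hc₀
  refine ⟨C, hC, ?_⟩
  intro 𝒯 h hh hqu Ωv ρb f _ hF W0 W H hW Wh hWh
  have l₁ : MemLp (fun p => h • 𝒯.residual₁ (VlasovMaxwell.source Ωv ρb f) Wh p) 2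
      (volume.restrict (VlasovMaxwell.cylinder T a b)) :=
    (𝒯.memLp_residual₁ hF hWh.1).const_smul h
  have l₂ : MemLp (fun p => h • 𝒯.residual₂ h W0 Wh p) 2
      (volume.restrict (VlasovMaxwell.cylinder T a b)) :=
    (𝒯.memLp_residual₂ hab (H.memLp_initial hT) hWh.1 h).const_smul h
  rw [← VlasovMaxwell.ofReal_sqrt_integral_norm_sq l₁,
    ← VlasovMaxwell.ofReal_sqrt_integral_norm_sq l₂,
    ← ENNReal.ofReal_add (Real.sqrt_nonneg _) (Real.sqrt_nonneg _), ← ENNReal.ofReal_mul hC]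
  -- Clearing the denominator also covers a test function of norm zero: the numerator is then
  -- bounded by 0, and the quotient is 0.
  refine iSup₂_le fun χ hχ => ENNReal.div_le_of_le_mul ?_
  obtain ⟨h1, h2, h3⟩ := hχ
  rw [← ENNReal.ofReal_mul (by positivity)]
  refine ENNReal.ofReal_le_ofReal ((hbound 𝒯 h hh hqu _ hF W0 W H hW Wh hWh χ h1 h2 h3).trans ?_)
  rw [mul_assoc]
  refine mul_le_mul_of_nonneg_left (mul_le_mul_of_nonneg_right ?_ (Real.sqrt_nonneg _)) hC
  exact VlasovMaxwell.sqrt_add_le_add_sqrt (integral_nonneg fun _ => sq_nonneg _)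
    (integral_nonneg fun _ => sq_nonneg _)
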